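/- Let $n,m\in\mathbb N$, $T\in(0,\infty)$, and let $W=(W_1,\dots,W_m)^\top$ be an $m$-dimensional Brownian motion on a complete probability space $(\Omega,\mathcal F,P)$, where $(\mathcal F_s)_{s\in[0,T]}$ is the augmented natural filtration of $W$. Let $O\in\mathbb R^{n\times n}$ be orthogonal, $\lambda_1,\dots,\lambda_n\in(0,\infty)$, and for $\alpha\in\mathbb R$ set $\gamma^\alpha=O^\top\operatorname{diag}(\lambda_1^\alpha,\dots,\lambda_n^\alpha)O$, $\gamma=\gamma^1$ (price impact). Let $\rho\in\mathbb R^{n\times n}\setminus\{0\}$ (resilience), and let $x,d\in\mathbb R^n$ with $d\neq\gamma x$. Put $$\mathscr B=-\gamma^{-\frac12}\rho\gamma^{\frac12},\qquad \mathscr R=\kappa=\tfrac12\bigl(\gamma^{-\frac12}\rho\gamma^{\frac12}+\gamma^{\frac12}\rho^\top\gamma^{-\frac12}\bigr),\qquad \nu(s)=e^{s\rho},\qquad h_0=\gamma^{-\frac12}d-\gamma^{\frac12}x,$$ and assume that $\kappa$ is positive definite. \emph{Strategies.} For an $\mathbb R^n$-valued progressively measurable process $X=(X(s))_{s\in[0,T]}$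 with prescribed value $X(0-)=x$ and $\int_0^T\|X(s)\|^2ds<\infty$ a.s., the associated deviation is $D^X(0-)=d$ and $$D^X(r)=\gamma X(r)+\nu(r)^{-1}\Bigl(d-\gamma x-\int_0^r\nu(s)\rho\gamma X(s)\,ds\Bigr),\quad r\in[0,T].$$ Let $\mathcal A^{pm}_0(x,d)$ be the set of such $X$ with $X(T)=0$ and $E\bigl[\int_0^T\|\gamma^{-\frac12}D^X(s)\|^2ds\bigr]<\infty$, identified up to $dP\times ds$-null sets, and set $$J^{pm}_0(x,d,X)=\tfrac12E\bigl[D^X(T)^\top\gamma^{-1}D^X(T)\,\big|\,\mathcal F_0\bigr]+E\Bigl[\int_0^TD^X(s)^\top\gamma^{-\frac12}\kappa\gamma^{-\frac12}D^X(s)\,ds\,\Big|\,\mathcal F_0\Bigr]-\tfrac12d^\top\gamma^{-1}d.$$ Let $\mathcal A^{fv}_0(x,d)$ be the set of adapted càdlàg finite-variation processes $X$ with $X(0-)=x$, $X(T)=0$ such that the solution $D$ of $dD(s)=-\rho D(s)\,ds+\gamma\,dX(s)$, $D(0-)=d$, satisfies $E\bigl[\int_0^T\|\gamma^{-\frac12}D(s)\|^2ds\bigr]<\infty$.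 \emph{Claim.} The inverse matrices below exist, and the following hold. (i) The Riccati BSDE $$d\mathscr Y(s)=\mathscr Y(s)\mathscr B\mathscr R^{-1}\mathscr B^\top\mathscr Y(s)\,ds+\sum_{k=1}^m\mathscr Z^k(s)\,dW_k(s),\quad s\in[0,T],\qquad\mathscr Y(T)=\tfrac12I_n,$$ has exactly one solution $(\mathscr Y,\mathscr Z)$ with $\mathscr Y$ symmetric-matrix-valued, bounded, adapted and continuous and with $\mathscr Z^1,\dots,\mathscr Z^m$ symmetric-matrix-valued, progressively measurable and square integrable ($\mathscr Y$ unique up to indistinguishability, $\mathscr Z$ unique $dP\times ds$-a.e.), namely $$\mathscr Y(s)=\tfrac12\bigl(I_n+\tfrac12(T-s)\mathscr B\mathscr R^{-1}\mathscr B^\top\bigr)^{-1},\quad s\in[0,T],\qquad\mathscr Z=0.$$ (ii) The associated feedback matrix is $\theta(s)=-\mathscr R^{-1}\mathscr B^\top\mathscr Y(s)$, and the unique solution of $d\mathcal H^*(s)=\mathscr B\theta(s)\mathcal H^*(s)\,ds$, $\mathcal H^*(0)=h_0$, is $$\mathcal H^*(s)=h_0-\tfrac12\mathscr B\mathscr R^{-1}\mathscr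 B^\top\bigl(I_n+\tfrac12T\mathscr B\mathscr R^{-1}\mathscr B^\top\bigr)^{-1}h_0\,s,\quad s\in[0,T].$$ (iii) There is a minimizer $X^*$ of $J^{pm}_0(x,d,\cdot)$ over $\mathcal A^{pm}_0(x,d)$, unique up to $dP\times ds$-null sets. It belongs to $\mathcal A^{fv}_0(x,d)$ and is given by $X^*(0-)=x$, $X^*(T)=0$, and, for $s\in[0,T)$, $$X^*(s)=-\tfrac12\gamma^{-\frac12}\Bigl(\mathscr R^{-1}\mathscr B^\top\bigl(I_n+\tfrac12T\mathscr B\mathscr R^{-1}\mathscr B^\top\bigr)^{-1}+2I_n\Bigr)h_0+\tfrac12\gamma^{-\frac12}\mathscr B\mathscr R^{-1}\mathscr B^\top\bigl(I_n+\tfrac12T\mathscr B\mathscr R^{-1}\mathscr B^\top\bigr)^{-1}h_0\,s.$$ In particular, block trades occur at most at the times $0$ and $T$, and the position is affine-linear in between. (iv) The deviation $D^*=D^{X^*}$ (which also solves $dD^*=-\rho D^*ds+\gamma\,dX^*$) satisfies $D^*(0-)=d$ and $$D^*(s)=-\tfrac12\gamma^{\frac12}\mathscr R^{-1}\mathscr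 B^\top\bigl(I_n+\tfrac12T\mathscr B\mathscr R^{-1}\mathscr B^\top\bigr)^{-1}h_0,\ s\in[0,T),\qquad D^*(T)=\gamma^{\frac12}\bigl(I_n+\tfrac12T\mathscr B\mathscr R^{-1}\mathscr B^\top\bigr)^{-1}h_0;$$ in particular it is constant on $[0,T)$. -/

import Mathlib

open MeasureTheory ProbabilityTheory Filter Topology Matrix
open scoped ENNReal

noncomputable section

namespace TradeExecution

/-! ### Time interval, Brownian motion and its filtration -/

/-- The time interval `[0, T]`. -/
abbrev Time (T : ℝ) : Type := Set.Icc (0 : ℝ) T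

/-- The time interval carries the restriction of Lebesgue measure as `volume`. -/
instance instMeasureSpaceTime (T : ℝ) : MeasureSpace (Time T) := Measure.Subtype.measureSpace

/-- The initial time `0`. -/
def startTime {T : ℝ} (hT : 0 < T) : Time T := ⟨0, Set.left_mem_Icc.2 hT.le⟩

/-- The terminal time `T`. -/
def endTime {T : ℝ} (hT : 0 < T) : Time T := ⟨T, Set.right_mem_Icc.2 hT.le⟩

/-- `W` is an `m`-dimensional standard Brownian motion on `[0, T]` with respect to `ℱ`. -/
structure IsBrownianMotion {T : ℝ} {Ω : Type*} {mΩ : MeasurableSpace Ω} {m : ℕ}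
    (ℱ : Filtration (Time T) mΩ) (P : Measure Ω) (W : Fin m → Time T → Ω → ℝ) : Prop where
  adapted : ∀ k, StronglyAdapted ℱ (W k)
  zero : ∀ᵐ ω ∂P, ∀ k, ∀ s : Time T, (s : ℝ) = 0 → W k s ω = 0
  continuous : ∀ᵐ ω ∂P, ∀ k, Continuous fun s => W k s ω
  indep : ∀ s t : Time T, s ≤ t →
    Indep (MeasurableSpace.comap (fun ω k => W k t ω - W k s ω) inferInstance) (ℱ s) P
  law : ∀ s t : Time T, s ≤ t →
    P.map (fun ω k => W k t ω - W k s ω)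
      = Measure.pi fun _ : Fin m => gaussianReal 0 (Real.toNNReal ((t : ℝ) - s))

/-- `ℱ` is the natural filtration of `W`, augmented by all `P`-null sets
(`P A = 0` means that `A` is contained in a measurable set of probability zero). -/
def IsAugmentedNaturalFiltration {T : ℝ} {Ω : Type*} {mΩ : MeasurableSpace Ω} {m : ℕ}
    (ℱ : Filtration (Time T) mΩ) (P : Measure Ω) (W : Fin m → Time T → Ω → ℝ) : Prop :=
  ∀ t : Time T, (ℱ t : MeasurableSpace Ω) =
    (⨆ k : Fin m, ⨆ s : Set.Iic t, MeasurableSpace.comap (W k s) inferInstance)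
      ⊔ MeasurableSpace.generateFrom {A : Set Ω | P A = 0}

/-! ### The Itô integral of square-integrable integrands -/

/-- A simple process `∑_{i < N} cᵢ 1_{(tᵢ, tᵢ₊₁]}` with bounded `ℱ_{tᵢ}`-measurable `cᵢ`. -/
structure SimpleProcess {T : ℝ} {Ω : Type*} {mΩ : MeasurableSpace Ω}
    (ℱ : Filtration (Time T) mΩ) where
  N : ℕ
  t : ℕ → Time T
  mono : Monotone t
  c : ℕ → Ω → ℝ
  meas : ∀ i, StronglyMeasurable[ℱ (t i)] (c i)
  bdd : ∃ K : ℝ, ∀ i ω, |c i ω| ≤ K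

namespace SimpleProcess

variable {T : ℝ} {Ω : Type*} {mΩ : MeasurableSpace Ω} {ℱ : Filtration (Time T) mΩ}

/-- The value of a simple process at time `s`. -/
def eval (S : SimpleProcess ℱ) (s : Time T) (ω : Ω) : ℝ :=
  ∑ i ∈ Finset.range S.N, (Set.Ioc (S.t i) (S.t (i + 1))).indicator (fun _ => S.c i ω) s

/-- The elementary integral `∫₀^r S dw = ∑ cᵢ (w(tᵢ₊₁ ∧ r) - w(tᵢ ∧ r))`. -/
def integral (S : SimpleProcess ℱ) (w : Time T → Ω → ℝ) (r : Time T) (ω : Ω) : ℝ :=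
  ∑ i ∈ Finset.range S.N, S.c i ω * (w (min (S.t (i + 1)) r) ω - w (min (S.t i) r) ω)

end SimpleProcess

/-- `I` is the Itô integral process `r ↦ ∫₀^r H dw` of the square-integrable integrand `H`:
a continuous adapted process which is the `L²` limit of the elementary integrals of simple
processes that approximate `H` in `L²(P ⊗ ds)`. -/
def IsItoIntegral {T : ℝ} {Ω : Type*} {mΩ : MeasurableSpace Ω}
    (ℱ : Filtration (Time T) mΩ) (P : Measure Ω) (w : Time T → Ω → ℝ)
    (H I : Time T → Ω → ℝ) : Prop :=
  IsStronglyProgressive ℱ H ∧ StronglyAdapted ℱ I ∧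
  (∀ᵐ ω ∂P, Continuous fun s => I s ω) ∧
  ∃ S : ℕ → SimpleProcess ℱ,
    Tendsto (fun j => ∫⁻ ω, (∫⁻ s, ENNReal.ofReal ((H s ω - (S j).eval s ω) ^ 2)) ∂P)
      atTop (𝓝 0) ∧
    ∀ r : Time T,
      Tendsto (fun j => ∫⁻ ω, ENNReal.ofReal ((I r ω - (S j).integral w r ω) ^ 2) ∂P)
        atTop (𝓝 0)

/-! ### Coefficients

All coefficients are given at a fixed time, as functions of the values of the orthogonal matrix
`O`, the powers `γh = γ^{1/2}` and `γmh = γ^{-1/2}` of the price impact, the resilience `ρ`,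
the drift `μ` and volatility `σ` of the eigenvalues of the price impact, and the risk matrix `Ξ`. -/

section Coefficients

variable {n m : ℕ}

/-- `𝒞^k = ½ Oᵀ diag(σ_{1,k}, …, σ_{n,k}) O`. -/
def coeffC (O : Matrix (Fin n) (Fin n) ℝ) (σ : Matrix (Fin n) (Fin m) ℝ) (k : Fin m) :
    Matrix (Fin n) (Fin n) ℝ :=
  (1 / 2 : ℝ) • (Oᵀ * Matrix.diagonal (fun j => σ j k) * O)

/-- `𝒜 = ½ Oᵀ diag(μ) O - ½ ∑ₖ 𝒞^k 𝒞^k`. -/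
def coeffA (O : Matrix (Fin n) (Fin n) ℝ) (μ : Fin n → ℝ) (σ : Matrix (Fin n) (Fin m) ℝ) :
    Matrix (Fin n) (Fin n) ℝ :=
  (1 / 2 : ℝ) • (Oᵀ * Matrix.diagonal μ * O)
    - (1 / 2 : ℝ) • ∑ k, coeffC O σ k * coeffC O σ k

/-- `ℬ = -γ^{-1/2} ρ γ^{1/2} - Oᵀ diag(μ) O + 2 ∑ₖ 𝒞^k 𝒞^k`. -/
def coeffB (O γh γmh ρ : Matrix (Fin n) (Fin n) ℝ) (μ : Fin n → ℝ)
    (σ : Matrix (Fin n) (Fin m) ℝ) : Matrix (Fin n) (Fin n) ℝ :=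
  -(γmh * ρ * γh) - Oᵀ * Matrix.diagonal μ * O
    + (2 : ℝ) • ∑ k, coeffC O σ k * coeffC O σ k

/-- `κ = ½ Oᵀ diag(μ) O - 2 ∑ₖ 𝒞^k 𝒞^k + ½ γ^{-1/2} ρ γ^{1/2} + ½ γ^{1/2} ρᵀ γ^{-1/2}`. -/
def coeffKappa (O γh γmh ρ : Matrix (Fin n) (Fin n) ℝ) (μ : Fin n → ℝ)
    (σ : Matrix (Fin n) (Fin m) ℝ) : Matrix (Fin n) (Fin n) ℝ :=
  (1 / 2 : ℝ) • (Oᵀ * Matrix.diagonal μ * O)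
    - (2 : ℝ) • ∑ k, coeffC O σ k * coeffC O σ k
    + (1 / 2 : ℝ) • (γmh * ρ * γh) + (1 / 2 : ℝ) • (γh * ρᵀ * γmh)

/-- `𝒬 = γ^{-1/2} Ξ γ^{-1/2}`. -/
def coeffQ (γmh Ξ : Matrix (Fin n) (Fin n) ℝ) : Matrix (Fin n) (Fin n) ℝ :=
  γmh * Ξ * γmh

/-- The driver `g` of the Riccati BSDE. -/
def driver (A B Q R : Matrix (Fin n) (Fin n) ℝ) (C : Fin m → Matrix (Fin n) (Fin n) ℝ)
    (Y : Matrix (Fin n) (Fin n) ℝ) (Z : Fin m → Matrix (Fin n) (Fin n) ℝ) :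
    Matrix (Fin n) (Fin n) ℝ :=
  Y * A + A * Y + Q + ∑ k, (C k * Y * C k + Z k * C k + C k * Z k)
    - (Y * B - Q - (2 : ℝ) • ∑ k, (C k * Y * C k + Z k * C k))
      * (R + (4 : ℝ) • ∑ k, C k * Y * C k)⁻¹
      * (Bᵀ * Y - Q - (2 : ℝ) • ∑ k, (C k * Y * C k + C k * Z k))

/-- The feedback matrix `θ` associated to `(𝒴, 𝒵)`. -/
def feedback (B Q R : Matrix (Fin n) (Fin n) ℝ) (C : Fin m → Matrix (Fin n) (Fin n) ℝ)
    (Y : Matrix (Fin n) (Fin n) ℝ) (Z : Fin m → Matrix (Fin n) (Fin n) ℝ) :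
    Matrix (Fin n) (Fin n) ℝ :=
  -((R + (4 : ℝ) • ∑ k, C k * Y * C k)⁻¹
      * (Bᵀ * Y - Q - (2 : ℝ) • ∑ k, (C k * Y * C k + C k * Z k)))

end Coefficients

/-! ### The Riccati BSDE and the SDE of the optimal state -/

section Equations

variable {T : ℝ} {Ω : Type*} {mΩ : MeasurableSpace Ω} {n m : ℕ}

/-- `(Y, Z)` is a solution of the Riccati BSDE
`dY = -g(Y, Z) ds + ∑ₖ Z^k dWₖ`, `Y(T) = ½ I`. -/
structure IsRiccatiSolution (hT : 0 < T) (ℱ : Filtration (Time T) mΩ) (P : Measure Ω)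
    (W : Fin m → Time T → Ω → ℝ)
    (A B Q R : Time T → Ω → Matrix (Fin n) (Fin n) ℝ)
    (C : Fin m → Time T → Ω → Matrix (Fin n) (Fin n) ℝ)
    (Y : Time T → Ω → Matrix (Fin n) (Fin n) ℝ)
    (Z : Fin m → Time T → Ω → Matrix (Fin n) (Fin n) ℝ) : Prop where
  symm_Y : ∀ s ω, (Y s ω).IsSymm
  bounded_Y : ∃ K : ℝ, ∀ᵐ ω ∂P, ∀ s i j, |Y s ω i j| ≤ K
  adapted_Y : StronglyAdapted ℱ Y
  continuous_Y : ∀ᵐ ω ∂P, Continuous fun s => Y s ω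
  symm_Z : ∀ k s ω, (Z k s ω).IsSymm
  prog_Z : ∀ k, IsStronglyProgressive ℱ (Z k)
  sq_integrable_Z : ∀ k,
    ∫⁻ ω, (∫⁻ s, ENNReal.ofReal (∑ i, ∑ j, (Z k s ω i j) ^ 2)) ∂P < ⊤
  posDef : ∀ᵐ p ∂((volume : Measure (Time T)).prod P),
    (R p.1 p.2 + (4 : ℝ) • ∑ k, C k p.1 p.2 * Y p.1 p.2 * C k p.1 p.2).PosDef
  integrable_driver : ∀ᵐ ω ∂P, ∀ i j, Integrable (fun s : Time T =>
    driver (A s ω) (B s ω) (Q s ω) (R s ω) (fun k => C k s ω) (Y s ω) (fun k => Z k s ω) i j)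
  terminal : ∀ᵐ ω ∂P, Y (endTime hT) ω = (1 / 2 : ℝ) • (1 : Matrix (Fin n) (Fin n) ℝ)
  equation : ∃ N : Fin m → Time T → Ω → Matrix (Fin n) (Fin n) ℝ,
    (∀ k i j, IsItoIntegral ℱ P (W k) (fun s ω => Z k s ω i j) (fun s ω => N k s ω i j)) ∧
    ∀ᵐ ω ∂P, ∀ s i j, Y s ω i j = Y (startTime hT) ω i j
      - (∫ r in Set.Iic s, driver (A r ω) (B r ω) (Q r ω) (R r ω) (fun k => C k r ω) (Y r ω)
          (fun k => Z k r ω) i j)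
      + ∑ k, N k s ω i j

/-- `H` is a solution of the SDE
`dH = (A + B θ) H ds + ∑ₖ C^k (I - 2 θ) H dWₖ`, `H(0) = h₀`. -/
structure IsOptimalStateSolution (hT : 0 < T) (ℱ : Filtration (Time T) mΩ) (P : Measure Ω)
    (W : Fin m → Time T → Ω → ℝ)
    (A B θ : Time T → Ω → Matrix (Fin n) (Fin n) ℝ)
    (C : Fin m → Time T → Ω → Matrix (Fin n) (Fin n) ℝ)
    (h₀ : Fin n → ℝ) (H : Time T → Ω → Fin n → ℝ) : Prop where
  adapted : StronglyAdapted ℱ H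
  continuous : ∀ᵐ ω ∂P, Continuous fun s => H s ω
  initial : ∀ᵐ ω ∂P, H (startTime hT) ω = h₀
  integrable_drift : ∀ᵐ ω ∂P, Integrable fun s : Time T =>
    (A s ω + B s ω * θ s ω) *ᵥ H s ω
  equation : ∃ N : Fin m → Time T → Ω → Fin n → ℝ,
    (∀ k i, IsItoIntegral ℱ P (W k)
      (fun s ω => ((C k s ω * (1 - (2 : ℝ) • θ s ω)) *ᵥ H s ω) i) (fun s ω => N k s ω i)) ∧
    ∀ᵐ ω ∂P, ∀ s, H s ω =
      h₀ + (∫ r in Set.Iic s, (A r ω + B r ω * θ r ω) *ᵥ H r ω) + ∑ k, N k s ω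

end Equations

/-! ### The multi-asset Obizhaeva–Wang model -/

/-- The data of the model with constant price impact `γ = Oᵀ diag(λ) O` and constant
resilience `ρ`. Zero drift `μ = 0` and volatility `σ = 0` of the eigenvalues `λ` and zero risk
term `Ξ = 0` are put into the general coefficients below. -/
structure OWModel (n : ℕ) where
  O : Matrix (Fin n) (Fin n) ℝ
  orth : O ∈ Matrix.orthogonalGroup (Fin n) ℝ
  lam : Fin n → ℝ
  lam_pos : ∀ j, 0 < lam j
  rho : Matrix (Fin n) (Fin n) ℝ

/-- An `ℝⁿ`-valued process on `[0, T]` together with its value at `0-`. -/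
structure StartedProcess (T : ℝ) (Ω : Type*) (n : ℕ) where
  pre : Fin n → ℝ
  path : Time T → Ω → Fin n → ℝ

namespace OWModel

variable {n : ℕ} (M : OWModel n)

/-- The power `γ^α = Oᵀ diag(λ₁^α, …, λₙ^α) O`. -/
def gammaPow (α : ℝ) : Matrix (Fin n) (Fin n) ℝ :=
  M.Oᵀ * Matrix.diagonal (fun j => M.lam j ^ α) * M.O

/-- The price impact `γ = Oᵀ diag(λ) O`. -/
def gamma : Matrix (Fin n) (Fin n) ℝ := M.Oᵀ * Matrix.diagonal M.lam * M.O

/-- `𝒜` with `μ = 0` and `σ = 0`; `m` is the dimension of the Brownian motion. -/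
def scrA (m : ℕ) : Matrix (Fin n) (Fin n) ℝ :=
  coeffA M.O 0 (0 : Matrix (Fin n) (Fin m) ℝ)

/-- `ℬ` with `μ = 0` and `σ = 0`. -/
def scrB (m : ℕ) : Matrix (Fin n) (Fin n) ℝ :=
  coeffB M.O (M.gammaPow (1 / 2)) (M.gammaPow (-(1 / 2))) M.rho 0
    (0 : Matrix (Fin n) (Fin m) ℝ)

/-- `𝒞^k` with `σ = 0`. -/
def scrC (m : ℕ) (k : Fin m) : Matrix (Fin n) (Fin n) ℝ :=
  coeffC M.O (0 : Matrix (Fin n) (Fin m) ℝ) k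

/-- `κ` with `μ = 0` and `σ = 0`. -/
def kappa (m : ℕ) : Matrix (Fin n) (Fin n) ℝ :=
  coeffKappa M.O (M.gammaPow (1 / 2)) (M.gammaPow (-(1 / 2))) M.rho 0
    (0 : Matrix (Fin n) (Fin m) ℝ)

/-- `𝒬` with `Ξ = 0`. -/
def scrQ : Matrix (Fin n) (Fin n) ℝ := coeffQ (M.gammaPow (-(1 / 2))) 0

/-- `ℛ = 𝒬 + κ`. -/
def scrR (m : ℕ) : Matrix (Fin n) (Fin n) ℝ := M.scrQ + M.kappa m

/-- `ℬ ℛ⁻¹ ℬᵀ`. -/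
def scrBRB (m : ℕ) : Matrix (Fin n) (Fin n) ℝ := M.scrB m * (M.scrR m)⁻¹ * (M.scrB m)ᵀ

/-- `γ^{-1/2} d - γ^{1/2} x`. -/
def initialState (x d : Fin n → ℝ) : Fin n → ℝ :=
  M.gammaPow (-(1 / 2)) *ᵥ d - M.gammaPow (1 / 2) *ᵥ x

/-- The fundamental matrix `ν(s) = e^{sρ}`, the solution of `dν = ν ρ ds`, `ν(0) = I`. -/
def nu (s : ℝ) : Matrix (Fin n) (Fin n) ℝ := NormedSpace.exp (s • M.rho)

theorem nu_zero : M.nu 0 = 1 := by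
  simp [nu]

section

open scoped Matrix.Norms.Operator

theorem hasDerivAt_nu (s : ℝ) (i j : Fin n) :
    HasDerivAt (fun r => M.nu r i j) ((M.nu s * M.rho) i j) s := by
  have h : HasDerivAt (fun r : ℝ => M.nu r) (M.nu s * M.rho) s :=
    hasDerivAt_exp_smul_const M.rho s
  exact (Matrix.entryLinearMap ℝ ℝ i j).toContinuousLinearMap.hasFDerivAt.comp_hasDerivAt s h

end

/-- `½ (I + ½ (T - s) ℬ ℛ⁻¹ ℬᵀ)⁻¹`. -/
def explicitY (m : ℕ) (T s : ℝ) : Matrix (Fin n) (Fin n) ℝ :=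
  (1 / 2 : ℝ) • (1 + ((1 / 2) * (T - s)) • M.scrBRB m)⁻¹

/-- `h₀ - ½ ℬ ℛ⁻¹ ℬᵀ (I + ½ T ℬ ℛ⁻¹ ℬᵀ)⁻¹ h₀ s` with `h₀ = γ^{-1/2} d - γ^{1/2} x`. -/
def explicitState (m : ℕ) (T : ℝ) (x d : Fin n → ℝ) (s : ℝ) : Fin n → ℝ :=
  M.initialState x d - s • (((1 / 2 : ℝ) •
    (M.scrBRB m * (1 + ((1 / 2) * T) • M.scrBRB m)⁻¹)) *ᵥ M.initialState x d)

section Deviation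

variable {T : ℝ} {Ω : Type*} {mΩ : MeasurableSpace Ω}

/-- The deviation of a progressively measurable strategy `X` started from `D(0-) = d`:
`D(r) = γ X(r) + ν(r)⁻¹ (d - γ X(0-) - ∫₀^r d(ν(s) γ) X(s))`. As `γ` is constant,
`d(ν(s) γ) = ν(s) ρ γ ds`. -/
def deviation (d : Fin n → ℝ) (X : StartedProcess T Ω n) : StartedProcess T Ω n where
  pre := d
  path r ω := M.gamma *ᵥ X.path r ω
    + (M.nu r)⁻¹ *ᵥ (d - M.gamma *ᵥ X.pre
      - ∫ s in Set.Iic r, (M.nu s * M.rho * M.gamma) *ᵥ X.path s ω)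

/-- `D` solves `dD = -ρ D ds + γ dX`, `D(0-) = d`, almost surely. As `γ` is constant,
`∫_{[0,r]} γ dX = γ (X(r) - X(0-))`. -/
def IsFVDeviation (P : Measure Ω) (d : Fin n → ℝ) (X D : StartedProcess T Ω n) : Prop :=
  D.pre = d ∧ ∀ᵐ ω ∂P,
    (Integrable fun s : Time T => M.rho *ᵥ D.path s ω) ∧
    ∀ r, D.path r ω = d - (∫ s in Set.Iic r, M.rho *ᵥ D.path s ω)
      + M.gamma *ᵥ (X.path r ω - X.pre)

/-- `E[∫₀^T ‖γ^{-1/2} D(s)‖² ds] < ∞`. -/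
def SqIntegrableDeviation (P : Measure Ω) (D : StartedProcess T Ω n) : Prop :=
  ∫⁻ ω, (∫⁻ s, ENNReal.ofReal
    ((M.gammaPow (-(1 / 2)) *ᵥ D.path s ω) ⬝ᵥ (M.gammaPow (-(1 / 2)) *ᵥ D.path s ω))) ∂P < ⊤

/-- `∑ₖ E[(∫₀^T |(γ^{-1/2} D)ᵀ Oᵀ diag(σ_{·,k}) O γ^{-1/2} D|² ds)^{1/2}] < ∞`. -/
def VolIntegrableDeviation {m : ℕ} (σ : Matrix (Fin n) (Fin m) ℝ) (P : Measure Ω)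
    (D : StartedProcess T Ω n) : Prop :=
  ∑ k, ∫⁻ ω, (∫⁻ s, ENNReal.ofReal
    (((M.gammaPow (-(1 / 2)) *ᵥ D.path s ω) ⬝ᵥ
      ((M.Oᵀ * Matrix.diagonal (fun j => σ j k) * M.O) *ᵥ
        (M.gammaPow (-(1 / 2)) *ᵥ D.path s ω))) ^ 2)) ^ (1 / 2 : ℝ) ∂P < ⊤

/-- The progressively measurable execution strategies with initial position `x`, initial
deviation `d` and terminal target `ξ`. -/
structure MemPM (hT : 0 < T) (ℱ : Filtration (Time T) mΩ) (P : Measure Ω)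
    (ξ : Ω → Fin n → ℝ) (x d : Fin n → ℝ) (X : StartedProcess T Ω n) : Prop where
  prog : IsStronglyProgressive ℱ X.path
  initial : X.pre = x
  terminal : ∀ᵐ ω ∂P, X.path (endTime hT) ω = ξ ω
  sq_integrable : ∀ᵐ ω ∂P, ∫⁻ s, ENNReal.ofReal (X.path s ω ⬝ᵥ X.path s ω) < ⊤
  dev : M.SqIntegrableDeviation P (M.deviation d X)

/-- The finite-variation execution strategies with initial position `x`, initial deviation `d`
and terminal target `ξ`, in the model with volatility `σ = 0`. -/
structure MemFV (m : ℕ) (hT : 0 < T) (ℱ : Filtration (Time T) mΩ) (P : Measure Ω)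
    (ξ : Ω → Fin n → ℝ) (x d : Fin n → ℝ) (X : StartedProcess T Ω n) : Prop where
  adapted : StronglyAdapted ℱ X.path
  rightContinuous : ∀ᵐ ω ∂P, ∀ s, ContinuousWithinAt (fun r => X.path r ω) (Set.Ici s) s
  leftLimits : ∀ᵐ ω ∂P, ∀ s, ∃ l, Tendsto (fun r => X.path r ω) (𝓝[<] s) (𝓝 l)
  finiteVariation : ∀ᵐ ω ∂P, BoundedVariationOn (fun r => X.path r ω) Set.univ
  initial : X.pre = x
  terminal : ∀ᵐ ω ∂P, X.path (endTime hT) ω = ξ ω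
  dev : ∃ D : StartedProcess T Ω n, M.IsFVDeviation P d X D ∧ StronglyAdapted ℱ D.path ∧
    M.SqIntegrableDeviation P D ∧
    M.VolIntegrableDeviation (0 : Matrix (Fin n) (Fin m) ℝ) P D

/-- The cost functional `J₀^{pm}` with risk matrix `Ξ` and running target `ζ`; `E₀` is the
conditional expectation with respect to `ℱ₀`. -/
def costPMGeneral (m : ℕ) (hT : 0 < T) (ℱ : Filtration (Time T) mΩ) (P : Measure Ω)
    (Ξ : Matrix (Fin n) (Fin n) ℝ) (ζ : Time T → Ω → Fin n → ℝ) (d : Fin n → ℝ)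
    (X : StartedProcess T Ω n) : Ω → ℝ := fun ω =>
  (1 / 2) * (P[fun ω => (M.deviation d X).path (endTime hT) ω ⬝ᵥ
      (M.gammaPow (-1) *ᵥ (M.deviation d X).path (endTime hT) ω) | ℱ (startTime hT)]) ω
  + (P[fun ω => ∫ s, (X.path s ω - ζ s ω) ⬝ᵥ (Ξ *ᵥ (X.path s ω - ζ s ω))
      | ℱ (startTime hT)]) ω
  + (P[fun ω => ∫ s, (M.deviation d X).path s ω ⬝ᵥ
      ((M.gammaPow (-(1 / 2)) * M.kappa m * M.gammaPow (-(1 / 2))) *ᵥ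
        (M.deviation d X).path s ω) | ℱ (startTime hT)]) ω
  - (1 / 2) * (d ⬝ᵥ (M.gammaPow (-1) *ᵥ d))

/-- The cost functional `J₀^{pm}` with `Ξ = 0` and `ζ = 0`. -/
def costPM (m : ℕ) (hT : 0 < T) (ℱ : Filtration (Time T) mΩ) (P : Measure Ω)
    (d : Fin n → ℝ) (X : StartedProcess T Ω n) : Ω → ℝ :=
  M.costPMGeneral m hT ℱ P 0 (fun _ _ => 0) d X

/-- `X` minimizes `J₀^{pm}` over the progressively measurable strategies with target `ξ = 0`. -/
def IsOptimal (m : ℕ) (hT : 0 < T) (ℱ : Filtration (Time T) mΩ) (P : Measure Ω)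
    (x d : Fin n → ℝ) (X : StartedProcess T Ω n) : Prop :=
  M.MemPM hT ℱ P (fun _ => 0) x d X ∧
  ∀ X' : StartedProcess T Ω n, M.MemPM hT ℱ P (fun _ => 0) x d X' →
    M.costPM m hT ℱ P d X ≤ᵐ[P] M.costPM m hT ℱ P d X'

end Deviation

end OWModel

end TradeExecution

end

open TradeExecution

/-!
Put `u = γ^{-1/2} D`, where `D` is the deviation of a strategy `X` with `X(T) = 0`. Integrating the
deviation equation `dD = -ρ D ds + γ dX` gives `γ^{-1/2} D(T) = h₀ + ℬ ∫ u`, so up to a constant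
the cost of `X` is the conditional expectation of the linear-quadratic cost
`½ |h₀ + ℬ ∫ u|² + ∫ uᵀ κ u` of the path of `u`. For a single path, completing the square around
the constant `v` with `2 κ v = -ℬᵀ (h₀ + T ℬ v)` shows that `v` is the unique minimizer. As `v`
does not depend on the path, it is optimal for every conditional expectation, and the optimal
strategy is the one whose rescaled deviation is `v` on `[0, T)`.

Since `𝒜`, `𝒞` and `𝒬` vanish, the driver of the Riccati BSDE depends on `𝒴` only, and the ODE
obtained for `𝒵 = 0` is solved by inverting an affine function of time. Taking conditional
expectations removes the martingale part from the difference `e` of two solutions, which leaves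
`E|e(t)| ≤ C ∫_t^T E|e(s)| ds` and hence `e = 0` by Grönwall's inequality; the Itô isometry then
yields `𝒵 = 0`.
-/

namespace TradeExecution

/-! ### Integration over the time interval -/

section Time

variable {T : ℝ} {E : Type*} [NormedAddCommGroup E]

instance isFiniteMeasure_volume_time (T : ℝ) : IsFiniteMeasure (volume : Measure (Time T)) where
  measure_univ_lt_top := by
    rw [Measure.Subtype.volume_univ measurableSet_Icc.nullMeasurableSet, Real.volume_Icc]
    exact ENNReal.ofReal_lt_top

theorem measurePreserving_time_coe (T : ℝ) :
    MeasurePreserving ((↑) : Time T → ℝ) volume (volume.restrict (Set.Icc 0 T)) :=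
  measurePreserving_subtype_coe measurableSet_Icc

theorem measurableEmbedding_time_coe (T : ℝ) : MeasurableEmbedding ((↑) : Time T → ℝ) :=
  MeasurableEmbedding.subtype_coe measurableSet_Icc

theorem integrable_of_continuous_time {f : Time T → E} (hf : Continuous f) :
    Integrable f :=
  hf.integrable_of_hasCompactSupport (HasCompactSupport.of_compactSpace f)

theorem integrable_iccExtend_iff (hT : 0 < T) {f : Time T → E} :
    IntegrableOn (Set.IccExtend hT.le f) (Set.Icc 0 T) ↔ Integrable f := by
  rw [IntegrableOn, ← (measurePreserving_time_coe T).integrable_comp_emb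
    (measurableEmbedding_time_coe T)]
  simp only [Function.comp_def, Set.IccExtend_val]

variable [NormedSpace ℝ E]

theorem setIntegral_preimage_time_coe (f : ℝ → E) {A : Set ℝ} (hA : MeasurableSet A) :
    ∫ s in ((↑) : Time T → ℝ) ⁻¹' A, f s = ∫ s in A ∩ Set.Icc 0 T, f s := by
  rw [(measurePreserving_time_coe T).setIntegral_preimage_emb (measurableEmbedding_time_coe T),
    Measure.restrict_restrict hA]

theorem setIntegral_Iic_time (f : ℝ → E) (r : Time T) :
    ∫ s in Set.Iic r, f s = ∫ s in (0 : ℝ)..r, f s := by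
  have hinter : Set.Iic (r : ℝ) ∩ Set.Icc 0 T = Set.Icc 0 (r : ℝ) := by
    ext s
    have := r.2.2
    simp only [Set.mem_inter_iff, Set.mem_Iic, Set.mem_Icc]
    grind
  rw [intervalIntegral.integral_of_le r.2.1, ← integral_Icc_eq_integral_Ioc, ← hinter]
  exact setIntegral_preimage_time_coe f measurableSet_Iic

theorem setIntegral_Ioi_time (f : ℝ → E) (r : Time T) :
    ∫ s in Set.Ioi r, f s = ∫ s in (r : ℝ)..T, f s := by
  have hinter : Set.Ioi (r : ℝ) ∩ Set.Icc 0 T = Set.Ioc (r : ℝ) T := by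
    ext s
    have := r.2.1
    simp only [Set.mem_inter_iff, Set.mem_Ioi, Set.mem_Icc, Set.mem_Ioc]
    grind
  rw [intervalIntegral.integral_of_le r.2.2, ← hinter]
  exact setIntegral_preimage_time_coe f measurableSet_Ioi

theorem setIntegral_Iic_const [CompleteSpace E] (r : Time T) (c : E) :
    ∫ _ in Set.Iic r, c = (r : ℝ) • c := by
  simpa using setIntegral_Iic_time (fun _ => c) r

theorem le_endTime (hT : 0 < T) (s : Time T) : s ≤ endTime hT := s.2.2

theorem Iic_endTime (hT : 0 < T) : Set.Iic (endTime hT) = Set.univ :=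
  Set.eq_univ_of_forall (le_endTime hT)

theorem setIntegral_Ioi_eq_integral_sub {f : Time T → E} (hf : Integrable f) (t : Time T) :
    ∫ s in Set.Ioi t, f s = (∫ s, f s) - ∫ s in Set.Iic t, f s := by
  rw [← Set.compl_Iic, eq_sub_iff_add_eq', integral_add_compl measurableSet_Iic hf]

theorem volume_real_Ioc_time {a b : Time T} (hab : a ≤ b) :
    (volume : Measure (Time T)).real (Set.Ioc a b) = b - a := by
  have hsub : Set.Ioc (a : ℝ) b ⊆ Set.Icc 0 T :=
    fun s hs => ⟨a.2.1.trans hs.1.le, hs.2.trans b.2.2⟩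
  have h := (measurePreserving_time_coe T).measureReal_preimage
    (measurableSet_Ioc (a := (a : ℝ)) (b := b)).nullMeasurableSet
  rw [measureReal_restrict_apply measurableSet_Ioc, Set.inter_eq_left.2 hsub,
    Real.volume_real_Ioc_of_le hab] at h
  exact h

theorem ae_lt_endTime (T : ℝ) : ∀ᵐ s : Time T, (s : ℝ) < T := by
  have h : ∀ᵐ x : ℝ ∂volume.restrict (Set.Icc 0 T), x ≠ T := ae_restrict_of_ae (Measure.ae_ne _ T)
  filter_upwards [(measurePreserving_time_coe T).quasiMeasurePreserving.ae h] with s hs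
  exact lt_of_le_of_ne s.2.2 hs

theorem setIntegral_Iic_eq_intervalIntegral (hT : 0 < T) (f : Time T → E) (r : Time T) :
    ∫ s in Set.Iic r, f s = ∫ s in (0 : ℝ)..r, Set.IccExtend hT.le f s := by
  simpa only [Set.IccExtend_val] using setIntegral_Iic_time (Set.IccExtend hT.le f) r

theorem setIntegral_Iic_eq_sub_of_hasDerivAt [CompleteSpace E] {f f' : ℝ → E}
    (hf : ∀ s ∈ Set.Icc 0 T, HasDerivAt f (f' s) s) (hf' : ContinuousOn f' (Set.Icc 0 T))
    (t : Time T) : ∫ s in Set.Iic t, f' s = f t - f 0 := by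
  have hsub : Set.uIcc 0 (t : ℝ) ⊆ Set.Icc 0 T := by
    rw [Set.uIcc_of_le t.2.1]
    exact Set.Icc_subset_Icc le_rfl t.2.2
  rw [setIntegral_Iic_time, intervalIntegral.integral_eq_sub_of_hasDerivAt
    (fun s hs => hf s (hsub hs)) (hf'.mono hsub).intervalIntegrable]

theorem continuous_setIntegral_Iic (hT : 0 < T) {f : Time T → E} (hf : Integrable f) :
    Continuous fun r : Time T => ∫ s in Set.Iic r, f s := by
  have h := intervalIntegral.continuousOn_primitive_interval (a := 0) (b := T)
    (by rw [Set.uIcc_of_le hT.le]; exact (integrable_iccExtend_iff hT).2 hf)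
  rw [Set.uIcc_of_le hT.le] at h
  simp only [setIntegral_Iic_eq_intervalIntegral hT]
  exact continuousOn_iff_continuous_domRestrict.1 h

end Time

/-! ### Grönwall inequalities -/

section Gronwall

-- In the norm `sup (u / w)` the hypotheses say that the monotone operator `u ↦ C ∫_{A t} u` is a
-- contraction with constant `1 / 2`, while `u` does not decrease under it.
theorem le_zero_of_le_mul_setIntegral {α : Type*} [MeasurableSpace α] {μ : Measure α}
    {A : α → Set α} {u w : α → ℝ} {C K : ℝ} (hC : 0 ≤ C) (hu : ∀ t, 0 ≤ u t)
    (huA : ∀ t, u t ≤ C * ∫ s in A t, u s ∂μ) (hw : ∀ t, 0 < w t) (hwi : Integrable w μ)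
    (hwA : ∀ t, C * ∫ s in A t, w s ∂μ ≤ w t / 2) (huw : ∀ t, u t ≤ K * w t) (t : α) :
    u t ≤ 0 := by
  have : Nonempty α := ⟨t⟩
  set S : ℝ := ⨆ t, u t / w t
  have hbdd : BddAbove (Set.range fun t => u t / w t) :=
    ⟨K, Set.forall_mem_range.2 fun t => (div_le_iff₀ (hw t)).2 (huw t)⟩
  have huS : ∀ t, u t ≤ S * w t := fun t => (div_le_iff₀ (hw t)).1 (le_ciSup hbdd t)
  have hS_nonneg : 0 ≤ S := Real.iSup_nonneg fun t => div_nonneg (hu t) (hw t).le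
  have hS_half : S ≤ S / 2 := by
    refine ciSup_le fun t => (div_le_iff₀ (hw t)).2 ?_
    calc u t ≤ C * ∫ s in A t, u s ∂μ := huA t
      _ ≤ C * ∫ s in A t, S * w s ∂μ := by
        refine mul_le_mul_of_nonneg_left ?_ hC
        exact integral_mono_of_nonneg (ae_of_all _ hu) (hwi.const_mul S).integrableOn
          (ae_of_all _ huS)
      _ = S * (C * ∫ s in A t, w s ∂μ) := by rw [integral_const_mul]; ring
      _ ≤ S * (w t / 2) := mul_le_mul_of_nonneg_left (hwA t) hS_nonneg
      _ = S / 2 * w t := by ring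
  calc u t ≤ S * w t := huS t
    _ = 0 := by rw [show S = 0 by linarith, zero_mul]

theorem integral_exp_mul {c : ℝ} (hc : c ≠ 0) (a b : ℝ) :
    ∫ s in a..b, Real.exp (c * s) = c⁻¹ * (Real.exp (c * b) - Real.exp (c * a)) := by
  rw [intervalIntegral.integral_comp_mul_left (f := Real.exp) hc, integral_exp, smul_eq_mul]

variable {T : ℝ} {u : Time T → ℝ} {C K : ℝ}

theorem le_zero_of_le_mul_setIntegral_Ioi (hC : 0 ≤ C) (hu : ∀ t, 0 ≤ u t) (huK : ∀ t, u t ≤ K)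
    (huI : ∀ t, u t ≤ C * ∫ s in Set.Ioi t, u s) (t : Time T) : u t ≤ 0 := by
  obtain rfl | hC := hC.eq_or_lt
  · simpa using huI t
  refine le_zero_of_le_mul_setIntegral (A := fun t : Time T => Set.Ioi t)
    (K := K * Real.exp (2 * C * T))
    (w := fun s : Time T => Real.exp (-(2 * C) * (s : ℝ))) hC.le hu huI (fun s => Real.exp_pos _)
    (integrable_of_continuous_time (by fun_prop)) (fun s => ?_) (fun s => ?_) t
  · rw [setIntegral_Ioi_time (fun s => Real.exp (-(2 * C) * s)),
      integral_exp_mul (by linarith)]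
    have hCinv : C * (-(2 * C))⁻¹ = -(1 / 2) := by field_simp
    rw [← mul_assoc, hCinv]
    linarith [Real.exp_pos (-(2 * C) * T)]
  · have hK : 0 ≤ K := (hu s).trans (huK s)
    have h1 : 1 ≤ Real.exp (2 * C * T) * Real.exp (-(2 * C) * s) := by
      rw [← Real.exp_add]
      exact Real.one_le_exp (by nlinarith [s.2.2])
    nlinarith [huK s]

theorem le_zero_of_le_mul_setIntegral_Iic (hC : 0 ≤ C) (hu : ∀ t, 0 ≤ u t) (huK : ∀ t, u t ≤ K)
    (huI : ∀ t, u t ≤ C * ∫ s in Set.Iic t, u s) (t : Time T) : u t ≤ 0 := by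
  obtain rfl | hC := hC.eq_or_lt
  · simpa using huI t
  refine le_zero_of_le_mul_setIntegral (A := fun t : Time T => Set.Iic t) (K := K)
    (w := fun s : Time T => Real.exp (2 * C * (s : ℝ))) hC.le hu huI (fun s => Real.exp_pos _)
    (integrable_of_continuous_time (by fun_prop)) (fun s => ?_) (fun s => ?_) t
  · rw [setIntegral_Iic_time (fun s => Real.exp (2 * C * s)), integral_exp_mul (by linarith),
      mul_zero, Real.exp_zero]
    field_simp
    linarith
  · exact (huK s).trans (le_mul_of_one_le_right ((hu s).trans (huK s))
      (Real.one_le_exp (by have := s.2.1; positivity)))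

end Gronwall

/-! ### Increments of Brownian motion -/

section Gaussian

variable {ι : Type*} [Fintype ι] (v : NNReal)

theorem memLp_eval_pi_gaussianReal (k : ι) :
    MemLp (fun y : ι → ℝ => y k) 2 (Measure.pi fun _ => gaussianReal 0 v) :=
  (memLp_id_gaussianReal 2).comp_measurePreserving
    (measurePreserving_eval (fun _ : ι => gaussianReal 0 v) k)

theorem integral_eval_pi_gaussianReal (k : ι) :
    ∫ y : ι → ℝ, y k ∂(Measure.pi fun _ => gaussianReal 0 v) = 0 := by
  rw [integral_comp_eval (X := fun _ : ι => ℝ) (f := fun z : ℝ => z) (by fun_prop),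
    integral_id_gaussianReal]

theorem integral_eval_mul_eval_pi_gaussianReal [DecidableEq ι] (k l : ι) :
    ∫ y : ι → ℝ, y k * y l ∂(Measure.pi fun _ => gaussianReal 0 v)
      = if k = l then (v : ℝ) else 0 := by
  split_ifs with hkl
  · subst hkl
    rw [integral_comp_eval (X := fun _ : ι => ℝ) (f := fun z : ℝ => z * z) (by fun_prop)]
    simpa only [pow_two, variance_fun_id_gaussianReal] using
      (variance_of_integral_eq_zero (μ := gaussianReal 0 v) (X := fun z => z)
        (by fun_prop) integral_id_gaussianReal).symm
  · have hindep : iIndepFun (fun (i : ι) (y : ι → ℝ) => y i)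
        (Measure.pi fun _ => gaussianReal 0 v) :=
      iIndepFun_pi (X := fun _ z => z) (fun _ => by fun_prop)
    rw [(hindep.indepFun hkl).integral_fun_mul_eq_mul_integral
      (measurable_pi_apply k).aestronglyMeasurable (measurable_pi_apply l).aestronglyMeasurable,
      integral_eval_pi_gaussianReal, zero_mul]

end Gaussian

namespace IsBrownianMotion

variable {T : ℝ} {Ω : Type*} {mΩ : MeasurableSpace Ω} {m : ℕ}
  {ℱ : Filtration (Time T) mΩ} {P : Measure Ω} {W : Fin m → Time T → Ω → ℝ}

theorem stronglyMeasurable_incr (hW : IsBrownianMotion ℱ P W) (k : Fin m) {a b r : Time T}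
    (ha : a ≤ r) (hb : b ≤ r) :
    StronglyMeasurable[ℱ r] fun ω => W k b ω - W k a ω :=
  ((hW.adapted k b).mono (ℱ.mono hb)).sub ((hW.adapted k a).mono (ℱ.mono ha))

theorem measurable_incr (hW : IsBrownianMotion ℱ P W) (a b : Time T) :
    Measurable fun ω k => W k b ω - W k a ω :=
  measurable_pi_lambda _ fun k =>
    (((hW.adapted k b).mono (ℱ.le b)).sub ((hW.adapted k a).mono (ℱ.le a))).measurable

theorem memLp_incr (hW : IsBrownianMotion ℱ P W) (k : Fin m) {a b : Time T} (hab : a ≤ b) :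
    MemLp (fun ω => W k b ω - W k a ω) 2 P := by
  have h := memLp_eval_pi_gaussianReal (Real.toNNReal ((b : ℝ) - a)) k
  rw [← hW.law a b hab] at h
  exact (memLp_map_measure_iff h.1 (hW.measurable_incr a b).aemeasurable).1 h

theorem integral_mul_comp_incr (hW : IsBrownianMotion ℱ P W) {a b : Time T} (hab : a ≤ b)
    {X : Ω → ℝ} (hX : StronglyMeasurable[ℱ a] X) {φ : (Fin m → ℝ) → ℝ} (hφ : Measurable φ) :
    ∫ ω, X ω * φ (fun k => W k b ω - W k a ω) ∂P
      = (∫ ω, X ω ∂P) * ∫ y, φ y ∂(Measure.pi fun _ : Fin m =>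
          gaussianReal 0 (Real.toNNReal ((b : ℝ) - a))) := by
  have hindep : IndepFun X (fun ω k => W k b ω - W k a ω) P :=
    ((IndepFun_iff_Indep _ _ _).2
      (indep_of_indep_of_le_right (hW.indep a b hab) hX.measurable.comap_le)).symm
  rw [← hW.law a b hab, integral_map (hW.measurable_incr a b).aemeasurable
    hφ.aestronglyMeasurable]
  exact (hindep.comp measurable_id hφ).integral_fun_mul_eq_mul_integral
    (hX.mono (ℱ.le a)).aestronglyMeasurable
    (hφ.comp (hW.measurable_incr a b)).aestronglyMeasurable

theorem integral_mul_incr (hW : IsBrownianMotion ℱ P W) (k : Fin m) {a b : Time T} (hab : a ≤ b)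
    {X : Ω → ℝ} (hX : StronglyMeasurable[ℱ a] X) :
    ∫ ω, X ω * (W k b ω - W k a ω) ∂P = 0 := by
  rw [hW.integral_mul_comp_incr hab hX (φ := fun y => y k) (by fun_prop),
    integral_eval_pi_gaussianReal, mul_zero]

theorem integrable_mul_incr_mul_incr (hW : IsBrownianMotion ℱ P W) (k l : Fin m)
    {a b a' b' : Time T} (hab : a ≤ b) (hab' : a' ≤ b') {X : Ω → ℝ} {K : ℝ}
    (hX : AEStronglyMeasurable X P) (hK : ∀ ω, |X ω| ≤ K) :
    Integrable (fun ω => X ω * ((W k b ω - W k a ω) * (W l b' ω - W l a' ω))) P :=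
  ((hW.memLp_incr k hab).integrable_mul (hW.memLp_incr l hab')).bdd_mul hX (ae_of_all _ hK)

theorem integral_mul_incr_mul_incr (hW : IsBrownianMotion ℱ P W) (k l : Fin m)
    {a b b' : Time T} (hab : a ≤ b) (hbb' : b ≤ b') {X : Ω → ℝ} {K : ℝ}
    (hX : StronglyMeasurable[ℱ a] X) (hK : ∀ ω, |X ω| ≤ K) :
    ∫ ω, X ω * ((W k b ω - W k a ω) * (W l b' ω - W l a ω)) ∂P
      = (if k = l then (b : ℝ) - a else 0) * ∫ ω, X ω ∂P := by
  have hX' := (hX.mono (ℱ.le a)).aestronglyMeasurable (μ := P)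
  have hsame : ∫ ω, X ω * ((W k b ω - W k a ω) * (W l b ω - W l a ω)) ∂P
      = (if k = l then (b : ℝ) - a else 0) * ∫ ω, X ω ∂P := by
    rw [hW.integral_mul_comp_incr hab hX (φ := fun y => y k * y l) (by fun_prop),
      integral_eval_mul_eval_pi_gaussianReal, Real.coe_toNNReal _ (sub_nonneg.2 hab), mul_comm]
  have hrest : ∫ ω, X ω * ((W k b ω - W k a ω) * (W l b' ω - W l b ω)) ∂P = 0 := by
    simpa only [mul_assoc, Pi.mul_apply] using hW.integral_mul_incr l hbb'
      ((hX.mono (ℱ.mono hab)).mul (hW.stronglyMeasurable_incr k hab le_rfl))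
  calc ∫ ω, X ω * ((W k b ω - W k a ω) * (W l b' ω - W l a ω)) ∂P
      = ∫ ω, (X ω * ((W k b ω - W k a ω) * (W l b ω - W l a ω))
          + X ω * ((W k b ω - W k a ω) * (W l b' ω - W l b ω))) ∂P :=
        integral_congr_ae (ae_of_all _ fun ω => by ring)
    _ = (if k = l then (b : ℝ) - a else 0) * ∫ ω, X ω ∂P := by
        rw [integral_add (hW.integrable_mul_incr_mul_incr k l hab hab hX' hK)
          (hW.integrable_mul_incr_mul_incr k l hab hbb' hX' hK), hsame, hrest, add_zero]

theorem integral_mul_incr_mul_incr_eq_min (hW : IsBrownianMotion ℱ P W) (k l : Fin m)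
    {a b b' : Time T} (hab : a ≤ b) (hab' : a ≤ b') {X : Ω → ℝ} {K : ℝ}
    (hX : StronglyMeasurable[ℱ a] X) (hK : ∀ ω, |X ω| ≤ K) :
    ∫ ω, X ω * ((W k b ω - W k a ω) * (W l b' ω - W l a ω)) ∂P
      = (if k = l then ((min b b' : Time T) : ℝ) - a else 0) * ∫ ω, X ω ∂P := by
  rcases le_total b b' with h | h
  · rw [min_eq_left h, hW.integral_mul_incr_mul_incr k l hab h hX hK]
  · simp only [min_eq_right h, eq_comm (a := k), mul_comm (W k b _ - W k a _)]
    exact hW.integral_mul_incr_mul_incr l k hab' h hX hK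

theorem integral_mul_incr_mul_mul_incr_of_le (hW : IsBrownianMotion ℱ P W) (k l : Fin m)
    {a b a' b' : Time T} (hab : a ≤ b) (hab' : a' ≤ b') (haa' : a ≤ a') {c c' : Ω → ℝ} {K : ℝ}
    (hc : StronglyMeasurable[ℱ a] c) (hc' : StronglyMeasurable[ℱ a'] c')
    (hK : ∀ ω, |c ω| ≤ K) (hK' : ∀ ω, |c' ω| ≤ K) :
    ∫ ω, (c ω * (W k b ω - W k a ω)) * (c' ω * (W l b' ω - W l a' ω)) ∂P
      = (if k = l then (volume : Measure (Time T)).real (Set.Ioc a b ∩ Set.Ioc a' b') else 0)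
        * ∫ ω, c ω * c' ω ∂P := by
  have hcc' : StronglyMeasurable[ℱ a'] (c * c') := (hc.mono (ℱ.mono haa')).mul hc'
  have hcc'_bdd : ∀ ω, |(c * c') ω| ≤ K * K := fun ω => by
    rw [Pi.mul_apply, abs_mul]
    exact mul_le_mul (hK ω) (hK' ω) (abs_nonneg _) ((abs_nonneg _).trans (hK ω))
  have hpast : ∀ t, a ≤ t → t ≤ a' →
      ∫ ω, (c * c') ω * ((W k t ω - W k a ω) * (W l b' ω - W l a' ω)) ∂P = 0 := fun t _ hta' => by
    simpa only [mul_assoc, Pi.mul_apply] using hW.integral_mul_incr l hab'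
      (hcc'.mul (hW.stronglyMeasurable_incr k haa' hta'))
  have hreorder : ∀ ω, (c ω * (W k b ω - W k a ω)) * (c' ω * (W l b' ω - W l a' ω))
      = (c * c') ω * ((W k b ω - W k a ω) * (W l b' ω - W l a' ω)) := fun ω => by
    rw [Pi.mul_apply]
    ring
  simp only [hreorder, Set.Ioc_inter_Ioc, sup_eq_right.2 haa']
  rcases le_total b a' with hba' | ha'b
  · rw [hpast b hab hba', Set.Ioc_eq_empty (not_lt.2 (inf_le_left.trans hba'))]
    simp
  · have hsplit : ∀ ω, (c * c') ω * ((W k b ω - W k a ω) * (W l b' ω - W l a' ω))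
        = (c * c') ω * ((W k a' ω - W k a ω) * (W l b' ω - W l a' ω))
          + (c * c') ω * ((W k b ω - W k a' ω) * (W l b' ω - W l a' ω)) := fun ω => by ring
    have hint : ∀ {p q : Time T}, p ≤ q → Integrable
        (fun ω => (c * c') ω * ((W k q ω - W k p ω) * (W l b' ω - W l a' ω))) P := fun hpq =>
      hW.integrable_mul_incr_mul_incr k l hpq hab' (hcc'.mono (ℱ.le a')).aestronglyMeasurable
        hcc'_bdd
    simp only [hsplit]
    rw [integral_add (hint haa') (hint ha'b), hpast a' haa' le_rfl, zero_add,
      hW.integral_mul_incr_mul_incr_eq_min k l ha'b hab' hcc' hcc'_bdd,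
      volume_real_Ioc_time (le_inf ha'b hab')]
    rfl

theorem integral_mul_incr_mul_mul_incr (hW : IsBrownianMotion ℱ P W) (k l : Fin m)
    {a b a' b' : Time T} (hab : a ≤ b) (hab' : a' ≤ b') {c c' : Ω → ℝ} {K : ℝ}
    (hc : StronglyMeasurable[ℱ a] c) (hc' : StronglyMeasurable[ℱ a'] c')
    (hK : ∀ ω, |c ω| ≤ K) (hK' : ∀ ω, |c' ω| ≤ K) :
    ∫ ω, (c ω * (W k b ω - W k a ω)) * (c' ω * (W l b' ω - W l a' ω)) ∂P
      = (if k = l then (volume : Measure (Time T)).real (Set.Ioc a b ∩ Set.Ioc a' b') else 0)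
        * ∫ ω, c ω * c' ω ∂P := by
  rcases le_total a a' with h | h
  · exact hW.integral_mul_incr_mul_mul_incr_of_le k l hab hab' h hc hc' hK hK'
  · simpa only [mul_comm, eq_comm (a := l), Set.inter_comm] using
      hW.integral_mul_incr_mul_mul_incr_of_le l k hab' hab h hc' hc hK' hK

end IsBrownianMotion

/-! ### Convergence in `L²` -/

section LTwo

variable {α : Type*} {mα : MeasurableSpace α} {μ : Measure α}

theorem eLpNorm_two_eq_lintegral_ofReal_sq (f : α → ℝ) :
    eLpNorm f 2 μ = (∫⁻ x, ENNReal.ofReal (f x ^ 2) ∂μ) ^ (1 / 2 : ℝ) := by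
  rw [eLpNorm_eq_lintegral_rpow_enorm_toReal two_ne_zero ENNReal.ofNat_ne_top]
  simp only [ENNReal.toReal_ofNat, ← Real.enorm_eq_ofReal (sq_nonneg _), enorm_pow,
    ENNReal.rpow_ofNat]

theorem tendsto_eLpNorm_two_of_tendsto_lintegral {f : ℕ → α → ℝ}
    (h : Tendsto (fun j => ∫⁻ x, ENNReal.ofReal (f j x ^ 2) ∂μ) atTop (𝓝 0)) :
    Tendsto (fun j => eLpNorm (f j) 2 μ) atTop (𝓝 0) := by
  simpa [eLpNorm_two_eq_lintegral_ofReal_sq] using h.ennrpow_const (1 / 2 : ℝ)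

theorem memLp_of_tendsto_eLpNorm_sub {p : ℝ≥0∞} {f : ℕ → α → ℝ} {g : α → ℝ}
    (hf : ∀ j, MemLp (f j) p μ) (hg : AEStronglyMeasurable g μ)
    (h : Tendsto (fun j => eLpNorm (f j - g) p μ) atTop (𝓝 0)) : MemLp g p μ := by
  obtain ⟨j, hj⟩ := (h.eventually (gt_mem_nhds ENNReal.zero_lt_top)).exists
  have hsub : MemLp (f j - g) p μ := ⟨(hf j).1.sub hg, hj⟩
  simpa only [sub_sub_cancel] using (hf j).sub hsub

theorem tendsto_integral_mul_of_tendsto_eLpNorm {f f' : ℕ → α → ℝ} {g g' : α → ℝ}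
    (hf : ∀ j, MemLp (f j) 2 μ) (hf' : ∀ j, MemLp (f' j) 2 μ)
    (hg : AEStronglyMeasurable g μ) (hg' : AEStronglyMeasurable g' μ)
    (h : Tendsto (fun j => eLpNorm (f j - g) 2 μ) atTop (𝓝 0))
    (h' : Tendsto (fun j => eLpNorm (f' j - g') 2 μ) atTop (𝓝 0)) :
    Tendsto (fun j => ∫ x, f j x * f' j x ∂μ) atTop (𝓝 (∫ x, g x * g' x ∂μ)) := by
  have hg2 := memLp_of_tendsto_eLpNorm_sub hf hg h
  have hg2' := memLp_of_tendsto_eLpNorm_sub hf' hg' h'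
  have hinner : ∀ {u v : α → ℝ} (hu : MemLp u 2 μ) (hv : MemLp v 2 μ),
      inner ℝ (hu.toLp u) (hv.toLp v) = ∫ x, u x * v x ∂μ := fun hu hv => by
    rw [L2.inner_def]
    refine integral_congr_ae ?_
    filter_upwards [hu.coeFn_toLp, hv.coeFn_toLp] with x hux hvx
    simp [hux, hvx, mul_comm]
  have hlim := ((Lp.tendsto_Lp_iff_tendsto_eLpNorm'' f hf g hg2).2 h).inner
    ((Lp.tendsto_Lp_iff_tendsto_eLpNorm'' f' hf' g' hg2').2 h') (𝕜 := ℝ)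
  simpa only [hinner] using hlim

end LTwo

/-! ### The Itô integral -/

section Ito

variable {T : ℝ} {Ω : Type*} {mΩ : MeasurableSpace Ω} {m : ℕ}
  {ℱ : Filtration (Time T) mΩ} {P : Measure Ω} {W : Fin m → Time T → Ω → ℝ}

namespace SimpleProcess

theorem stronglyMeasurable_coeff (S : SimpleProcess ℱ) (i : ℕ) : StronglyMeasurable (S.c i) :=
  (S.meas i).mono (ℱ.le _)

theorem memLp_top_coeff (S : SimpleProcess ℱ) (i : ℕ) : MemLp (S.c i) ⊤ P := by
  obtain ⟨K, hK⟩ := S.bdd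
  exact memLp_top_of_bound (S.stronglyMeasurable_coeff i).aestronglyMeasurable K
    (ae_of_all _ (hK i))

theorem memLp_coeff_mul_incr (hW : IsBrownianMotion ℱ P W) (S : SimpleProcess ℱ) (k : Fin m)
    (i : ℕ) {a b : Time T} (hab : a ≤ b) :
    MemLp (fun ω => S.c i ω * (W k b ω - W k a ω)) 2 P :=
  (hW.memLp_incr k hab).mul' (S.memLp_top_coeff i)

theorem memLp_integral (hW : IsBrownianMotion ℱ P W) (S : SimpleProcess ℱ) (k : Fin m)
    (r : Time T) : MemLp (S.integral (W k) r) 2 P :=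
  memLp_finsetSum (f := fun i ω =>
      S.c i ω * (W k (min (S.t (i + 1)) r) ω - W k (min (S.t i) r) ω)) _ fun i _ =>
    S.memLp_coeff_mul_incr hW k i (min_le_min_right _ (S.mono i.le_succ))

theorem eval_eq_sum_indicator_one_mul (S : SimpleProcess ℱ) (s : Time T) (ω : Ω) :
    S.eval s ω = ∑ i ∈ Finset.range S.N,
      (Set.Ioc (S.t i) (S.t (i + 1))).indicator 1 s * S.c i ω := by
  simp [SimpleProcess.eval, Set.indicator_apply]

theorem memLp_indicator_mul_coeff [IsFiniteMeasure P] (S : SimpleProcess ℱ) (i : ℕ) :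
    MemLp (fun p : Time T × Ω => (Set.Ioc (S.t i) (S.t (i + 1))).indicator 1 p.1 * S.c i p.2) 2
      ((volume : Measure (Time T)).prod P) := by
  obtain ⟨K, hK⟩ := S.bdd
  have hmeas : Measurable fun s : Time T =>
      (Set.Ioc (S.t i) (S.t (i + 1))).indicator (1 : Time T → ℝ) s :=
    measurable_one.indicator measurableSet_Ioc
  refine MemLp.of_bound ((hmeas.comp measurable_fst).mul
    ((S.stronglyMeasurable_coeff i).measurable.comp measurable_snd)).aestronglyMeasurable K
    (ae_of_all _ fun p => ?_)
  by_cases hp : p.1 ∈ Set.Ioc (S.t i) (S.t (i + 1))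
  · simpa [Set.indicator_of_mem hp] using hK i p.2
  · simpa [Set.indicator_of_notMem hp] using (abs_nonneg _).trans (hK i p.2)

theorem memLp_eval [IsFiniteMeasure P] (S : SimpleProcess ℱ) :
    MemLp (fun p : Time T × Ω => S.eval p.1 p.2) 2 ((volume : Measure (Time T)).prod P) := by
  simp only [eval_eq_sum_indicator_one_mul]
  exact memLp_finsetSum _ fun i _ => S.memLp_indicator_mul_coeff i

theorem integral_eval_mul_eval [IsFiniteMeasure P] (S S' : SimpleProcess ℱ) :
    ∫ p : Time T × Ω, S.eval p.1 p.2 * S'.eval p.1 p.2 ∂((volume : Measure (Time T)).prod P)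
      = ∑ i ∈ Finset.range S.N, ∑ j ∈ Finset.range S'.N, (volume : Measure (Time T)).real
          (Set.Ioc (S.t i) (S.t (i + 1)) ∩ Set.Ioc (S'.t j) (S'.t (j + 1)))
        * ∫ ω, S.c i ω * S'.c j ω ∂P := by
  have hint : ∀ i j, Integrable (fun p : Time T × Ω =>
      (Set.Ioc (S.t i) (S.t (i + 1))).indicator 1 p.1 * S.c i p.2
        * ((Set.Ioc (S'.t j) (S'.t (j + 1))).indicator 1 p.1 * S'.c j p.2))
      ((volume : Measure (Time T)).prod P) := fun i j =>
    (S.memLp_indicator_mul_coeff i).integrable_mul (S'.memLp_indicator_mul_coeff j)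
  simp only [eval_eq_sum_indicator_one_mul, Finset.sum_mul_sum]
  rw [integral_finsetSum _ fun i _ => integrable_finsetSum _ fun j _ => hint i j]
  refine Finset.sum_congr rfl fun i _ => ?_
  rw [integral_finsetSum _ fun j _ => hint i j]
  refine Finset.sum_congr rfl fun j _ => ?_
  refine (integral_congr_ae (ae_of_all _ fun p => mul_mul_mul_comm _ _ _ _)).trans ?_
  rw [integral_prod_mul (fun s : Time T => (Set.Ioc (S.t i) (S.t (i + 1))).indicator 1 s
      * (Set.Ioc (S'.t j) (S'.t (j + 1))).indicator 1 s) (fun ω => S.c i ω * S'.c j ω)]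
  rw [← integral_indicator_one (measurableSet_Ioc.inter measurableSet_Ioc),
    Set.inter_indicator_one]
  rfl

theorem integral_endTime (hT : 0 < T) (S : SimpleProcess ℱ) (w : Time T → Ω → ℝ) (ω : Ω) :
    S.integral w (endTime hT) ω
      = ∑ i ∈ Finset.range S.N, S.c i ω * (w (S.t (i + 1)) ω - w (S.t i) ω) := by
  simp only [SimpleProcess.integral, min_eq_left (le_endTime hT _)]

theorem integral_endTime_mul_endTime [IsFiniteMeasure P] (hT : 0 < T)
    (hW : IsBrownianMotion ℱ P W) (S S' : SimpleProcess ℱ) (k l : Fin m) :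
    ∫ ω, S.integral (W k) (endTime hT) ω * S'.integral (W l) (endTime hT) ω ∂P
      = if k = l then ∫ p : Time T × Ω, S.eval p.1 p.2 * S'.eval p.1 p.2
          ∂((volume : Measure (Time T)).prod P) else 0 := by
  obtain ⟨K, hK⟩ := S.bdd
  obtain ⟨K', hK'⟩ := S'.bdd
  have hm : ∀ i, S.t i ≤ S.t (i + 1) := fun i => S.mono i.le_succ
  have hm' : ∀ i, S'.t i ≤ S'.t (i + 1) := fun i => S'.mono i.le_succ
  have hint : ∀ i j, Integrable (fun ω => S.c i ω * (W k (S.t (i + 1)) ω - W k (S.t i) ω)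
      * (S'.c j ω * (W l (S'.t (j + 1)) ω - W l (S'.t j) ω))) P := fun i j =>
    (S.memLp_coeff_mul_incr hW k i (hm i)).integrable_mul
      (S'.memLp_coeff_mul_incr hW l j (hm' j))
  simp only [integral_endTime, Finset.sum_mul_sum]
  rw [integral_finsetSum _ fun i _ => integrable_finsetSum _ fun j _ => hint i j]
  have hsum : ∀ i, ∫ ω, ∑ j ∈ Finset.range S'.N, S.c i ω * (W k (S.t (i + 1)) ω - W k (S.t i) ω)
        * (S'.c j ω * (W l (S'.t (j + 1)) ω - W l (S'.t j) ω)) ∂P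
      = ∑ j ∈ Finset.range S'.N, (if k = l then (volume : Measure (Time T)).real
          (Set.Ioc (S.t i) (S.t (i + 1)) ∩ Set.Ioc (S'.t j) (S'.t (j + 1))) else 0)
        * ∫ ω, S.c i ω * S'.c j ω ∂P := fun i => by
    rw [integral_finsetSum _ fun j _ => hint i j]
    exact Finset.sum_congr rfl fun j _ => hW.integral_mul_incr_mul_mul_incr k l (hm i) (hm' j)
      (S.meas i) (S'.meas j) (K := max K K') (fun ω => (hK i ω).trans (le_max_left _ _))
      fun ω => (hK' j ω).trans (le_max_right _ _)
  simp only [hsum]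
  split_ifs with hkl
  · exact (integral_eval_mul_eval S S').symm
  · simp

theorem integral_endTime_sub (hT : 0 < T) (S : SimpleProcess ℱ) (w : Time T → Ω → ℝ)
    (t : Time T) (ω : Ω) :
    S.integral w (endTime hT) ω - S.integral w t ω
      = ∑ i ∈ Finset.range S.N, S.c i ω * (w (max (S.t (i + 1)) t) ω - w (max (S.t i) t) ω) := by
  have hminmax : ∀ u : Time T, w (min u t) ω + w (max u t) ω = w u ω + w t ω := fun u => by
    rcases le_total u t with h | h
    · rw [min_eq_left h, max_eq_right h]
    · rw [min_eq_right h, max_eq_left h, add_comm]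
  rw [integral_endTime, SimpleProcess.integral, ← Finset.sum_sub_distrib]
  refine Finset.sum_congr rfl fun i _ => ?_
  linear_combination S.c i ω * (hminmax (S.t i) - hminmax (S.t (i + 1)))

theorem setIntegral_integral_endTime [IsFiniteMeasure P] (hT : 0 < T)
    (hW : IsBrownianMotion ℱ P W) (S : SimpleProcess ℱ) (k : Fin m) {t : Time T} {A : Set Ω}
    (hA : MeasurableSet[ℱ t] A) :
    ∫ ω in A, S.integral (W k) (endTime hT) ω ∂P = ∫ ω in A, S.integral (W k) t ω ∂P := by
  have hint := fun r => ((S.memLp_integral hW k r).integrable one_le_two).integrableOn (s := A)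
  have hle : ∀ i, max (S.t i) t ≤ max (S.t (i + 1)) t := fun i =>
    max_le_max_right _ (S.mono i.le_succ)
  rw [← sub_eq_zero, ← integral_sub (hint _) (hint _)]
  simp only [integral_endTime_sub]
  rw [integral_finsetSum _ fun i _ =>
    ((S.memLp_coeff_mul_incr hW k i (hle i)).integrable one_le_two).integrableOn]
  refine Finset.sum_eq_zero fun i _ => ?_
  have hc : StronglyMeasurable[ℱ (max (S.t i) t)] (A.indicator (S.c i)) :=
    ((S.meas i).mono (ℱ.mono (le_max_left _ _))).indicator (ℱ.mono (le_max_right _ _) A hA)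
  refine Eq.trans ?_ (hW.integral_mul_incr k (hle i) hc)
  rw [← integral_indicator (ℱ.le t A hA)]
  simp only [Set.indicator_mul_left]

end SimpleProcess

theorem stronglyMeasurable_uncurry_of_isStronglyProgressive {β : Type*} [TopologicalSpace β]
    (hT : 0 < T) {u : Time T → Ω → β} (h : IsStronglyProgressive ℱ u) :
    StronglyMeasurable fun p : Time T × Ω => u p.1 p.2 := by
  have hend : StronglyMeasurable fun p : Set.Iic (endTime hT) × Ω => u p.1 p.2 :=
    (h (endTime hT)).mono (sup_le_sup le_rfl (MeasurableSpace.comap_mono (ℱ.le _)))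
  have hembed : Measurable fun p : Time T × Ω =>
      ((⟨p.1, le_endTime hT p.1⟩ : Set.Iic (endTime hT)), p.2) :=
    measurable_fst.subtype_mk.prodMk measurable_snd
  exact hend.comp_measurable hembed

theorem ae_forall_eq_of_continuous {β : Type*} [TopologicalSpace β] [T2Space β]
    {u v : Time T → Ω → β} (hu : ∀ᵐ ω ∂P, Continuous fun s => u s ω)
    (hv : ∀ᵐ ω ∂P, Continuous fun s => v s ω) (h : ∀ s, ∀ᵐ ω ∂P, u s ω = v s ω) :
    ∀ᵐ ω ∂P, ∀ s, u s ω = v s ω := by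
  obtain ⟨D, hD_countable, hD_dense⟩ := TopologicalSpace.exists_countable_dense (Time T)
  have heqOn : ∀ᵐ ω ∂P, ∀ s ∈ D, u s ω = v s ω := (ae_ball_iff hD_countable).2 fun s _ => h s
  filter_upwards [heqOn, hu, hv] with ω heqOn hu hv s
  exact congrFun (hu.ext_on hD_dense hv heqOn) s

namespace IsItoIntegral

variable {k l : Fin m} {H H' I I' : Time T → Ω → ℝ}

theorem aestronglyMeasurable {w : Time T → Ω → ℝ} (h : IsItoIntegral ℱ P w H I) (r : Time T) :
    AEStronglyMeasurable (I r) P :=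
  ((h.2.1 r).mono (ℱ.le r)).aestronglyMeasurable

theorem measurable_integrand (hT : 0 < T) {w : Time T → Ω → ℝ} (h : IsItoIntegral ℱ P w H I) :
    Measurable fun p : Time T × Ω => H p.1 p.2 :=
  (stronglyMeasurable_uncurry_of_isStronglyProgressive hT h.1).measurable

theorem exists_tendsto_eLpNorm [IsFiniteMeasure P] (hT : 0 < T) {w : Time T → Ω → ℝ}
    (h : IsItoIntegral ℱ P w H I) :
    ∃ S : ℕ → SimpleProcess ℱ,
      Tendsto (fun j => eLpNorm ((fun p : Time T × Ω => (S j).eval p.1 p.2) - fun p => H p.1 p.2)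
        2 ((volume : Measure (Time T)).prod P)) atTop (𝓝 0) ∧
      ∀ r, Tendsto (fun j => eLpNorm ((S j).integral w r - I r) 2 P) atTop (𝓝 0) := by
  have hH := (h.measurable_integrand hT).aestronglyMeasurable
    (μ := (volume : Measure (Time T)).prod P)
  obtain ⟨-, -, -, S, hSH, hSI⟩ := h
  refine ⟨S, tendsto_eLpNorm_two_of_tendsto_lintegral ?_, fun r =>
    tendsto_eLpNorm_two_of_tendsto_lintegral ?_⟩
  · refine hSH.congr fun j => ?_
    simp only [Pi.sub_apply, sub_sq_comm _ (H _ _)]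
    exact (lintegral_prod_symm _ ((hH.sub
      (S j).memLp_eval.1).aemeasurable.pow_const 2).ennreal_ofReal).symm
  · simpa only [Pi.sub_apply, sub_sq_comm _ (I r _)] using hSI r

theorem memLp [IsFiniteMeasure P] (hT : 0 < T) (hW : IsBrownianMotion ℱ P W)
    (h : IsItoIntegral ℱ P (W k) H I) (r : Time T) : MemLp (I r) 2 P := by
  obtain ⟨S, -, hSI⟩ := h.exists_tendsto_eLpNorm hT
  exact memLp_of_tendsto_eLpNorm_sub (fun j => (S j).memLp_integral hW k r)
    (h.aestronglyMeasurable r) (hSI r)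

theorem memLp_integrand [IsFiniteMeasure P] (hT : 0 < T) {w : Time T → Ω → ℝ}
    (h : IsItoIntegral ℱ P w H I) :
    MemLp (fun p : Time T × Ω => H p.1 p.2) 2 ((volume : Measure (Time T)).prod P) := by
  obtain ⟨S, hSH, -⟩ := h.exists_tendsto_eLpNorm hT
  exact memLp_of_tendsto_eLpNorm_sub (fun j => (S j).memLp_eval)
    (h.measurable_integrand hT).aestronglyMeasurable hSH

theorem integral_endTime_mul_endTime [IsFiniteMeasure P] (hT : 0 < T)
    (hW : IsBrownianMotion ℱ P W) (h : IsItoIntegral ℱ P (W k) H I)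
    (h' : IsItoIntegral ℱ P (W l) H' I') :
    ∫ ω, I (endTime hT) ω * I' (endTime hT) ω ∂P
      = if k = l then ∫ p : Time T × Ω, H p.1 p.2 * H' p.1 p.2
          ∂((volume : Measure (Time T)).prod P) else 0 := by
  obtain ⟨S, hSH, hSI⟩ := h.exists_tendsto_eLpNorm hT
  obtain ⟨S', hSH', hSI'⟩ := h'.exists_tendsto_eLpNorm hT
  have hI := tendsto_integral_mul_of_tendsto_eLpNorm (fun j => (S j).memLp_integral hW k _)
    (fun j => (S' j).memLp_integral hW l _) (h.aestronglyMeasurable _)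
    (h'.aestronglyMeasurable _) (hSI (endTime hT)) (hSI' (endTime hT))
  have hH := tendsto_integral_mul_of_tendsto_eLpNorm (fun j => (S j).memLp_eval)
    (fun j => (S' j).memLp_eval) (h.measurable_integrand hT).aestronglyMeasurable
    (h'.measurable_integrand hT).aestronglyMeasurable hSH hSH'
  simp only [SimpleProcess.integral_endTime_mul_endTime hT hW] at hI
  split_ifs at hI ⊢ with hkl
  · exact tendsto_nhds_unique hI hH
  · exact tendsto_nhds_unique hI tendsto_const_nhds

theorem integral_sum_endTime_sq [IsFiniteMeasure P] (hT : 0 < T) (hW : IsBrownianMotion ℱ P W)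
    {H I : Fin m → Time T → Ω → ℝ} (h : ∀ k, IsItoIntegral ℱ P (W k) (H k) (I k)) :
    ∫ ω, (∑ k, I k (endTime hT) ω) ^ 2 ∂P
      = ∑ k, ∫ p : Time T × Ω, H k p.1 p.2 ^ 2 ∂((volume : Measure (Time T)).prod P) := by
  have hint : ∀ k l, Integrable (fun ω => I k (endTime hT) ω * I l (endTime hT) ω) P :=
    fun k l => ((h k).memLp hT hW (endTime hT)).integrable_mul ((h l).memLp hT hW (endTime hT))
  simp only [pow_two, Finset.sum_mul_sum]
  rw [integral_finsetSum _ fun k _ => integrable_finsetSum _ fun l _ => hint k l]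
  refine Finset.sum_congr rfl fun k _ => ?_
  rw [integral_finsetSum _ fun l _ => hint k l]
  simp only [integral_endTime_mul_endTime hT hW (h k) (h _), Finset.sum_ite_eq, Finset.mem_univ,
    if_true]

theorem integrand_eq_zero [IsFiniteMeasure P] (hT : 0 < T) (hW : IsBrownianMotion ℱ P W)
    {H I : Fin m → Time T → Ω → ℝ} (h : ∀ k, IsItoIntegral ℱ P (W k) (H k) (I k))
    (h0 : ∀ᵐ ω ∂P, ∑ k, I k (endTime hT) ω = 0) (k : Fin m) :
    ∀ᵐ p ∂((volume : Measure (Time T)).prod P), H k p.1 p.2 = 0 := by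
  have hsum := integral_sum_endTime_sq hT hW h
  rw [integral_eq_zero_of_ae (h0.mono fun ω hω => by simp [hω])] at hsum
  have hk := (Finset.sum_eq_zero_iff_of_nonneg fun k _ =>
    integral_nonneg fun p => sq_nonneg _).1 hsum.symm k (Finset.mem_univ k)
  rw [integral_eq_zero_iff_of_nonneg (fun p => sq_nonneg _)
    ((h k).memLp_integrand hT).integrable_sq] at hk
  filter_upwards [hk] with p hp
  exact pow_eq_zero_iff two_ne_zero |>.1 hp

theorem condExp_endTime_ae_eq [IsFiniteMeasure P] (hT : 0 < T) (hW : IsBrownianMotion ℱ P W)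
    (h : IsItoIntegral ℱ P (W k) H I) (t : Time T) : P[I (endTime hT) | ℱ t] =ᵐ[P] I t := by
  have hint := fun r => (h.memLp hT hW r).integrable one_le_two
  refine (ae_eq_condExp_of_forall_setIntegral_eq (ℱ.le t) (hint _)
    (fun A _ _ => (hint t).integrableOn) (fun A hA _ => ?_)
    (h.2.1 t).aestronglyMeasurable).symm
  obtain ⟨S, -, hSI⟩ := h.exists_tendsto_eLpNorm hT
  have hA' := ℱ.le t A hA
  have hlim : ∀ r, Tendsto (fun j => ∫ ω in A, (S j).integral (W k) r ω ∂P) atTop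
      (𝓝 (∫ ω in A, I r ω ∂P)) := fun r => by
    have hone : MemLp (A.indicator (1 : Ω → ℝ)) 2 P := (memLp_const 1).indicator hA'
    simpa only [← Set.indicator_mul_left, Pi.one_apply, one_mul, integral_indicator hA'] using
      tendsto_integral_mul_of_tendsto_eLpNorm (fun _ => hone)
        (fun j => (S j).memLp_integral hW k r) hone.1 (h.aestronglyMeasurable r)
        (by simp) (hSI r)
  refine tendsto_nhds_unique (hlim t) ((hlim (endTime hT)).congr fun j => ?_)
  exact (S j).setIntegral_integral_endTime hT hW k hA

theorem eq_zero_of_integrand_eq_zero [IsFiniteMeasure P] (hT : 0 < T)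
    (hW : IsBrownianMotion ℱ P W) (h : IsItoIntegral ℱ P (W k) (fun _ _ => 0) I) :
    ∀ᵐ ω ∂P, ∀ s, I s ω = 0 := by
  have hend : I (endTime hT) =ᵐ[P] 0 := by
    have hsq := integral_endTime_mul_endTime hT hW h h
    rw [if_pos rfl] at hsq
    simp only [mul_zero, integral_zero] at hsq
    rw [integral_eq_zero_iff_of_nonneg (fun ω => mul_self_nonneg _)
      ((h.memLp hT hW _).integrable_mul (h.memLp hT hW _))] at hsq
    filter_upwards [hsq] with ω hω using mul_self_eq_zero.1 hω
  refine ae_forall_eq_of_continuous h.2.2.1 (ae_of_all _ fun _ => continuous_const) fun t => ?_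
  have hcond := condExp_congr_ae (m := ℱ t) hend
  rw [condExp_zero] at hcond
  exact (h.condExp_endTime_ae_eq hT hW t).symm.trans hcond

end IsItoIntegral

end Ito

/-! ### The explicit solution of the Riccati equation -/

section Matrix

variable {ι : Type*}

open scoped Matrix.Norms.Operator in
theorem hasDerivAt_matrix_inv [Fintype ι] [DecidableEq ι] {A : ℝ → Matrix ι ι ℝ}
    {A' : Matrix ι ι ℝ} {s : ℝ} (hA : HasDerivAt A A' s) (hs : IsUnit (A s)) :
    HasDerivAt (fun r => (A r)⁻¹) (-((A s)⁻¹ * A' * (A s)⁻¹)) s := by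
  obtain ⟨U, hU⟩ := hs
  have hinv := hasFDerivAt_ringInverse (𝕜 := ℝ) U
  rw [hU] at hinv
  have hcomp := hinv.comp_hasDerivAt s hA
  simp only [Function.comp_def, ← Matrix.nonsing_inv_eq_ringInverse, Matrix.coe_units_inv, hU,
    _root_.neg_apply, ContinuousLinearMap.mulLeftRight_apply] at hcomp
  exact hcomp

theorem hasDerivAt_matrix_apply [Finite ι] {A : ℝ → Matrix ι ι ℝ} {A' : Matrix ι ι ℝ}
    {s : ℝ} (hA : HasDerivAt A A' s) (i j : ι) : HasDerivAt (fun r => A r i j) (A' i j) s := by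
  have := Fintype.ofFinite ι
  exact hasDerivAt_pi.1 (hasDerivAt_pi.1 hA i) j

open scoped Matrix.Norms.Elementwise in
theorem exists_abs_apply_le_of_continuous [Finite ι] {X : Type*} [TopologicalSpace X]
    [CompactSpace X] {f : X → Matrix ι ι ℝ} (hf : Continuous f) :
    ∃ K : ℝ, ∀ s i j, |f s i j| ≤ K := by
  have := Fintype.ofFinite ι
  obtain ⟨K, hK⟩ := isCompact_univ.exists_bound_of_continuousOn hf.continuousOn
  exact ⟨K, fun s i j =>
    (Matrix.norm_entry_le_entrywise_sup_norm (f s)).trans (hK s (Set.mem_univ s))⟩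

end Matrix

namespace OWModel

variable {n : ℕ} (M : OWModel n) {m : ℕ}

theorem O_mul_transpose : M.O * M.Oᵀ = 1 := by
  simpa [Matrix.star_eq_conjTranspose] using (Matrix.mem_orthogonalGroup_iff (Fin n) ℝ).1 M.orth

theorem transpose_mul_O : M.Oᵀ * M.O = 1 := by
  simpa [Matrix.star_eq_conjTranspose] using (Matrix.mem_orthogonalGroup_iff' (Fin n) ℝ).1 M.orth

theorem gammaPow_mul (α β : ℝ) : M.gammaPow α * M.gammaPow β = M.gammaPow (α + β) :=
  calc M.gammaPow α * M.gammaPow β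
      = M.Oᵀ * (Matrix.diagonal (fun j => M.lam j ^ α) * (M.O * M.Oᵀ)
        * Matrix.diagonal (fun j => M.lam j ^ β)) * M.O := by
        simp only [gammaPow, Matrix.mul_assoc]
    _ = M.gammaPow (α + β) := by
        simp only [O_mul_transpose, Matrix.mul_one, Matrix.diagonal_mul_diagonal, gammaPow,
          Real.rpow_add (M.lam_pos _)]

theorem gammaPow_zero : M.gammaPow 0 = 1 := by
  simp [gammaPow, transpose_mul_O]

theorem gammaPow_one : M.gammaPow 1 = M.gamma := by
  simp [gammaPow, gamma]

theorem gammaPow_transpose (α : ℝ) : (M.gammaPow α)ᵀ = M.gammaPow α := by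
  simp [gammaPow, Matrix.mul_assoc]

theorem gammaPow_half_mul_neg_half : M.gammaPow (1 / 2) * M.gammaPow (-(1 / 2)) = 1 := by
  rw [gammaPow_mul, add_neg_cancel, gammaPow_zero]

theorem gammaPow_neg_half_mul_half : M.gammaPow (-(1 / 2)) * M.gammaPow (1 / 2) = 1 := by
  rw [gammaPow_mul, neg_add_cancel, gammaPow_zero]

theorem gammaPow_half_mul_half : M.gammaPow (1 / 2) * M.gammaPow (1 / 2) = M.gamma := by
  rw [gammaPow_mul, ← gammaPow_one, add_halves]

theorem gamma_mul_gammaPow_neg_half : M.gamma * M.gammaPow (-(1 / 2)) = M.gammaPow (1 / 2) := by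
  rw [← gammaPow_half_mul_half, Matrix.mul_assoc, gammaPow_half_mul_neg_half, Matrix.mul_one]

theorem gammaPow_neg_half_mul_neg_half :
    M.gammaPow (-(1 / 2)) * M.gammaPow (-(1 / 2)) = M.gammaPow (-1) := by
  rw [gammaPow_mul, ← neg_add, add_halves]

theorem scrC_eq_zero (k : Fin m) : M.scrC m k = 0 := by
  simp [scrC, coeffC]

theorem scrA_eq_zero : M.scrA m = 0 := by
  simp [scrA, coeffA, coeffC]

theorem scrB_eq : M.scrB m = -(M.gammaPow (-(1 / 2)) * M.rho * M.gammaPow (1 / 2)) := by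
  simp [scrB, coeffB, coeffC]

theorem scrQ_eq_zero : M.scrQ = 0 := by
  simp [scrQ, coeffQ]

theorem scrR_eq_kappa : M.scrR m = M.kappa m := by
  simp [scrR, scrQ_eq_zero]

theorem driver_eq (Y : Matrix (Fin n) (Fin n) ℝ) (Z : Fin m → Matrix (Fin n) (Fin n) ℝ) :
    driver (M.scrA m) (M.scrB m) M.scrQ (M.scrR m) (fun k => M.scrC m k) Y Z
      = -(Y * M.scrBRB m * Y) := by
  simp [driver, scrA_eq_zero, scrQ_eq_zero, scrC_eq_zero, scrBRB, Matrix.mul_assoc]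

theorem feedback_eq (Y : Matrix (Fin n) (Fin n) ℝ) (Z : Fin m → Matrix (Fin n) (Fin n) ℝ) :
    feedback (M.scrB m) M.scrQ (M.scrR m) (M.scrC m) Y Z
      = -((M.scrR m)⁻¹ * (M.scrB m)ᵀ * Y) := by
  simp [feedback, scrQ_eq_zero, scrC_eq_zero, Matrix.mul_assoc]

theorem explicitY_self (T : ℝ) : M.explicitY m T T = (1 / 2 : ℝ) • 1 := by
  simp [explicitY]

variable (hκ : (M.kappa m).PosDef) {T : ℝ}
include hκ

theorem isUnit_scrR : IsUnit (M.scrR m) := by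
  rw [scrR_eq_kappa]
  exact hκ.isUnit

theorem posSemidef_scrBRB : (M.scrBRB m).PosSemidef := by
  simpa [scrBRB, scrR_eq_kappa] using hκ.inv.posSemidef.mul_mul_conjTranspose_same (M.scrB m)

theorem scrBRB_transpose : (M.scrBRB m)ᵀ = M.scrBRB m := by
  simpa using (M.posSemidef_scrBRB hκ).isHermitian.eq

theorem isUnit_one_add_smul_scrBRB {c : ℝ} (hc : 0 ≤ c) : IsUnit (1 + c • M.scrBRB m) :=
  (Matrix.PosDef.one.add_posSemidef ((M.posSemidef_scrBRB hκ).smul hc)).isUnit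

theorem isUnit_one_add_half_mul_sub_smul_scrBRB {s : ℝ} (hs : s ≤ T) :
    IsUnit (1 + ((1 / 2) * (T - s)) • M.scrBRB m) :=
  M.isUnit_one_add_smul_scrBRB hκ (by linarith)

theorem explicitY_transpose (T s : ℝ) : (M.explicitY m T s)ᵀ = M.explicitY m T s := by
  simp [explicitY, Matrix.transpose_nonsing_inv, M.scrBRB_transpose hκ]

open scoped Matrix.Norms.Operator in
theorem hasDerivAt_explicitY_apply {s : ℝ} (hs : s ≤ T) (i j : Fin n) :
    HasDerivAt (fun r => M.explicitY m T r i j)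
      ((M.explicitY m T s * M.scrBRB m * M.explicitY m T s) i j) s := by
  have hlin : HasDerivAt (fun r : ℝ => 1 + ((1 / 2) * (T - r)) • M.scrBRB m)
      ((-(1 / 2) : ℝ) • M.scrBRB m) s := by
    rw [← mul_neg_one]
    exact ((((hasDerivAt_id s).const_sub T).const_mul (1 / 2)).smul_const
      (M.scrBRB m)).const_add 1
  have hinv := hasDerivAt_matrix_inv hlin (M.isUnit_one_add_half_mul_sub_smul_scrBRB hκ hs)
  convert! (hasDerivAt_matrix_apply hinv i j).const_mul (1 / 2 : ℝ) using 1
  simp [explicitY]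

theorem continuous_explicitY (T : ℝ) : Continuous fun s : Time T => M.explicitY m T s := by
  refine continuous_matrix fun i j => continuous_iff_continuousAt.2 fun s => ?_
  exact ContinuousAt.comp (f := ((↑) : Time T → ℝ)) (g := fun r => M.explicitY m T r i j)
    (M.hasDerivAt_explicitY_apply hκ s.2.2 i j).continuousAt continuous_subtype_val.continuousAt

theorem explicitY_eq_add_setIntegral (t : Time T) (i j : Fin n) :
    M.explicitY m T t i j = M.explicitY m T 0 i j
      + ∫ s : Time T in Set.Iic t, (M.explicitY m T s * M.scrBRB m * M.explicitY m T s) i j := by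
  have hY := M.continuous_explicitY hκ T
  rw [setIntegral_Iic_eq_sub_of_hasDerivAt (f := fun s => M.explicitY m T s i j)
    (f' := fun s => (M.explicitY m T s * M.scrBRB m * M.explicitY m T s) i j)
    (fun s hs => M.hasDerivAt_explicitY_apply hκ hs.2 i j)
    (continuousOn_iff_continuous_domRestrict.2
      (((hY.matrix_mul continuous_const).matrix_mul hY).matrix_elem i j)), add_sub_cancel]

end OWModel

section RiccatiExistence

variable {T : ℝ} {Ω : Type*} {mΩ : MeasurableSpace Ω}
  {ℱ : Filtration (Time T) mΩ} {P : Measure Ω} {n m : ℕ} {W : Fin m → Time T → Ω → ℝ}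

theorem isItoIntegral_zero (hT : 0 < T) (w : Time T → Ω → ℝ) :
    IsItoIntegral ℱ P w (fun _ _ => 0) (fun _ _ => 0) := by
  let S : SimpleProcess ℱ :=
    { N := 0
      t := fun _ => startTime hT
      mono := monotone_const
      c := fun _ _ => 0
      meas := fun _ => stronglyMeasurable_const
      bdd := ⟨0, by simp⟩ }
  refine ⟨isStronglyProgressive_const _ _, fun _ => stronglyMeasurable_const,
    ae_of_all _ fun _ => continuous_const, fun _ => S, ?_, fun r => ?_⟩
  · simp [S, SimpleProcess.eval]
  · simp [S, SimpleProcess.integral]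

theorem OWModel.isRiccatiSolution_explicitY (hT : 0 < T) (M : OWModel n)
    (hκ : (M.kappa m).PosDef) :
    IsRiccatiSolution hT ℱ P W (fun _ _ => M.scrA m) (fun _ _ => M.scrB m)
      (fun _ _ => M.scrQ) (fun _ _ => M.scrR m) (fun k _ _ => M.scrC m k)
      (fun s _ => M.explicitY m T s) (fun _ _ _ => 0) where
  symm_Y s _ := M.explicitY_transpose hκ T s
  bounded_Y := (exists_abs_apply_le_of_continuous (M.continuous_explicitY hκ T)).imp
    fun _ hK => ae_of_all _ fun _ => hK
  adapted_Y _ := stronglyMeasurable_const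
  continuous_Y := ae_of_all _ fun _ => M.continuous_explicitY hκ T
  symm_Z _ _ _ := Matrix.isSymm_zero
  prog_Z _ := isStronglyProgressive_const _ _
  sq_integrable_Z _ := by simp
  posDef := ae_of_all _ fun _ => by simpa [M.scrC_eq_zero, M.scrR_eq_kappa] using hκ
  integrable_driver := ae_of_all _ fun _ i j => by
    have hY := M.continuous_explicitY hκ T
    simp only [M.driver_eq]
    exact integrable_of_continuous_time
      ((((hY.matrix_mul continuous_const).matrix_mul hY).neg).matrix_elem i j)
  terminal := ae_of_all _ fun _ => M.explicitY_self T
  equation := by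
    refine ⟨fun _ _ _ => 0, fun _ _ _ => isItoIntegral_zero hT _, ae_of_all _ fun _ s i j => ?_⟩
    simp only [M.driver_eq, Matrix.neg_apply, integral_neg, Matrix.zero_apply,
      Finset.sum_const_zero, add_zero, sub_neg_eq_add]
    exact M.explicitY_eq_add_setIntegral hκ s i j

end RiccatiExistence

/-! ### Uniqueness for the Riccati equation -/

theorem norm_mul_mul_sub_mul_mul_le {A : Type*} [NormedRing A] {K : ℝ} {a b : A} (s : A)
    (ha : ‖a‖ ≤ K) (hb : ‖b‖ ≤ K) : ‖a * s * a - b * s * b‖ ≤ 2 * K * ‖s‖ * ‖a - b‖ :=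
  calc ‖a * s * a - b * s * b‖ = ‖(a - b) * s * a + b * s * (a - b)‖ := by
        congr 1
        noncomm_ring
    _ ≤ ‖(a - b) * s * a‖ + ‖b * s * (a - b)‖ := norm_add_le _ _
    _ ≤ ‖a - b‖ * ‖s‖ * ‖a‖ + ‖b‖ * ‖s‖ * ‖a - b‖ :=
        add_le_add (norm_mul₃_le ..) (norm_mul₃_le ..)
    _ ≤ ‖a - b‖ * ‖s‖ * K + K * ‖s‖ * ‖a - b‖ := by gcongr
    _ = 2 * K * ‖s‖ * ‖a - b‖ := by ring

section MatrixNorm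

variable {ι : Type*} [Fintype ι]

open scoped Matrix.Norms.Operator

theorem abs_apply_le_linfty_opNorm (A : Matrix ι ι ℝ) (i j : ι) : |A i j| ≤ ‖A‖ := by
  rw [Matrix.linfty_opNorm_def]
  refine le_trans ?_ (NNReal.coe_le_coe.2 (Finset.le_sup (Finset.mem_univ i)))
  simpa using Finset.single_le_sum (f := fun j => |A i j|) (fun j _ => abs_nonneg _)
    (Finset.mem_univ j)

theorem linfty_opNorm_le_sum_abs (A : Matrix ι ι ℝ) : ‖A‖ ≤ ∑ i, ∑ j, |A i j| := by
  have hrow : ‖A‖₊ ≤ ∑ i, ∑ j, ‖A i j‖₊ := by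
    rw [Matrix.linfty_opNNNorm_def]
    exact Finset.sup_le fun i hi => Finset.single_le_sum (f := fun i => ∑ j, ‖A i j‖₊)
      (fun _ _ => zero_le) hi
  simpa using NNReal.coe_le_coe.2 hrow

theorem exists_abs_mul_mul_sub_apply_le (S : Matrix ι ι ℝ) (K : ℝ) :
    ∃ C, 0 ≤ C ∧ ∀ Y Y' : Matrix ι ι ℝ, (∀ i j, |Y i j| ≤ K) → (∀ i j, |Y' i j| ≤ K) →
      ∀ i j, |(Y * S * Y - Y' * S * Y') i j|
        ≤ C * ∑ p : ι × ι, |Y p.1 p.2 - Y' p.1 p.2| := by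
  classical
  have hnorm : ∀ Y : Matrix ι ι ℝ, (∀ i j, |Y i j| ≤ K) → ‖Y‖ ≤ ∑ _i : ι, ∑ _j : ι, |K| :=
    fun Y hY => (linfty_opNorm_le_sum_abs Y).trans (Finset.sum_le_sum fun i _ =>
      Finset.sum_le_sum fun j _ => (hY i j).trans (le_abs_self K))
  refine ⟨2 * (∑ _i : ι, ∑ _j : ι, |K|) * ‖S‖, by positivity, fun Y Y' hY hY' i j => ?_⟩
  refine (abs_apply_le_linfty_opNorm _ i j).trans
    ((norm_mul_mul_sub_mul_mul_le S (hnorm Y hY) (hnorm Y' hY')).trans ?_)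
  rw [Fintype.sum_prod_type]
  exact mul_le_mul_of_nonneg_left (linfty_opNorm_le_sum_abs (Y - Y')) (by positivity)

end MatrixNorm

theorem stronglyMeasurable_matrix_apply {α ι κ : Type*} {_ : MeasurableSpace α}
    {f : α → Matrix ι κ ℝ} (hf : StronglyMeasurable f) (i : ι) (j : κ) :
    StronglyMeasurable fun a => f a i j :=
  (continuous_id.matrix_elem i j).comp_stronglyMeasurable hf

section BackwardEquation

variable {Ω : Type*} {m mΩ : MeasurableSpace Ω} {P : Measure Ω}

theorem integral_abs_le_integral_abs_add_sub_condExp [IsFiniteMeasure P]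
    (hm : m ≤ mΩ) {f g : Ω → ℝ} (hf : StronglyMeasurable[m] f) (hfi : Integrable f P)
    (hg : Integrable g P) : ∫ ω, |f ω| ∂P ≤ ∫ ω, |f ω + (g ω - (P[g | m]) ω)| ∂P := by
  have hcond : P[f + (g - P[g | m]) | m] =ᵐ[P] f := by
    filter_upwards [condExp_add hfi (hg.sub integrable_condExp) m,
      condExp_sub hg (integrable_condExp (m := m) (f := g)) m] with ω hadd hsub
    rw [hadd, Pi.add_apply, hsub, condExp_of_stronglyMeasurable hm hf hfi, Pi.sub_apply,
      condExp_of_stronglyMeasurable hm stronglyMeasurable_condExp integrable_condExp, sub_self,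
      add_zero]
  calc ∫ ω, |f ω| ∂P = ∫ ω, |(P[f + (g - P[g | m]) | m]) ω| ∂P :=
        integral_congr_ae (hcond.mono fun ω hω => by simp only [hω])
    _ ≤ ∫ ω, |f ω + (g ω - (P[g | m]) ω)| ∂P := integral_abs_condExp_le _

theorem integrable_uncurry_of_ae_continuous {X E : Type*} [TopologicalSpace X]
    [TopologicalSpace.MetrizableSpace X] [SecondCountableTopology X] [MeasurableSpace X]
    [OpensMeasurableSpace X] [NormedAddCommGroup E] {μ : Measure X} [IsFiniteMeasure μ]
    [IsFiniteMeasure P] {u : X → Ω → E} {K : ℝ} (hu : ∀ s, StronglyMeasurable (u s))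
    (huc : ∀ᵐ ω ∂P, Continuous fun s => u s ω) (huK : ∀ᵐ ω ∂P, ∀ s, ‖u s ω‖ ≤ K) :
    Integrable (Function.uncurry u) (μ.prod P) := by
  refine Integrable.of_bound ?_ K
    ((Measure.quasiMeasurePreserving_snd.ae huK).mono fun p hp => hp p.1)
  obtain ⟨B, hB_sub, hB_meas, hB_null⟩ := exists_measurable_superset_of_null (ae_iff.1 huc)
  have hmod : StronglyMeasurable (Function.uncurry fun s => Bᶜ.indicator (u s)) := by
    refine stronglyMeasurable_uncurry_of_continuous_of_stronglyMeasurable (fun ω => ?_)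
      fun s => (hu s).indicator hB_meas.compl
    by_cases hω : ω ∈ B
    · simpa only [Set.indicator_of_notMem (Set.notMem_compl_iff.2 hω)] using continuous_const
    · simpa only [Set.indicator_of_mem (Set.mem_compl hω)] using
        not_not.1 fun hc => hω (hB_sub hc)
  refine ⟨_, hmod, ?_⟩
  filter_upwards [Measure.quasiMeasurePreserving_snd.ae (measure_eq_zero_iff_ae_notMem.1 hB_null)]
    with p hp
  exact (Set.indicator_of_mem (Set.mem_compl hp) (u p.1)).symm

theorem integral_abs_le_mul_integral_of_backward_equation [IsFiniteMeasure P] {X : Type*}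
    [MeasurableSpace X] {μ : Measure X} [SFinite μ] (hm : m ≤ mΩ) {C : ℝ}
    {e N : Ω → ℝ} {φ g : X → Ω → ℝ} (he : StronglyMeasurable[m] e) (hei : Integrable e P)
    (hN : Integrable N P) (hg : Integrable (Function.uncurry g) (μ.prod P))
    (hφ : ∀ᵐ ω ∂P, ∀ s, |φ s ω| ≤ C * g s ω)
    (heq : ∀ᵐ ω ∂P, e ω = (∫ s, φ s ω ∂μ) - (N ω - (P[N | m]) ω)) :
    ∫ ω, |e ω| ∂P ≤ C * ∫ s, ∫ ω, g s ω ∂P ∂μ :=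
  calc ∫ ω, |e ω| ∂P ≤ ∫ ω, |e ω + (N ω - (P[N | m]) ω)| ∂P :=
        integral_abs_le_integral_abs_add_sub_condExp hm he hei hN
    _ ≤ ∫ ω, (C * ∫ s, g s ω ∂μ) ∂P := by
        refine integral_mono_of_nonneg (ae_of_all _ fun ω => abs_nonneg _)
          (hg.integral_prod_right.const_mul C) ?_
        filter_upwards [heq, hφ, hg.prod_left_ae] with ω heq hφ hint
        rw [heq, sub_add_cancel, ← integral_const_mul]
        exact norm_integral_le_of_norm_le (f := fun s => φ s ω) (g := fun s => C * g s ω)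
          (hint.const_mul C) (ae_of_all _ hφ)
    _ = C * ∫ s, ∫ ω, g s ω ∂P ∂μ := by
        rw [integral_const_mul, integral_integral_swap hg]

variable {T : ℝ} {ℱ : Filtration (Time T) mΩ} {ι : Type*} [Fintype ι]

theorem ae_eq_zero_of_backward_equation [IsFiniteMeasure P] (hT : 0 < T) {C K : ℝ} (hC : 0 ≤ C)
    {e φ N : ι → Time T → Ω → ℝ} (he : ∀ i t, StronglyMeasurable[ℱ t] (e i t))
    (hec : ∀ i, ∀ᵐ ω ∂P, Continuous fun t => e i t ω) (heK : ∀ᵐ ω ∂P, ∀ i t, |e i t ω| ≤ K)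
    (hN : ∀ i, Integrable (N i (endTime hT)) P)
    (hNmart : ∀ i t, P[N i (endTime hT) | ℱ t] =ᵐ[P] N i t)
    (hφ : ∀ᵐ ω ∂P, ∀ i t, |φ i t ω| ≤ C * ∑ j, |e j t ω|)
    (heq : ∀ᵐ ω ∂P, ∀ i t,
      e i t ω = (∫ s in Set.Ioi t, φ i s ω) - (N i (endTime hT) ω - N i t ω))
    (i : ι) (t : Time T) : e i t =ᵐ[P] 0 := by
  have hei : ∀ i t, Integrable (e i t) P := fun i t =>
    Integrable.of_bound ((he i t).mono (ℱ.le t)).aestronglyMeasurable K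
      (heK.mono fun ω hω => hω i t)
  have hsum : ∀ t, Integrable (Function.uncurry fun s ω => ∑ j, |e j s ω|)
      ((volume.restrict (Set.Ioi t)).prod P) := fun t =>
    integrable_finsetSum _ fun j _ => (integrable_uncurry_of_ae_continuous
      (fun t => (he j t).mono (ℱ.le t)) (hec j) (heK.mono fun ω hω => hω j)).abs
  set u : Time T → ℝ := fun t => ∫ ω, ∑ j, |e j t ω| ∂P
  have hu_sum : ∀ t, u t = ∑ j, ∫ ω, |e j t ω| ∂P := fun t =>
    integral_finsetSum _ fun j _ => (hei j t).abs
  have hentry : ∀ i t, ∫ ω, |e i t ω| ∂P ≤ C * ∫ s in Set.Ioi t, u s := fun i t =>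
    integral_abs_le_mul_integral_of_backward_equation (ℱ.le t) (he i t) (hei i t) (hN i) (hsum t)
      (hφ.mono fun ω hω => hω i) (by
        filter_upwards [heq, hNmart i t] with ω heq hmart
        rw [hmart, heq i t])
  have hu_le : ∀ t, u t ≤ Fintype.card ι * (K * P.real Set.univ) := fun t => by
    rw [hu_sum, ← nsmul_eq_mul, ← Finset.card_univ]
    refine Finset.sum_le_card_nsmul _ _ _ fun j _ => ?_
    refine (integral_mono_ae (hei j t).abs (integrable_const K)
      (heK.mono fun ω hω => hω j t)).trans_eq ?_
    rw [integral_const, smul_eq_mul, mul_comm]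
  have hu_zero : u t ≤ 0 := by
    refine le_zero_of_le_mul_setIntegral_Ioi (u := u) (C := Fintype.card ι * C) (by positivity)
      (fun t => integral_nonneg fun ω => by positivity) hu_le (fun t => ?_) t
    rw [hu_sum, mul_assoc, ← nsmul_eq_mul, ← Finset.card_univ]
    exact Finset.sum_le_card_nsmul _ _ _ fun j _ => hentry j t
  have hi : ∫ ω, |e i t ω| ∂P = 0 := by
    refine le_antisymm (le_trans ?_ hu_zero) (integral_nonneg fun ω => abs_nonneg _)
    rw [hu_sum]
    exact Finset.single_le_sum (f := fun j => ∫ ω, |e j t ω| ∂P)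
      (fun j _ => integral_nonneg fun ω => abs_nonneg _) (Finset.mem_univ i)
  filter_upwards [(integral_eq_zero_iff_of_nonneg (fun ω => abs_nonneg _) (hei i t).abs).1 hi]
    with ω hω using abs_eq_zero.1 hω

end BackwardEquation

section RiccatiUniqueness

variable {T : ℝ} {Ω : Type*} {mΩ : MeasurableSpace Ω} {ℱ : Filtration (Time T) mΩ} {P : Measure Ω}
  {n m : ℕ} {W : Fin m → Time T → Ω → ℝ}

theorem IsItoIntegral.integrable_sum [IsFiniteMeasure P] (hT : 0 < T)
    (hW : IsBrownianMotion ℱ P W) {H I : Fin m → Time T → Ω → ℝ}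
    (h : ∀ k, IsItoIntegral ℱ P (W k) (H k) (I k)) (t : Time T) :
    Integrable (∑ k, I k t) P :=
  integrable_finsetSum' _ fun k _ => ((h k).memLp hT hW t).integrable one_le_two

theorem IsItoIntegral.condExp_sum_endTime_ae_eq [IsFiniteMeasure P] (hT : 0 < T)
    (hW : IsBrownianMotion ℱ P W) {H I : Fin m → Time T → Ω → ℝ}
    (h : ∀ k, IsItoIntegral ℱ P (W k) (H k) (I k)) (t : Time T) :
    P[∑ k, I k (endTime hT) | ℱ t] =ᵐ[P] ∑ k, I k t := by
  refine (condExp_finsetSum (fun k _ => ((h k).memLp hT hW _).integrable one_le_two) _).trans ?_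
  filter_upwards [ae_all_iff.2 fun k => (h k).condExp_endTime_ae_eq hT hW t] with ω hω
  simp only [Finset.sum_apply, hω]

namespace OWModel

variable (M : OWModel n) {Y Y' : Time T → Ω → Matrix (Fin n) (Fin n) ℝ}
  {Z Z' : Fin m → Time T → Ω → Matrix (Fin n) (Fin n) ℝ}

theorem exists_backward_equation_of_isRiccatiSolution (hT : 0 < T)
    (h : IsRiccatiSolution hT ℱ P W (fun _ _ => M.scrA m) (fun _ _ => M.scrB m)
      (fun _ _ => M.scrQ) (fun _ _ => M.scrR m) (fun k _ _ => M.scrC m k) Y Z) :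
    ∃ N : Fin m → Time T → Ω → Matrix (Fin n) (Fin n) ℝ,
      (∀ k i j, IsItoIntegral ℱ P (W k) (fun s ω => Z k s ω i j) (fun s ω => N k s ω i j)) ∧
      ∀ᵐ ω ∂P, (∀ i j, Integrable fun s => (Y s ω * M.scrBRB m * Y s ω) i j) ∧
        ∀ t i j, Y t ω i j = ((1 / 2 : ℝ) • (1 : Matrix (Fin n) (Fin n) ℝ)) i j
          - (∫ s in Set.Ioi t, (Y s ω * M.scrBRB m * Y s ω) i j)
          - ∑ k, (N k (endTime hT) ω i j - N k t ω i j) := by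
  obtain ⟨N, hN, heq⟩ := h.equation
  refine ⟨N, hN, ?_⟩
  have hint := h.integrable_driver
  simp only [driver_eq, Matrix.neg_apply, integral_neg, integrable_fun_neg_iff] at heq hint
  filter_upwards [heq, hint, h.terminal] with ω heq hint hterm
  refine ⟨hint, fun t i j => ?_⟩
  have hend := heq (endTime hT) i j
  rw [hterm, Iic_endTime, setIntegral_univ] at hend
  rw [heq t i j, setIntegral_Ioi_eq_integral_sub (hint i j), hend, Finset.sum_sub_distrib]
  ring

theorem ae_eq_of_isRiccatiSolution [IsFiniteMeasure P] (hT : 0 < T)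
    (hW : IsBrownianMotion ℱ P W)
    (h : IsRiccatiSolution hT ℱ P W (fun _ _ => M.scrA m) (fun _ _ => M.scrB m)
      (fun _ _ => M.scrQ) (fun _ _ => M.scrR m) (fun k _ _ => M.scrC m k) Y Z)
    (h' : IsRiccatiSolution hT ℱ P W (fun _ _ => M.scrA m) (fun _ _ => M.scrB m)
      (fun _ _ => M.scrQ) (fun _ _ => M.scrR m) (fun k _ _ => M.scrC m k) Y' Z') :
    ∀ᵐ ω ∂P, ∀ t, Y t ω = Y' t ω := by
  refine ae_forall_eq_of_continuous h.continuous_Y h'.continuous_Y fun t => ?_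
  obtain ⟨K, hK⟩ := h.bounded_Y
  obtain ⟨K', hK'⟩ := h'.bounded_Y
  obtain ⟨N, hN, heq⟩ := M.exists_backward_equation_of_isRiccatiSolution hT h
  obtain ⟨N', hN', heq'⟩ := M.exists_backward_equation_of_isRiccatiSolution hT h'
  obtain ⟨C, hC, hlip⟩ := exists_abs_mul_mul_sub_apply_le (M.scrBRB m) (max K K')
  have hentry := ae_eq_zero_of_backward_equation (P := P) (ℱ := ℱ) hT hC
    (K := K + K') (ι := Fin n × Fin n) (e := fun p t ω => Y t ω p.1 p.2 - Y' t ω p.1 p.2)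
    (φ := fun p t ω => -(Y t ω * M.scrBRB m * Y t ω - Y' t ω * M.scrBRB m * Y' t ω) p.1 p.2)
    (N := fun p t => (∑ k, fun ω => N k t ω p.1 p.2) - ∑ k, fun ω => N' k t ω p.1 p.2)
    (fun p t => ?_) (fun p => ?_) ?_ (fun p => ?_) (fun p t => ?_) ?_ ?_
  · filter_upwards [ae_all_iff.2 fun p => hentry p t] with ω hω
    ext i j
    exact sub_eq_zero.1 (hω (i, j))
  · exact (stronglyMeasurable_matrix_apply (h.adapted_Y t) p.1 p.2).sub
      (stronglyMeasurable_matrix_apply (h'.adapted_Y t) p.1 p.2)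
  · filter_upwards [h.continuous_Y, h'.continuous_Y] with ω hω hω'
    exact (hω.matrix_elem p.1 p.2).sub (hω'.matrix_elem p.1 p.2)
  · filter_upwards [hK, hK'] with ω hK hK' p t
    exact (abs_sub _ _).trans (add_le_add (hK t p.1 p.2) (hK' t p.1 p.2))
  · exact (IsItoIntegral.integrable_sum hT hW (fun k => hN k p.1 p.2) _).sub
      (IsItoIntegral.integrable_sum hT hW (fun k => hN' k p.1 p.2) _)
  · exact (condExp_sub (IsItoIntegral.integrable_sum hT hW (fun k => hN k p.1 p.2) _)
      (IsItoIntegral.integrable_sum hT hW (fun k => hN' k p.1 p.2) _) _).trans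
      ((IsItoIntegral.condExp_sum_endTime_ae_eq hT hW (fun k => hN k p.1 p.2) t).sub
        (IsItoIntegral.condExp_sum_endTime_ae_eq hT hW (fun k => hN' k p.1 p.2) t))
  · filter_upwards [hK, hK'] with ω hK hK' p t
    rw [abs_neg]
    exact hlip _ _ (fun i j => (hK t i j).trans (le_max_left K K'))
      (fun i j => (hK' t i j).trans (le_max_right K K')) p.1 p.2
  · filter_upwards [heq, heq'] with ω heq heq' p t
    simp only [Matrix.sub_apply, Pi.sub_apply, Finset.sum_apply]
    rw [heq.2 t, heq'.2 t, integral_neg,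
      integral_sub (heq.1 _ _).integrableOn (heq'.1 _ _).integrableOn,
      Finset.sum_sub_distrib, Finset.sum_sub_distrib]
    ring

theorem eq_explicitY_of_isRiccatiSolution [IsFiniteMeasure P] (hT : 0 < T)
    (hW : IsBrownianMotion ℱ P W) (hκ : (M.kappa m).PosDef)
    (h : IsRiccatiSolution hT ℱ P W (fun _ _ => M.scrA m) (fun _ _ => M.scrB m)
      (fun _ _ => M.scrQ) (fun _ _ => M.scrR m) (fun k _ _ => M.scrC m k) Y Z) :
    ∀ᵐ ω ∂P, ∀ t, Y t ω = M.explicitY m T t :=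
  M.ae_eq_of_isRiccatiSolution hT hW h (isRiccatiSolution_explicitY hT M hκ)

theorem integrand_eq_zero_of_isRiccatiSolution [IsFiniteMeasure P] (hT : 0 < T)
    (hW : IsBrownianMotion ℱ P W) (hκ : (M.kappa m).PosDef)
    (h : IsRiccatiSolution hT ℱ P W (fun _ _ => M.scrA m) (fun _ _ => M.scrB m)
      (fun _ _ => M.scrQ) (fun _ _ => M.scrR m) (fun k _ _ => M.scrC m k) Y Z) (k : Fin m) :
    ∀ᵐ p ∂((volume : Measure (Time T)).prod P), Z k p.1 p.2 = 0 := by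
  obtain ⟨N, hN, heq⟩ := h.equation
  simp only [driver_eq, Matrix.neg_apply, integral_neg, sub_neg_eq_add] at heq
  have hentry : ∀ i j, ∀ᵐ p ∂((volume : Measure (Time T)).prod P), Z k p.1 p.2 i j = 0 := by
    refine fun i j => IsItoIntegral.integrand_eq_zero hT hW (fun k => hN k i j) ?_ k
    filter_upwards [M.eq_explicitY_of_isRiccatiSolution hT hW hκ h, heq] with ω hY heq
    have hforward := heq (endTime hT) i j
    simp only [hY, M.explicitY_eq_add_setIntegral hκ (endTime hT) i j] at hforward
    exact left_eq_add.1 hforward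
  filter_upwards [ae_all_iff.2 fun i => ae_all_iff.2 (hentry i)] with p hp
  exact Matrix.ext hp

end OWModel

end RiccatiUniqueness

/-! ### The optimal state -/

open scoped Matrix.Norms.Operator in
theorem eq_of_eq_add_setIntegral_mulVec {T : ℝ} {ι : Type*} [Fintype ι] (hT : 0 < T)
    {A : Time T → Matrix ι ι ℝ} {f g v : Time T → ι → ℝ}
    (hA : Continuous A) (hf : Continuous f) (hg : Continuous g)
    (hfeq : ∀ t, f t = v t + ∫ s in Set.Iic t, A s *ᵥ f s)
    (hgeq : ∀ t, g t = v t + ∫ s in Set.Iic t, A s *ᵥ g s) : f = g := by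
  obtain ⟨C, hC⟩ := isCompact_univ.exists_bound_of_continuousOn hA.continuousOn
  obtain ⟨K, hK⟩ := isCompact_univ.exists_bound_of_continuousOn (hf.sub hg).continuousOn
  have hC_nonneg : 0 ≤ C := (norm_nonneg _).trans (hC (startTime hT) (Set.mem_univ _))
  funext t
  refine sub_eq_zero.1 (norm_le_zero_iff.1 (le_zero_of_le_mul_setIntegral_Iic
    (u := fun t => ‖f t - g t‖) hC_nonneg (fun t => norm_nonneg _)
    (fun t => hK t (Set.mem_univ t)) (fun t => ?_) t))
  calc ‖f t - g t‖ = ‖∫ s in Set.Iic t, A s *ᵥ (f s - g s)‖ := by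
        simp only [Matrix.mulVec_sub]
        rw [integral_sub (integrable_of_continuous_time (hA.matrix_mulVec hf)).integrableOn
          (integrable_of_continuous_time (hA.matrix_mulVec hg)).integrableOn, hfeq t, hgeq t,
          add_sub_add_left_eq_sub]
    _ ≤ ∫ s in Set.Iic t, C * ‖f s - g s‖ := by
        refine norm_integral_le_of_norm_le (integrable_of_continuous_time
          (continuous_const.mul (hf.sub hg).norm)).integrableOn (ae_of_all _ fun s => ?_)
        exact (Matrix.linfty_opNorm_mulVec _ _).trans
          (mul_le_mul_of_nonneg_right (hC s (Set.mem_univ s)) (norm_nonneg _))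
    _ = C * ∫ s in Set.Iic t, ‖f s - g s‖ := integral_const_mul _ _

namespace OWModel

variable {T : ℝ} {Ω : Type*} {mΩ : MeasurableSpace Ω} {ℱ : Filtration (Time T) mΩ} {P : Measure Ω}
  {n m : ℕ} {W : Fin m → Time T → Ω → ℝ} (M : OWModel n)

theorem scrA_add_scrB_mul_feedback (Y : Matrix (Fin n) (Fin n) ℝ)
    (Z : Fin m → Matrix (Fin n) (Fin n) ℝ) :
    M.scrA m + M.scrB m * feedback (M.scrB m) M.scrQ (M.scrR m) (M.scrC m) Y Z
      = -(M.scrBRB m * Y) := by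
  rw [feedback_eq, scrA_eq_zero, zero_add, Matrix.mul_neg, scrBRB]
  simp only [Matrix.mul_assoc]

theorem continuous_explicitState (x d : Fin n → ℝ) : Continuous (M.explicitState m T x d) := by
  unfold explicitState
  fun_prop

theorem explicitState_zero (x d : Fin n → ℝ) :
    M.explicitState m T x d 0 = M.initialState x d := by
  simp [explicitState]

variable (hκ : (M.kappa m).PosDef) (x d : Fin n → ℝ)
include hκ

theorem explicitState_eq_mulVec (hT : 0 ≤ T) (s : ℝ) :
    M.explicitState m T x d s = ((1 + ((1 / 2) * (T - s)) • M.scrBRB m)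
      * (1 + ((1 / 2) * T) • M.scrBRB m)⁻¹) *ᵥ M.initialState x d := by
  have hsplit : 1 + ((1 / 2) * (T - s)) • M.scrBRB m
      = (1 + ((1 / 2) * T) • M.scrBRB m) - (s * (1 / 2)) • M.scrBRB m := by module
  have hdet := (Matrix.isUnit_iff_isUnit_det _).1
    (M.isUnit_one_add_smul_scrBRB hκ (c := (1 / 2) * T) (by positivity))
  rw [hsplit, Matrix.sub_mul, Matrix.mul_nonsing_inv _ hdet, Matrix.sub_mulVec,
    Matrix.one_mulVec, explicitState, Matrix.smul_mul, mul_smul s, Matrix.smul_mulVec s]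

theorem explicitY_mulVec_explicitState {s : ℝ} (hT : 0 ≤ T) (hs : s ≤ T) :
    M.explicitY m T s *ᵥ M.explicitState m T x d s
      = (1 / 2 : ℝ) • ((1 + ((1 / 2) * T) • M.scrBRB m)⁻¹ *ᵥ M.initialState x d) := by
  have hdet := (Matrix.isUnit_iff_isUnit_det _).1
    (M.isUnit_one_add_half_mul_sub_smul_scrBRB hκ hs)
  rw [M.explicitState_eq_mulVec hκ x d hT, Matrix.mulVec_mulVec, explicitY, Matrix.smul_mul,
    ← Matrix.mul_assoc, Matrix.nonsing_inv_mul _ hdet, Matrix.one_mul, Matrix.smul_mulVec]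

theorem explicitState_eq_add_setIntegral (hT : 0 ≤ T) (t : Time T) :
    M.explicitState m T x d t = M.initialState x d + ∫ s : Time T in Set.Iic t,
      (-(M.scrBRB m * M.explicitY m T s)) *ᵥ M.explicitState m T x d s := by
  have hdrift : ∀ s : Time T, (-(M.scrBRB m * M.explicitY m T s)) *ᵥ M.explicitState m T x d s
      = -(((1 / 2 : ℝ) • (M.scrBRB m * (1 + ((1 / 2) * T) • M.scrBRB m)⁻¹))
        *ᵥ M.initialState x d) := fun s => by
    rw [Matrix.neg_mulVec, ← Matrix.mulVec_mulVec,
      M.explicitY_mulVec_explicitState hκ x d hT s.2.2, Matrix.mulVec_smul,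
      Matrix.mulVec_mulVec, Matrix.smul_mulVec]
  simp only [hdrift]
  rw [setIntegral_Iic_const, smul_neg, explicitState, sub_eq_add_neg]

theorem isOptimalStateSolution_explicitState (hT : 0 < T) :
    IsOptimalStateSolution hT ℱ P W (fun _ _ => M.scrA m) (fun _ _ => M.scrB m)
      (fun s _ => feedback (M.scrB m) M.scrQ (M.scrR m) (M.scrC m) (M.explicitY m T s)
        (fun _ => 0))
      (fun k _ _ => M.scrC m k) (M.initialState x d) (fun s _ => M.explicitState m T x d s) where
  adapted _ := stronglyMeasurable_const
  continuous := ae_of_all _ fun _ =>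
    (M.continuous_explicitState x d).comp continuous_subtype_val
  initial := ae_of_all _ fun _ => M.explicitState_zero x d
  integrable_drift := ae_of_all _ fun _ => by
    simp only [scrA_add_scrB_mul_feedback]
    exact integrable_of_continuous_time
      ((continuous_const.matrix_mul (M.continuous_explicitY hκ T)).neg.matrix_mulVec
        ((M.continuous_explicitState x d).comp continuous_subtype_val))
  equation := by
    refine ⟨fun _ _ _ => 0, fun k i => ?_, ae_of_all _ fun ω t => ?_⟩
    · simpa only [scrC_eq_zero, Matrix.zero_mul, Matrix.zero_mulVec, Pi.zero_apply]
        using isItoIntegral_zero hT (W k)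
    · simp only [scrA_add_scrB_mul_feedback, Finset.sum_const_zero, add_zero]
      exact M.explicitState_eq_add_setIntegral hκ x d hT.le t

theorem eq_explicitState_of_isOptimalStateSolution [IsFiniteMeasure P] (hT : 0 < T)
    (hW : IsBrownianMotion ℱ P W) {H : Time T → Ω → Fin n → ℝ}
    (h : IsOptimalStateSolution hT ℱ P W (fun _ _ => M.scrA m) (fun _ _ => M.scrB m)
      (fun s _ => feedback (M.scrB m) M.scrQ (M.scrR m) (M.scrC m) (M.explicitY m T s)
        (fun _ => 0))
      (fun k _ _ => M.scrC m k) (M.initialState x d) H) :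
    ∀ᵐ ω ∂P, ∀ s : Time T, H s ω = M.explicitState m T x d s := by
  obtain ⟨N, hN, heq⟩ := h.equation
  simp only [scrC_eq_zero, Matrix.zero_mul, Matrix.zero_mulVec, Pi.zero_apply] at hN
  have hN_zero : ∀ᵐ ω ∂P, ∀ k i s, N k s ω i = 0 := ae_all_iff.2 fun k => ae_all_iff.2 fun i =>
    (hN k i).eq_zero_of_integrand_eq_zero hT hW
  filter_upwards [heq, hN_zero, h.continuous] with ω hHeq hN_zero hHc
  refine congrFun (eq_of_eq_add_setIntegral_mulVec hT
    (A := fun s : Time T => -(M.scrBRB m * M.explicitY m T s))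
    (continuous_const.matrix_mul (M.continuous_explicitY hκ T)).neg hHc
    ((M.continuous_explicitState x d).comp continuous_subtype_val) (fun t => ?_)
    (M.explicitState_eq_add_setIntegral hκ x d hT.le))
  have hsum : ∑ k, N k t ω = 0 := Finset.sum_eq_zero fun k _ => funext fun i => hN_zero k i t
  rw [hHeq t, hsum, add_zero]
  simp only [scrA_add_scrB_mul_feedback]

end OWModel

/-! ### The deviation equation -/

theorem mul_sub_integral_eq_add_integral {u u' f : ℝ → ℝ} {a b : ℝ}
    (hu : ∀ x, HasDerivAt u (u' x) x) (hu' : Continuous u')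
    (hf : IntervalIntegrable f volume a b) (c : ℝ) :
    u b * (c - ∫ s in a..b, f s)
      = u a * c + ∫ s in a..b, (u' s * (c - ∫ q in a..s, f q) - u s * f s) := by
  have hderiv : deriv u = u' := funext fun x => (hu x).deriv
  have hu_abs : AbsolutelyContinuousOnInterval u a b :=
    (contDiff_one_iff_deriv.2 ⟨fun x => (hu x).differentiableAt, hderiv ▸ hu'⟩).contDiffOn
      |>.absolutelyContinuousOnInterval
  have hprim_abs : AbsolutelyContinuousOnInterval (fun x => c - ∫ q in a..x, f q) a b :=
    contDiffOn_const.absolutelyContinuousOnInterval.sub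
      (hf.absolutelyContinuousOnInterval_intervalIntegral Set.left_mem_uIcc)
  have hprim_deriv : ∀ᵐ x, x ∈ Set.uIoc a b → deriv (fun x => c - ∫ q in a..x, f q) x = -f x := by
    filter_upwards [hf.ae_hasDerivAt_integral] with x hx hxab
    exact ((hx (Set.uIoc_subset_uIcc hxab) a Set.left_mem_uIcc).const_sub c).deriv
  have hparts := hu_abs.integral_deriv_mul_eq_sub hprim_abs
  rw [intervalIntegral.integral_same, sub_zero] at hparts
  rw [← sub_eq_iff_eq_add', ← hparts]
  refine intervalIntegral.integral_congr_ae ?_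
  filter_upwards [hprim_deriv] with x hx hxab
  rw [hx hxab, hderiv, mul_neg, ← sub_eq_add_neg]

theorem mul_sub_setIntegral_Iic_eq_add_setIntegral {T : ℝ} (hT : 0 < T) {u u' : ℝ → ℝ}
    (hu : ∀ x, HasDerivAt u (u' x) x) (hu' : Continuous u') {f : Time T → ℝ}
    (hf : Integrable f) (c : ℝ) (r : Time T) :
    u r * (c - ∫ s in Set.Iic r, f s)
      = u 0 * c + ∫ s in Set.Iic r, (u' s * (c - ∫ q in Set.Iic s, f q) - u s * f s) := by
  have hfr : IntervalIntegrable (Set.IccExtend hT.le f) volume 0 r :=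
    (intervalIntegrable_iff_integrableOn_Icc_of_le r.2.1).2
      (((integrable_iccExtend_iff hT).2 hf).mono_set (Set.Icc_subset_Icc_right r.2.2))
  have hparts := mul_sub_integral_eq_add_integral hu hu' hfr c
  rw [← setIntegral_Iic_time (fun s : ℝ => u' s * (c - ∫ q in (0 : ℝ)..s,
    Set.IccExtend hT.le f q) - u s * Set.IccExtend hT.le f s) r] at hparts
  simpa only [setIntegral_Iic_eq_intervalIntegral hT f, Set.IccExtend_val] using hparts

section

variable {α ι κ : Type*} [MeasurableSpace α] {μ : Measure α} [Fintype ι] [Fintype κ]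

theorem integral_apply {f : α → ι → ℝ} (hf : Integrable f μ) (i : ι) :
    (∫ s, f s ∂μ) i = ∫ s, f s i ∂μ :=
  ((ContinuousLinearMap.proj (R := ℝ) (φ := fun _ : ι => ℝ) i).integral_comp_comm hf).symm

theorem integral_mulVec (A : Matrix κ ι ℝ) {f : α → ι → ℝ} (hf : Integrable f μ) :
    ∫ s, A *ᵥ f s ∂μ = A *ᵥ ∫ s, f s ∂μ :=
  (Matrix.mulVecLin A).toContinuousLinearMap.integral_comp_comm hf

theorem integrable_mulVec [TopologicalSpace α] [CompactSpace α] [OpensMeasurableSpace α]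
    [T2Space α] {A : α → Matrix κ ι ℝ} (hA : Continuous A) {f : α → ι → ℝ}
    (hf : Integrable f μ) : Integrable (fun s => A s *ᵥ f s) μ :=
  Integrable.of_eval fun i => integrable_finsetSum _ fun j _ => integrableOn_univ.1
    ((hf.eval j).integrableOn.continuousOn_mul (hA.matrix_elem i j).continuousOn isCompact_univ)

theorem mulVec_sub_setIntegral_Iic_eq_add_setIntegral {T : ℝ} (hT : 0 < T)
    {A A' : ℝ → Matrix κ ι ℝ} (hA : ∀ x i j, HasDerivAt (fun y => A y i j) (A' x i j) x)
    (hA' : Continuous A') {f : Time T → ι → ℝ} (hf : Integrable f) (v : ι → ℝ) (r : Time T) :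
    A r *ᵥ (v - ∫ s in Set.Iic r, f s) = A 0 *ᵥ v
      + ∫ s in Set.Iic r, (A' s *ᵥ (v - ∫ q in Set.Iic s, f q) - A s *ᵥ f s) := by
  have hAc : Continuous fun s : Time T => A s := continuous_matrix fun i j =>
    (continuous_iff_continuousAt.2 fun x => (hA x i j).continuousAt).comp continuous_subtype_val
  have hA'c : Continuous fun s : Time T => A' s := hA'.comp continuous_subtype_val
  have hprim := (continuous_const (y := v)).sub (continuous_setIntegral_Iic hT hf)
  have hint : Integrable fun s : Time T => A' s *ᵥ (v - ∫ q in Set.Iic s, f q) - A s *ᵥ f s :=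
    (integrable_of_continuous_time (hA'c.matrix_mulVec hprim)).sub (integrable_mulVec hAc hf)
  have hentry : ∀ i j, Integrable fun s : Time T =>
      A' s i j * (v j - (∫ q in Set.Iic s, f q) j) - A s i j * f s j := fun i j =>
    (integrable_of_continuous_time ((hA'c.matrix_elem i j).mul
      ((continuous_apply j).comp hprim))).sub
      (integrableOn_univ.1 ((hf.eval j).integrableOn.continuousOn_mul
        (hAc.matrix_elem i j).continuousOn isCompact_univ))
  ext i
  rw [Pi.add_apply, integral_apply hint.integrableOn]
  simp only [Pi.sub_apply, Matrix.mulVec_apply_eq_sum, ← Finset.sum_sub_distrib]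
  rw [integral_finsetSum _ fun j _ => (hentry i j).integrableOn, ← Finset.sum_add_distrib]
  refine Finset.sum_congr rfl fun j _ => ?_
  simpa only [Pi.sub_apply, integral_apply hf.integrableOn] using
    mul_sub_setIntegral_Iic_eq_add_setIntegral hT (fun x => hA x i j) (hA'.matrix_elem i j)
      (hf.eval j) (v j) r

end

namespace OWModel

variable {T : ℝ} {n : ℕ} (M : OWModel n)

theorem nu_inv_mul_nu (s : ℝ) : (M.nu s)⁻¹ * M.nu s = 1 :=
  Matrix.nonsing_inv_mul _ ((Matrix.isUnit_iff_isUnit_det _).1 (Matrix.isUnit_exp _))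

open scoped Matrix.Norms.Operator in
theorem hasDerivAt_nu_inv (s : ℝ) (i j : Fin n) :
    HasDerivAt (fun r => (M.nu r)⁻¹ i j) ((-(M.rho * (M.nu s)⁻¹)) i j) s := by
  have hderiv : HasDerivAt (fun r => (M.nu r)⁻¹) (-(M.rho * (M.nu s)⁻¹)) s := by
    simp only [nu, ← Matrix.exp_neg, ← neg_smul, ← neg_one_smul ℝ (M.rho * _)]
    exact (hasDerivAt_exp_smul_const' M.rho (-s)).scomp s (hasDerivAt_neg s)
  exact hasDerivAt_matrix_apply hderiv i j

theorem continuous_nu : Continuous M.nu :=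
  continuous_matrix fun i j => continuous_iff_continuousAt.2 fun s =>
    (M.hasDerivAt_nu s i j).continuousAt

theorem continuous_nu_inv : Continuous fun s => (M.nu s)⁻¹ :=
  continuous_matrix fun i j => continuous_iff_continuousAt.2 fun s =>
    (M.hasDerivAt_nu_inv s i j).continuousAt

theorem continuous_nu_mul : Continuous fun s : Time T => M.nu s * M.rho * M.gamma :=
  ((M.continuous_nu.comp continuous_subtype_val).matrix_mul continuous_const).matrix_mul
    continuous_const

/-- The part of the deviation at time `r` of a strategy with path `X` that varies continuously
with `r`, with `v` standing for the initial value `d - γ x`; adding `γ X(r)` gives the deviation. -/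
noncomputable def resiliencePart (v : Fin n → ℝ) (X : Time T → Fin n → ℝ) (r : Time T) :
    Fin n → ℝ :=
  (M.nu r)⁻¹ *ᵥ (v - ∫ s in Set.Iic r, (M.nu s * M.rho * M.gamma) *ᵥ X s)

theorem continuous_resiliencePart (hT : 0 < T) (v : Fin n → ℝ) {X : Time T → Fin n → ℝ}
    (hX : Integrable X) : Continuous (M.resiliencePart v X) :=
  (M.continuous_nu_inv.comp continuous_subtype_val).matrix_mulVec
    (continuous_const.sub (continuous_setIntegral_Iic hT
      (integrable_mulVec M.continuous_nu_mul hX)))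

theorem resiliencePart_eq (hT : 0 < T) (v : Fin n → ℝ) {X : Time T → Fin n → ℝ}
    (hX : Integrable X) (r : Time T) :
    M.resiliencePart v X r = v - ∫ s in Set.Iic r,
      M.rho *ᵥ (M.gamma *ᵥ X s + M.resiliencePart v X s) := by
  have hparts := mulVec_sub_setIntegral_Iic_eq_add_setIntegral hT M.hasDerivAt_nu_inv
    (continuous_const.matrix_mul M.continuous_nu_inv).neg
    (integrable_mulVec M.continuous_nu_mul hX) v r
  rw [M.nu_zero, inv_one, Matrix.one_mulVec] at hparts
  rw [resiliencePart, hparts, sub_eq_add_neg, ← integral_neg]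
  congr 2 with s : 1
  have hcancel : (M.nu s)⁻¹ *ᵥ ((M.nu s * M.rho * M.gamma) *ᵥ X s)
      = M.rho *ᵥ (M.gamma *ᵥ X s) := by
    simp only [Matrix.mulVec_mulVec, ← Matrix.mul_assoc, M.nu_inv_mul_nu, Matrix.one_mul]
  rw [hcancel, Matrix.neg_mulVec, ← Matrix.mulVec_mulVec, Matrix.mulVec_add, neg_add_rev]
  exact sub_eq_add_neg _ _

end OWModel

/-! ### The optimal strategy -/

section JumpToZero

variable {T : ℝ} {E : Type*} [NormedAddCommGroup E] {f : Time T → E}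

theorem ite_lt_endTime_ae_eq (f : Time T → E) :
    (fun s : Time T => if (s : ℝ) < T then f s else 0) =ᵐ[volume] f := by
  filter_upwards [ae_lt_endTime T] with s hs
  rw [if_pos hs]

theorem stronglyMeasurable_ite_lt_endTime (hf : Continuous f) :
    StronglyMeasurable fun s : Time T => if (s : ℝ) < T then f s else 0 :=
  hf.stronglyMeasurable.ite (measurableSet_lt measurable_subtype_coe measurable_const)
    stronglyMeasurable_const

theorem continuousWithinAt_Ici_ite_lt_endTime (hf : Continuous f) (s : Time T) :
    ContinuousWithinAt (fun s : Time T => if (s : ℝ) < T then f s else 0) (Set.Ici s) s := by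
  by_cases hs : (s : ℝ) < T
  · refine (hf.continuousAt.congr ?_).continuousWithinAt
    filter_upwards [(continuous_subtype_val.tendsto s).eventually (gt_mem_nhds hs)] with r hr
    rw [if_pos hr]
  · have hs_max : IsMax s := fun r _ => r.2.2.trans (not_lt.1 hs)
    rw [hs_max.Ici_eq]
    exact continuousWithinAt_singleton

theorem tendsto_nhdsLT_ite_lt_endTime (hf : Continuous f) (s : Time T) :
    Tendsto (fun s : Time T => if (s : ℝ) < T then f s else 0) (𝓝[<] s) (𝓝 (f s)) := by
  refine ((hf.tendsto s).mono_left nhdsWithin_le_nhds).congr' ?_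
  filter_upwards [self_mem_nhdsWithin] with r hr
  rw [if_pos ((Subtype.coe_lt_coe.2 hr).trans_le s.2.2)]

theorem boundedVariationOn_ite_lt_endTime [NormedSpace ℝ E] (hf : BoundedVariationOn f Set.univ) :
    BoundedVariationOn (fun s : Time T => if (s : ℝ) < T then f s else 0) Set.univ := by
  have hjump_mono : Monotone fun s : Time T => if (s : ℝ) < T then (-1 : ℝ) else 0 := by
    intro s t hst
    have hst' : (s : ℝ) ≤ t := hst
    dsimp only
    split_ifs <;> linarith
  have hjump : BoundedVariationOn (fun s : Time T => if (s : ℝ) < T then (-1 : ℝ) else 0)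
      Set.univ := (hjump_mono.monotoneOn _).boundedVariationOn (C := 1) fun s _ => by
    split_ifs <;> simp
  have hneg : BoundedVariationOn (fun s => -f s) Set.univ :=
    (LipschitzWith.id (α := E)).neg.comp_boundedVariationOn hf
  convert! hjump.fun_smul hneg using 2 with s
  split_ifs <;> simp

end JumpToZero

namespace OWModel

variable {T : ℝ} {Ω : Type*} {mΩ : MeasurableSpace Ω} {ℱ : Filtration (Time T) mΩ} {P : Measure Ω}
  {n m : ℕ} (M : OWModel n)

theorem deviation_path_eq (d : Fin n → ℝ) (X : StartedProcess T Ω n) (r : Time T) (ω : Ω) :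
    (M.deviation d X).path r ω = M.gamma *ᵥ X.path r ω
      + M.resiliencePart (d - M.gamma *ᵥ X.pre) (fun s => X.path s ω) r := rfl

theorem integrable_deviation (hT : 0 < T) (d : Fin n → ℝ) (X : StartedProcess T Ω n) {ω : Ω}
    (hX : Integrable fun s => X.path s ω) : Integrable fun s => (M.deviation d X).path s ω :=
  (integrable_mulVec continuous_const hX).add
    (integrable_of_continuous_time (M.continuous_resiliencePart hT _ hX))

theorem resiliencePart_eq_sub_integral_deviation (hT : 0 < T) (d : Fin n → ℝ)
    (X : StartedProcess T Ω n) {ω : Ω} (hX : Integrable fun s => X.path s ω) (r : Time T) :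
    M.resiliencePart (d - M.gamma *ᵥ X.pre) (fun s => X.path s ω) r
      = d - M.gamma *ᵥ X.pre - ∫ s in Set.Iic r, M.rho *ᵥ (M.deviation d X).path s ω :=
  M.resiliencePart_eq hT _ hX r

theorem isFVDeviation_deviation (hT : 0 < T) (d : Fin n → ℝ) (X : StartedProcess T Ω n)
    (hX : ∀ᵐ ω ∂P, Integrable fun s => X.path s ω) :
    M.IsFVDeviation P d X (M.deviation d X) := by
  refine ⟨rfl, ?_⟩
  filter_upwards [hX] with ω hω
  refine ⟨integrable_mulVec continuous_const (M.integrable_deviation hT d X hω), fun r => ?_⟩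
  rw [M.deviation_path_eq, M.resiliencePart_eq_sub_integral_deviation hT d X hω,
    Matrix.mulVec_sub]
  abel

theorem gammaPow_half_mulVec_initialState (x d : Fin n → ℝ) :
    M.gammaPow (1 / 2) *ᵥ M.initialState x d = d - M.gamma *ᵥ x := by
  rw [initialState, Matrix.mulVec_sub, Matrix.mulVec_mulVec, Matrix.mulVec_mulVec,
    M.gammaPow_half_mul_neg_half, M.gammaPow_half_mul_half, Matrix.one_mulVec]

/-- The position of the optimal strategy on `[0, T)`, as a function on all of `ℝ`. -/
noncomputable def optimalPosition (m : ℕ) (T : ℝ) (x d : Fin n → ℝ) (s : ℝ) : Fin n → ℝ :=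
  (-(1 / 2 : ℝ)) • ((M.gammaPow (-(1 / 2)) *
      ((M.scrR m)⁻¹ * (M.scrB m)ᵀ * (1 + ((1 / 2) * T) • M.scrBRB m)⁻¹
        + (2 : ℝ) • 1)) *ᵥ M.initialState x d)
  + s • ((1 / 2 : ℝ) • ((M.gammaPow (-(1 / 2)) * M.scrBRB m *
      (1 + ((1 / 2) * T) • M.scrBRB m)⁻¹) *ᵥ M.initialState x d))

/-- The optimal strategy: affine-linear on `[0, T)`, with block trades at `0` and at `T`. -/
noncomputable def optimalStrategy (m : ℕ) (T : ℝ) (Ω : Type*) (x d : Fin n → ℝ) :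
    StartedProcess T Ω n where
  pre := x
  path s _ := if (s : ℝ) < T then M.optimalPosition m T x d s else 0

/-- The constant value on `[0, T)` of the deviation of the optimal strategy. -/
noncomputable def optimalDeviation (m : ℕ) (T : ℝ) (x d : Fin n → ℝ) : Fin n → ℝ :=
  (-(1 / 2 : ℝ)) • ((M.gammaPow (1 / 2) * (M.scrR m)⁻¹ * (M.scrB m)ᵀ *
    (1 + ((1 / 2) * T) • M.scrBRB m)⁻¹) *ᵥ M.initialState x d)

theorem gammaPow_half_mul_scrB :
    M.gammaPow (1 / 2) * M.scrB m = -(M.rho * M.gammaPow (1 / 2)) := by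
  rw [M.scrB_eq, Matrix.mul_neg, Matrix.mul_assoc, ← Matrix.mul_assoc,
    M.gammaPow_half_mul_neg_half, Matrix.one_mul]

theorem gammaPow_half_mul_scrBRB :
    M.gammaPow (1 / 2) * M.scrBRB m
      = -(M.rho * (M.gammaPow (1 / 2) * (M.scrR m)⁻¹ * (M.scrB m)ᵀ)) := by
  rw [scrBRB, ← Matrix.mul_assoc, ← Matrix.mul_assoc, M.gammaPow_half_mul_scrB]
  simp only [Matrix.neg_mul, Matrix.mul_assoc]

section Explicit

variable (x d : Fin n → ℝ)

theorem gammaPow_half_mulVec_explicitState (s : ℝ) :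
    M.gammaPow (1 / 2) *ᵥ M.explicitState m T x d s
      = d - M.gamma *ᵥ x - s • (M.rho *ᵥ M.optimalDeviation m T x d) := by
  rw [explicitState, Matrix.mulVec_sub, M.gammaPow_half_mulVec_initialState, Matrix.mulVec_smul,
    Matrix.smul_mulVec, Matrix.mulVec_smul, Matrix.mulVec_mulVec, ← Matrix.mul_assoc,
    M.gammaPow_half_mul_scrBRB, optimalDeviation, Matrix.mulVec_smul, Matrix.mulVec_mulVec,
    Matrix.neg_mul, Matrix.neg_mulVec, smul_neg, neg_smul]
  simp only [Matrix.mul_assoc]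

theorem gamma_mulVec_optimalPosition (s : ℝ) :
    M.gamma *ᵥ M.optimalPosition m T x d s + M.gammaPow (1 / 2) *ᵥ M.explicitState m T x d s
      = M.optimalDeviation m T x d := by
  simp only [optimalPosition, explicitState, optimalDeviation, Matrix.mulVec_add,
    Matrix.mulVec_sub, Matrix.mulVec_smul, Matrix.mulVec_mulVec, Matrix.smul_mulVec]
  simp only [← Matrix.mul_assoc, M.gamma_mul_gammaPow_neg_half, Matrix.mul_add, Matrix.add_mulVec,
    Matrix.mul_smul, Matrix.mul_one, Matrix.smul_mulVec]
  module

theorem continuous_optimalPosition :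
    Continuous fun s : Time T => M.optimalPosition m T x d s := by
  unfold optimalPosition
  fun_prop

theorem boundedVariationOn_optimalPosition :
    BoundedVariationOn (fun s : Time T => M.optimalPosition m T x d s) Set.univ := by
  have hval : BoundedVariationOn (fun s : Time T => (s : ℝ)) Set.univ :=
    (Subtype.mono_coe _ |>.monotoneOn _).boundedVariationOn (C := T) fun s _ =>
      (abs_of_nonneg s.2.1).trans_le s.2.2
  exact ((LipschitzWith.const (α := ℝ) _).add
    (ContinuousLinearMap.toSpanSingleton ℝ _).lipschitz).comp_boundedVariationOn hval

theorem integrable_optimalStrategy (ω : Ω) :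
    Integrable fun s => (M.optimalStrategy m T Ω x d).path s ω :=
  (integrable_of_continuous_time (M.continuous_optimalPosition (m := m) x d)).congr
    (ite_lt_endTime_ae_eq _).symm

theorem resiliencePart_optimalStrategy (hT : 0 < T) (ω : Ω) (r : Time T) :
    M.resiliencePart (d - M.gamma *ᵥ x) (fun s => (M.optimalStrategy m T Ω x d).path s ω) r
      = M.gammaPow (1 / 2) *ᵥ M.explicitState m T x d r := by
  set X := fun s => (M.optimalStrategy m T Ω x d).path s ω
  have hX : Integrable X := M.integrable_optimalStrategy x d ω
  have hstate : Continuous fun s : Time T => M.gammaPow (1 / 2) *ᵥ M.explicitState m T x d s :=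
    continuous_const.matrix_mulVec
      ((M.continuous_explicitState x d).comp continuous_subtype_val)
  have hstate_eq : ∀ t : Time T, M.gammaPow (1 / 2) *ᵥ M.explicitState m T x d t
      = d - M.gamma *ᵥ x - ∫ s in Set.Iic t, M.rho *ᵥ
        (M.gamma *ᵥ X s + M.gammaPow (1 / 2) *ᵥ M.explicitState m T x d s) := by
    intro t
    have hconst : ∀ᵐ s : Time T, M.rho *ᵥ (M.gamma *ᵥ X s
        + M.gammaPow (1 / 2) *ᵥ M.explicitState m T x d s)
        = M.rho *ᵥ M.optimalDeviation m T x d := by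
      filter_upwards [ite_lt_endTime_ae_eq fun s => M.optimalPosition m T x d s] with s hs
      rw [← M.gamma_mulVec_optimalPosition x d s, ← hs]
      rfl
    rw [integral_congr_ae (ae_restrict_of_ae hconst), setIntegral_Iic_const,
      M.gammaPow_half_mulVec_explicitState]
  have hsplit : ∀ (w : Time T → Fin n → ℝ) (_ : Continuous w) (t : Time T),
      d - M.gamma *ᵥ x - ∫ s in Set.Iic t, M.rho *ᵥ (M.gamma *ᵥ X s + w s)
        = (d - M.gamma *ᵥ x - ∫ s in Set.Iic t, M.rho *ᵥ (M.gamma *ᵥ X s))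
          + ∫ s in Set.Iic t, (-M.rho) *ᵥ w s := fun w hw t => by
    have hgammaX := integrable_mulVec (A := fun _ => M.gamma) continuous_const hX
    simp only [Matrix.mulVec_add, Matrix.neg_mulVec]
    rw [integral_add
      (integrable_mulVec (A := fun _ => M.rho) continuous_const hgammaX).integrableOn
      (integrable_of_continuous_time (continuous_const.matrix_mulVec hw)).integrableOn,
      integral_neg]
    abel
  have hresilience := M.continuous_resiliencePart hT (d - M.gamma *ᵥ x) hX
  exact congrFun (eq_of_eq_add_setIntegral_mulVec hT (A := fun _ => -M.rho) continuous_const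
    hresilience hstate
    (fun t => (M.resiliencePart_eq hT _ hX t).trans (hsplit _ hresilience t))
    (fun t => (hstate_eq t).trans (hsplit _ hstate t))) r

theorem deviation_optimalStrategy_of_lt (hT : 0 < T) (s : Time T) (ω : Ω) (hs : (s : ℝ) < T) :
    (M.deviation d (M.optimalStrategy m T Ω x d)).path s ω = M.optimalDeviation m T x d := by
  rw [M.deviation_path_eq, ← M.gamma_mulVec_optimalPosition x d s,
    ← M.resiliencePart_optimalStrategy x d hT ω s]
  simp only [optimalStrategy, if_pos hs]

theorem optimalStrategy_endTime (hT : 0 < T) (ω : Ω) :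
    (M.optimalStrategy m T Ω x d).path (endTime hT) ω = 0 :=
  if_neg (lt_irrefl T)

theorem deviation_optimalStrategy_endTime (hκ : (M.kappa m).PosDef) (hT : 0 < T) (ω : Ω) :
    (M.deviation d (M.optimalStrategy m T Ω x d)).path (endTime hT) ω =
      (M.gammaPow (1 / 2) * (1 + ((1 / 2) * T) • M.scrBRB m)⁻¹) *ᵥ M.initialState x d := by
  have hstate : M.explicitState m T x d T
      = (1 + ((1 / 2) * T) • M.scrBRB m)⁻¹ *ᵥ M.initialState x d := by
    rw [M.explicitState_eq_mulVec hκ x d hT.le, sub_self, mul_zero, zero_smul, add_zero,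
      Matrix.one_mul]
  rw [← Matrix.mulVec_mulVec, ← hstate]
  refine (M.deviation_path_eq d _ _ ω).trans ?_
  rw [M.optimalStrategy_endTime, Matrix.mulVec_zero, zero_add]
  exact M.resiliencePart_optimalStrategy x d hT ω (endTime hT)

variable [IsFiniteMeasure P]

theorem sqIntegrableDeviation_optimalStrategy (hT : 0 < T) :
    M.SqIntegrableDeviation P (M.deviation d (M.optimalStrategy m T Ω x d)) := by
  have hconst : ∀ ω : Ω, ∫⁻ s, ENNReal.ofReal
      ((M.gammaPow (-(1 / 2)) *ᵥ (M.deviation d (M.optimalStrategy m T Ω x d)).path s ω) ⬝ᵥ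
        (M.gammaPow (-(1 / 2)) *ᵥ (M.deviation d (M.optimalStrategy m T Ω x d)).path s ω))
      = ∫⁻ _ : Time T, ENNReal.ofReal ((M.gammaPow (-(1 / 2)) *ᵥ M.optimalDeviation m T x d) ⬝ᵥ
          (M.gammaPow (-(1 / 2)) *ᵥ M.optimalDeviation m T x d)) := fun ω => by
    refine lintegral_congr_ae ?_
    filter_upwards [ae_lt_endTime T] with s hs
    rw [M.deviation_optimalStrategy_of_lt x d hT s ω hs]
  rw [SqIntegrableDeviation, lintegral_congr hconst, lintegral_const, lintegral_const]
  finiteness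

theorem memPM_optimalStrategy (hT : 0 < T) :
    M.MemPM hT ℱ P (fun _ => 0) x d (M.optimalStrategy m T Ω x d) where
  prog t := (stronglyMeasurable_ite_lt_endTime
    (M.continuous_optimalPosition x d)).comp_measurable
      (measurable_subtype_coe.comp measurable_fst)
  initial := rfl
  terminal := ae_of_all _ fun ω => M.optimalStrategy_endTime x d hT ω
  sq_integrable := ae_of_all _ fun ω => by
    have hpos := M.continuous_optimalPosition (m := m) (T := T) x d
    refine lt_of_eq_of_lt (lintegral_congr_ae ?_)
      (integrable_of_continuous_time (hpos.dotProduct hpos)).lintegral_lt_top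
    filter_upwards [ite_lt_endTime_ae_eq fun s => M.optimalPosition m T x d s] with s hs
    simp only [optimalStrategy, hs]
  dev := M.sqIntegrableDeviation_optimalStrategy x d hT

theorem memFV_optimalStrategy (hT : 0 < T) :
    M.MemFV m hT ℱ P (fun _ => 0) x d (M.optimalStrategy m T Ω x d) where
  adapted _ := stronglyMeasurable_const
  rightContinuous := ae_of_all _ fun _ s =>
    continuousWithinAt_Ici_ite_lt_endTime (M.continuous_optimalPosition x d) s
  leftLimits := ae_of_all _ fun _ s =>
    ⟨_, tendsto_nhdsLT_ite_lt_endTime (M.continuous_optimalPosition x d) s⟩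
  finiteVariation := ae_of_all _ fun _ =>
    boundedVariationOn_ite_lt_endTime (M.boundedVariationOn_optimalPosition x d)
  initial := rfl
  terminal := ae_of_all _ fun ω => M.optimalStrategy_endTime x d hT ω
  dev := ⟨M.deviation d (M.optimalStrategy m T Ω x d),
    M.isFVDeviation_deviation hT d _
      (ae_of_all _ fun ω => M.integrable_optimalStrategy x d ω),
    fun _ => stronglyMeasurable_const' fun _ _ => rfl,
    M.sqIntegrableDeviation_optimalStrategy x d hT, by simp [VolIntegrableDeviation]⟩

end Explicit

end OWModel

/-! ### Linear-quadratic control -/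

section SecondMoments

variable {α Ω ι : Type*} [MeasurableSpace α] [MeasurableSpace Ω] [Fintype ι]
  {μ : Measure α} {P : Measure Ω} {E : Type*} [NormedAddCommGroup E]

theorem sq_integral_le [IsFiniteMeasure μ] {f : α → ℝ} (hf : MemLp f 2 μ) :
    (∫ s, f s ∂μ) ^ 2 ≤ μ.real Set.univ * ∫ s, f s ^ 2 ∂μ := by
  have hint := hf.integrable one_le_two
  have hnonneg : ∀ c : ℝ,
      0 ≤ μ.real Set.univ * (c * c) + (-2 * ∫ s, f s ∂μ) * c + ∫ s, f s ^ 2 ∂μ := by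
    intro c
    have hcross : Integrable (fun s => f s ^ 2 - 2 * c * f s) μ :=
      hf.integrable_sq.sub (hint.const_mul _)
    calc (0 : ℝ) ≤ ∫ s, (f s - c) ^ 2 ∂μ := integral_nonneg fun _ => sq_nonneg _
      _ = ∫ s, (f s ^ 2 - 2 * c * f s + c * c) ∂μ := by congr with s; ring
      _ = _ := by
        rw [integral_add hcross (integrable_const _),
          integral_sub hf.integrable_sq (hint.const_mul _), integral_const_mul, integral_const,
          smul_eq_mul]
        ring
  have hdiscrim := discrim_le_zero hnonneg
  rw [discrim] at hdiscrim
  linarith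

theorem memLp_two_integral_left [NormedSpace ℝ E] [IsFiniteMeasure μ] [IsFiniteMeasure P]
    {f : α × Ω → E} (hf : MemLp f 2 (μ.prod P)) : MemLp (fun ω => ∫ s, f (s, ω) ∂μ) 2 P := by
  have hsq := (memLp_two_iff_integrable_sq_norm hf.1).1 hf
  have hmeas := (hf.integrable one_le_two).integral_prod_right.1
  refine (memLp_two_iff_integrable_sq_norm hmeas).2 <|
    (hsq.integral_prod_right.const_mul (μ.real Set.univ)).mono' (hmeas.norm.pow 2) ?_
  filter_upwards [(hf.integrable one_le_two).prod_left_ae, hsq.prod_left_ae] with ω hω hω2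
  rw [Real.norm_of_nonneg (by positivity)]
  exact (pow_le_pow_left₀ (norm_nonneg _) (norm_integral_le_integral_norm _) 2).trans
    (sq_integral_le ((memLp_two_iff_integrable_sq hω.1.norm).2 hω2))

theorem ae_memLp_two_left [SFinite μ] [SFinite P] {f : α × Ω → E}
    (hfm : StronglyMeasurable f) (hf : MemLp f 2 (μ.prod P)) :
    ∀ᵐ ω ∂P, MemLp (fun s => f (s, ω)) 2 μ := by
  filter_upwards [((memLp_two_iff_integrable_sq_norm hf.1).1 hf).prod_left_ae] with ω hω
  exact (memLp_two_iff_integrable_sq_norm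
    (hfm.comp_measurable measurable_prodMk_right).aestronglyMeasurable).2 hω

theorem sq_norm_le_dotProduct_self (v : ι → ℝ) : ‖v‖ ^ 2 ≤ v ⬝ᵥ v := by
  have hcoord : ∀ i, v i ^ 2 ≤ v ⬝ᵥ v := fun i => (pow_two (v i)).trans_le <|
    Finset.single_le_sum (f := fun j => v j * v j) (fun j _ => mul_self_nonneg _)
      (Finset.mem_univ i)
  have hnorm : ‖v‖ ≤ √(v ⬝ᵥ v) := (pi_norm_le_iff_of_nonneg (Real.sqrt_nonneg _)).2
    fun i => Real.abs_le_sqrt (hcoord i)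
  exact (Real.le_sqrt (norm_nonneg _) (dotProduct_star_self_nonneg v)).1 hnorm

theorem memLp_two_of_lintegral_dotProduct_self_lt_top {u : α → ι → ℝ}
    (hu : AEStronglyMeasurable u μ) (h : ∫⁻ s, ENNReal.ofReal (u s ⬝ᵥ u s) ∂μ < ⊤) :
    MemLp u 2 μ := by
  refine (memLp_two_iff_integrable_sq_norm hu).2 <|
    (lintegral_ofReal_ne_top_iff_integrable (hu.norm.pow 2)
      (ae_of_all _ fun _ => sq_nonneg _)).1 (ne_of_lt <| lt_of_le_of_lt ?_ h)
  exact lintegral_mono fun s => ENNReal.ofReal_le_ofReal (sq_norm_le_dotProduct_self _)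

theorem integrable_dotProduct_of_memLp_two {u v : α → ι → ℝ} (hu : MemLp u 2 μ)
    (hv : MemLp v 2 μ) : Integrable (fun s => u s ⬝ᵥ v s) μ :=
  integrable_finsetSum _ fun i _ => (hu.eval i).integrable_mul (hv.eval i)

theorem memLp_mulVec {κ : Type*} [Fintype κ] {p : ℝ≥0∞} (A : Matrix κ ι ℝ) {u : α → ι → ℝ}
    (hu : MemLp u p μ) : MemLp (fun s => A *ᵥ u s) p μ :=
  (Matrix.mulVecLin A).toContinuousLinearMap.comp_memLp' hu

theorem integral_dotProduct_const (c : ι → ℝ) {u : α → ι → ℝ} (hu : Integrable u μ) :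
    ∫ s, c ⬝ᵥ u s ∂μ = c ⬝ᵥ ∫ s, u s ∂μ := by
  simp only [dotProduct, integral_apply hu]
  rw [integral_finsetSum _ fun i _ => (hu.eval i).const_mul (c i)]
  simp only [integral_const_mul]

end SecondMoments

section LinearQuadratic

variable {α Ω ι : Type*} [MeasurableSpace α] [MeasurableSpace Ω] [Fintype ι]
  {μ : Measure α} {P : Measure Ω} {B K : Matrix ι ι ℝ} {h v : ι → ℝ} {u w : α → ι → ℝ}

/-- The linear-quadratic cost `½ |h + B ∫ u|² + ∫ uᵀ K u` of the open-loop control `u`, which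
drives the state from `h` to `h + B ∫ u`. -/
noncomputable def lqCost (μ : Measure α) (B K : Matrix ι ι ℝ) (h : ι → ℝ) (u : α → ι → ℝ) : ℝ :=
  1 / 2 * ((h + B *ᵥ ∫ s, u s ∂μ) ⬝ᵥ (h + B *ᵥ ∫ s, u s ∂μ)) + ∫ s, u s ⬝ᵥ K *ᵥ u s ∂μ

theorem lqCost_congr (huw : u =ᵐ[μ] w) : lqCost μ B K h u = lqCost μ B K h w := by
  have hquad : (fun s => u s ⬝ᵥ K *ᵥ u s) =ᵐ[μ] fun s => w s ⬝ᵥ K *ᵥ w s :=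
    huw.fun_comp fun x => x ⬝ᵥ K *ᵥ x
  rw [lqCost, lqCost, integral_congr_ae huw, integral_congr_ae hquad]

theorem integrable_terminal_lqCost [IsFiniteMeasure μ] [IsFiniteMeasure P] (B : Matrix ι ι ℝ)
    (h : ι → ℝ) {u : α → Ω → ι → ℝ} (hu : MemLp (fun p : α × Ω => u p.1 p.2) 2 (μ.prod P)) :
    Integrable (fun ω => (h + B *ᵥ ∫ s, u s ω ∂μ) ⬝ᵥ (h + B *ᵥ ∫ s, u s ω ∂μ)) P := by
  have hstate : MemLp (fun ω => h + B *ᵥ ∫ s, u s ω ∂μ) 2 P :=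
    (memLp_const h).add (memLp_mulVec B (memLp_two_integral_left hu))
  exact integrable_dotProduct_of_memLp_two hstate hstate

theorem integrable_running_lqCost [SFinite μ] [SFinite P] (K : Matrix ι ι ℝ)
    {u : α → Ω → ι → ℝ} (hu : MemLp (fun p : α × Ω => u p.1 p.2) 2 (μ.prod P)) :
    Integrable (fun ω => ∫ s, u s ω ⬝ᵥ K *ᵥ u s ω ∂μ) P :=
  (integrable_dotProduct_of_memLp_two hu (memLp_mulVec K hu)).integral_prod_right

theorem integrable_lqCost [IsFiniteMeasure μ] [IsFiniteMeasure P] (B K : Matrix ι ι ℝ)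
    (h : ι → ℝ) {u : α → Ω → ι → ℝ} (hu : MemLp (fun p : α × Ω => u p.1 p.2) 2 (μ.prod P)) :
    Integrable (fun ω => lqCost μ B K h fun s => u s ω) P :=
  ((integrable_terminal_lqCost B h hu).const_mul _).add (integrable_running_lqCost K hu)

theorem dotProduct_mulVec_comm (hK : K.IsSymm) (x y : ι → ℝ) :
    x ⬝ᵥ K *ᵥ y = (K *ᵥ x) ⬝ᵥ y := by
  rw [Matrix.dotProduct_mulVec, ← Matrix.mulVec_transpose, hK]

theorem add_dotProduct_add_self (x y : ι → ℝ) :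
    (x + y) ⬝ᵥ (x + y) = x ⬝ᵥ x + 2 * (x ⬝ᵥ y) + y ⬝ᵥ y := by
  rw [add_dotProduct, dotProduct_add, dotProduct_add, dotProduct_comm y x]
  ring

theorem integral_add_dotProduct_mulVec_add [IsFiniteMeasure μ] (hK : K.IsSymm)
    (hw : MemLp w 2 μ) (v : ι → ℝ) :
    ∫ s, (v + w s) ⬝ᵥ K *ᵥ (v + w s) ∂μ
      = ∫ _, v ⬝ᵥ K *ᵥ v ∂μ + 2 * ((K *ᵥ v) ⬝ᵥ ∫ s, w s ∂μ) + ∫ s, w s ⬝ᵥ K *ᵥ w s ∂μ := by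
  have hcross : Integrable (fun s => (K *ᵥ v) ⬝ᵥ w s) μ :=
    integrable_dotProduct_of_memLp_two (memLp_const _) hw
  have hlinear : Integrable (fun s => v ⬝ᵥ K *ᵥ v + 2 * ((K *ᵥ v) ⬝ᵥ w s)) μ :=
    (integrable_const _).add (hcross.const_mul 2)
  have hexpand : ∀ s, (v + w s) ⬝ᵥ K *ᵥ (v + w s)
      = v ⬝ᵥ K *ᵥ v + 2 * ((K *ᵥ v) ⬝ᵥ w s) + w s ⬝ᵥ K *ᵥ w s := by
    intro s
    rw [Matrix.mulVec_add, add_dotProduct, dotProduct_add, dotProduct_add,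
      dotProduct_mulVec_comm hK v (w s), dotProduct_comm (w s) (K *ᵥ v)]
    ring
  simp only [hexpand]
  rw [integral_add hlinear (integrable_dotProduct_of_memLp_two hw (memLp_mulVec K hw)),
    integral_add (integrable_const _) (hcross.const_mul 2), integral_const_mul,
    integral_dotProduct_const _ (hw.integrable one_le_two)]

theorem lqCost_const_add [IsFiniteMeasure μ] (hK : K.IsSymm)
    (hv : (2 : ℝ) • (K *ᵥ v) = -(Bᵀ *ᵥ (h + μ.real Set.univ • (B *ᵥ v)))) (hw : MemLp w 2 μ) :
    lqCost μ B K h (fun s => v + w s) = lqCost μ B K h (fun _ => v) + lqCost μ B K 0 w := by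
  have hstate : h + B *ᵥ ∫ s, (v + w s) ∂μ = (h + B *ᵥ ∫ _, v ∂μ) + B *ᵥ ∫ s, w s ∂μ := by
    rw [integral_add (integrable_const v) (hw.integrable one_le_two), Matrix.mulVec_add,
      add_assoc]
  have hcross : (h + B *ᵥ ∫ _, v ∂μ) ⬝ᵥ (B *ᵥ ∫ s, w s ∂μ)
      = -(2 * ((K *ᵥ v) ⬝ᵥ ∫ s, w s ∂μ)) := by
    rw [integral_const, Matrix.mulVec_smul, Matrix.dotProduct_mulVec, ← Matrix.mulVec_transpose,
      ← neg_eq_iff_eq_neg.2 hv, neg_dotProduct, smul_dotProduct, smul_eq_mul]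
  simp only [lqCost]
  rw [integral_add_dotProduct_mulVec_add hK hw, hstate, zero_add,
    add_dotProduct_add_self, hcross]
  ring

theorem integral_le_lqCost (μ : Measure α) (B K : Matrix ι ι ℝ) (h : ι → ℝ) (u : α → ι → ℝ) :
    ∫ s, u s ⬝ᵥ K *ᵥ u s ∂μ ≤ lqCost μ B K h u :=
  le_add_of_nonneg_left (mul_nonneg (by norm_num) (dotProduct_star_self_nonneg _))

theorem lqCost_eq_const_add [IsFiniteMeasure μ] (hK : K.IsSymm)
    (hv : (2 : ℝ) • (K *ᵥ v) = -(Bᵀ *ᵥ (h + μ.real Set.univ • (B *ᵥ v)))) (hu : MemLp u 2 μ) :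
    lqCost μ B K h u
      = lqCost μ B K h (fun _ => v) + lqCost μ B K 0 (fun s => u s - v) := by
  have hdiff : MemLp (fun s => u s - v) 2 μ := hu.sub (memLp_const v)
  simpa only [add_sub_cancel] using lqCost_const_add hK hv hdiff

theorem lqCost_const_le [IsFiniteMeasure μ] (hK : K.PosDef)
    (hv : (2 : ℝ) • (K *ᵥ v) = -(Bᵀ *ᵥ (h + μ.real Set.univ • (B *ᵥ v)))) (hu : MemLp u 2 μ) :
    lqCost μ B K h (fun _ => v) ≤ lqCost μ B K h u := by
  rw [lqCost_eq_const_add (Matrix.isHermitian_iff_isSymm.1 hK.isHermitian) hv hu]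
  exact le_add_of_nonneg_right <| (integral_nonneg fun s =>
    hK.posSemidef.dotProduct_mulVec_nonneg (u s - v)).trans (integral_le_lqCost _ _ _ _ _)

theorem ae_eq_of_lqCost_eq_lqCost_const [IsFiniteMeasure μ] (hK : K.PosDef)
    (hv : (2 : ℝ) • (K *ᵥ v) = -(Bᵀ *ᵥ (h + μ.real Set.univ • (B *ᵥ v)))) (hu : MemLp u 2 μ)
    (heq : lqCost μ B K h (fun _ => v) = lqCost μ B K h u) : ∀ᵐ s ∂μ, u s = v := by
  rw [lqCost_eq_const_add (Matrix.isHermitian_iff_isSymm.1 hK.isHermitian) hv hu,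
    left_eq_add] at heq
  have hdiff : MemLp (fun s => u s - v) 2 μ := hu.sub (memLp_const v)
  have hnonneg : ∀ s, 0 ≤ (u s - v) ⬝ᵥ K *ᵥ (u s - v) := fun s =>
    hK.posSemidef.dotProduct_mulVec_nonneg (u s - v)
  have hzero := (integral_eq_zero_iff_of_nonneg hnonneg
    (integrable_dotProduct_of_memLp_two hdiff (memLp_mulVec K hdiff))).1
    (le_antisymm (heq ▸ integral_le_lqCost _ _ _ _ _) (integral_nonneg hnonneg))
  filter_upwards [hzero] with s hs
  by_contra hne
  exact (hK.dotProduct_mulVec_pos (sub_ne_zero.2 hne)).ne' hs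

end LinearQuadratic

/-! ### Optimality -/

theorem volume_real_univ_time {T : ℝ} (hT : 0 ≤ T) :
    (volume : Measure (Time T)).real Set.univ = T := by
  rw [Measure.real, Measure.Subtype.volume_univ measurableSet_Icc.nullMeasurableSet,
    Real.volume_Icc, sub_zero, ENNReal.toReal_ofReal hT]

theorem stronglyMeasurable_setIntegral_Iic {α Ω E : Type*} [MeasurableSpace α]
    [MeasurableSpace Ω] [TopologicalSpace α] [LinearOrder α] [OrderClosedTopology α]
    [SecondCountableTopology α] [OpensMeasurableSpace α] [NormedAddCommGroup E] [NormedSpace ℝ E]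
    (μ : Measure α) [SFinite μ] {f : α → Ω → E}
    (hf : StronglyMeasurable fun p : α × Ω => f p.1 p.2) :
    StronglyMeasurable fun p : α × Ω => ∫ s in Set.Iic p.1, f s p.2 ∂μ := by
  have hswap : Measurable fun q : (α × Ω) × α => (q.2, q.1.2) := by fun_prop
  have hindicator : StronglyMeasurable ({q : (α × Ω) × α | q.2 ≤ q.1.1}.indicator
      fun q => f q.2 q.1.2) :=
    (hf.comp_measurable hswap).indicator
      (measurableSet_le measurable_snd (measurable_fst.comp measurable_fst))
  refine (congrArg StronglyMeasurable (funext fun p => ?_)).mp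
    (hindicator.integral_prod_right' (ν := μ))
  exact integral_indicator (f := fun s => f s p.2) (measurableSet_Iic (a := p.1))

namespace OWModel

variable {n m : ℕ} {T : ℝ} {Ω : Type*} {mΩ : MeasurableSpace Ω} {ℱ : Filtration (Time T) mΩ}
  {P : Measure Ω} (M : OWModel n) {hT : 0 < T} {x d : Fin n → ℝ} {X : StartedProcess T Ω n}

/-- The rescaled deviation `γ^{-1/2} D` of the strategy `X`. It is the control `u` of the
linear-quadratic problem to which the minimization of the cost reduces. -/
noncomputable def scaledDeviation (d : Fin n → ℝ) (X : StartedProcess T Ω n) (s : Time T) (ω : Ω) :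
    Fin n → ℝ :=
  M.gammaPow (-(1 / 2)) *ᵥ (M.deviation d X).path s ω

theorem gammaPow_half_mulVec_scaledDeviation (d : Fin n → ℝ) (X : StartedProcess T Ω n)
    (s : Time T) (ω : Ω) :
    M.gammaPow (1 / 2) *ᵥ M.scaledDeviation d X s ω = (M.deviation d X).path s ω := by
  rw [scaledDeviation, Matrix.mulVec_mulVec, M.gammaPow_half_mul_neg_half, Matrix.one_mulVec]

theorem dotProduct_gammaPow_conj_mulVec (A : Matrix (Fin n) (Fin n) ℝ) (v : Fin n → ℝ) :
    v ⬝ᵥ ((M.gammaPow (-(1 / 2)) * A * M.gammaPow (-(1 / 2))) *ᵥ v)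
      = (M.gammaPow (-(1 / 2)) *ᵥ v) ⬝ᵥ A *ᵥ (M.gammaPow (-(1 / 2)) *ᵥ v) := by
  rw [Matrix.mul_assoc, ← Matrix.mulVec_mulVec, dotProduct_mulVec_comm (M.gammaPow_transpose _),
    Matrix.mulVec_mulVec]

theorem stronglyMeasurable_deviation (hT : 0 < T) (d : Fin n → ℝ)
    (hX : IsStronglyProgressive ℱ X.path) :
    StronglyMeasurable fun p : Time T × Ω => (M.deviation d X).path p.1 p.2 := by
  have hXm := stronglyMeasurable_uncurry_of_isStronglyProgressive hT hX
  have hmetrizable : TopologicalSpace.PseudoMetrizableSpace (Matrix (Fin n) (Fin n) ℝ) :=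
    inferInstanceAs (TopologicalSpace.PseudoMetrizableSpace (Fin n → Fin n → ℝ))
  have hmulVec : Continuous fun p : Matrix (Fin n) (Fin n) ℝ × (Fin n → ℝ) => p.1 *ᵥ p.2 :=
    continuous_fst.matrix_mulVec continuous_snd
  have hnu_mul : StronglyMeasurable fun p : Time T × Ω => M.nu p.1 * M.rho * M.gamma :=
    M.continuous_nu_mul.stronglyMeasurable.comp_measurable measurable_fst
  have hnu_inv : StronglyMeasurable fun p : Time T × Ω => (M.nu p.1)⁻¹ :=
    (M.continuous_nu_inv.comp continuous_subtype_val).stronglyMeasurable.comp_measurable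
      measurable_fst
  have hintegral := stronglyMeasurable_setIntegral_Iic (volume : Measure (Time T))
    (f := fun s ω => (M.nu s * M.rho * M.gamma) *ᵥ X.path s ω)
    (hmulVec.comp_stronglyMeasurable (hnu_mul.prodMk hXm))
  exact ((continuous_const.matrix_mulVec continuous_id).comp_stronglyMeasurable hXm).add
    (hmulVec.comp_stronglyMeasurable (hnu_inv.prodMk (stronglyMeasurable_const.sub hintegral)))

variable {M}

theorem MemPM.stronglyMeasurable_scaledDeviation {ξ : Ω → Fin n → ℝ}
    (h : M.MemPM hT ℱ P ξ x d X) :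
    StronglyMeasurable fun p : Time T × Ω => M.scaledDeviation d X p.1 p.2 :=
  (continuous_const.matrix_mulVec continuous_id).comp_stronglyMeasurable
    (M.stronglyMeasurable_deviation hT d h.prog)

theorem MemPM.memLp_scaledDeviation [SFinite P] {ξ : Ω → Fin n → ℝ}
    (h : M.MemPM hT ℱ P ξ x d X) :
    MemLp (fun p : Time T × Ω => M.scaledDeviation d X p.1 p.2) 2 (volume.prod P) := by
  have hmeas := h.stronglyMeasurable_scaledDeviation
  have hsq : Continuous fun v : Fin n → ℝ => v ⬝ᵥ v := continuous_id.dotProduct continuous_id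
  refine memLp_two_of_lintegral_dotProduct_self_lt_top hmeas.aestronglyMeasurable ?_
  rw [lintegral_prod_symm' _ (hsq.comp_stronglyMeasurable hmeas).measurable.ennreal_ofReal]
  exact h.dev

theorem MemPM.ae_memLp_scaledDeviation [SFinite P] {ξ : Ω → Fin n → ℝ}
    (h : M.MemPM hT ℱ P ξ x d X) : ∀ᵐ ω ∂P, MemLp (fun s => M.scaledDeviation d X s ω) 2 :=
  ae_memLp_two_left h.stronglyMeasurable_scaledDeviation h.memLp_scaledDeviation

theorem MemPM.integrable_path {ξ : Ω → Fin n → ℝ} (h : M.MemPM hT ℱ P ξ x d X) :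
    ∀ᵐ ω ∂P, Integrable fun s => X.path s ω := by
  filter_upwards [h.sq_integrable] with ω hω
  have hmeas := (stronglyMeasurable_uncurry_of_isStronglyProgressive hT h.prog).comp_measurable
    (measurable_prodMk_right (y := ω))
  exact (memLp_two_of_lintegral_dotProduct_self_lt_top hmeas.aestronglyMeasurable hω).integrable
    one_le_two

theorem MemPM.scaledDeviation_endTime (m : ℕ) (h : M.MemPM hT ℱ P (fun _ => 0) x d X) :
    ∀ᵐ ω ∂P, M.scaledDeviation d X (endTime hT) ω
      = M.initialState x d + M.scrB m *ᵥ ∫ s, M.scaledDeviation d X s ω := by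
  filter_upwards [h.integrable_path, h.terminal] with ω hω hterminal
  have hD := M.integrable_deviation hT d X hω
  have hresilience := M.resiliencePart_eq_sub_integral_deviation hT d X hω (endTime hT)
  rw [Iic_endTime, setIntegral_univ, integral_mulVec _ hD, h.initial] at hresilience
  have hcontrol : ∫ s, M.scaledDeviation d X s ω
      = M.gammaPow (-(1 / 2)) *ᵥ ∫ s, (M.deviation d X).path s ω := integral_mulVec _ hD
  rw [hcontrol, scaledDeviation, M.deviation_path_eq, hterminal, Matrix.mulVec_zero, zero_add,
    h.initial, hresilience, ← M.gammaPow_half_mulVec_initialState, Matrix.mulVec_sub,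
    Matrix.mulVec_mulVec, Matrix.mulVec_mulVec, Matrix.mulVec_mulVec,
    M.gammaPow_neg_half_mul_half, Matrix.one_mulVec, M.scrB_eq, Matrix.neg_mul,
    Matrix.neg_mulVec, sub_eq_add_neg, Matrix.mul_assoc _ (M.gammaPow (1 / 2)),
    M.gammaPow_half_mul_neg_half, Matrix.mul_one]

theorem MemPM.terminalCost_ae_eq (m : ℕ) (h : M.MemPM hT ℱ P (fun _ => 0) x d X) :
    (fun ω => (M.deviation d X).path (endTime hT) ω ⬝ᵥ
      (M.gammaPow (-1) *ᵥ (M.deviation d X).path (endTime hT) ω)) =ᵐ[P] fun ω =>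
      (M.initialState x d + M.scrB m *ᵥ ∫ s, M.scaledDeviation d X s ω) ⬝ᵥ
        (M.initialState x d + M.scrB m *ᵥ ∫ s, M.scaledDeviation d X s ω) := by
  filter_upwards [h.scaledDeviation_endTime m] with ω hω
  have hconj := M.dotProduct_gammaPow_conj_mulVec 1 ((M.deviation d X).path (endTime hT) ω)
  rw [Matrix.mul_one, Matrix.one_mulVec, M.gammaPow_neg_half_mul_neg_half] at hconj
  rw [hconj, ← hω, scaledDeviation]

theorem MemPM.costPM_ae_eq [IsFiniteMeasure P] (h : M.MemPM hT ℱ P (fun _ => 0) x d X) :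
    M.costPM m hT ℱ P d X =ᵐ[P] fun ω =>
      (P[fun ω => lqCost volume (M.scrB m) (M.kappa m) (M.initialState x d)
        fun s => M.scaledDeviation d X s ω | ℱ (startTime hT)]) ω
      - 1 / 2 * (d ⬝ᵥ (M.gammaPow (-1) *ᵥ d)) := by
  set terminal : Ω → ℝ := fun ω => (M.deviation d X).path (endTime hT) ω ⬝ᵥ
    (M.gammaPow (-1) *ᵥ (M.deviation d X).path (endTime hT) ω)
  set running : Ω → ℝ := fun ω => ∫ s, M.scaledDeviation d X s ω ⬝ᵥ
    M.kappa m *ᵥ M.scaledDeviation d X s ω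
  have hterminal : Integrable terminal P :=
    (integrable_terminal_lqCost (M.scrB m) _ h.memLp_scaledDeviation).congr
      (h.terminalCost_ae_eq m).symm
  have hcost : (fun ω => lqCost volume (M.scrB m) (M.kappa m) (M.initialState x d)
      fun s => M.scaledDeviation d X s ω) =ᵐ[P] (1 / 2 : ℝ) • terminal + running := by
    filter_upwards [h.terminalCost_ae_eq m] with ω hω
    exact congrArg (fun c => 1 / 2 * c + running ω) hω.symm
  filter_upwards [condExp_congr_ae (m := ℱ (startTime hT)) hcost,
    condExp_add (hterminal.smul (1 / 2 : ℝ))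
      (integrable_running_lqCost (M.kappa m) h.memLp_scaledDeviation) (ℱ (startTime hT)),
    condExp_smul (μ := P) (1 / 2 : ℝ) terminal (ℱ (startTime hT))] with ω hω hadd hsmul
  have hrisk : P[fun _ : Ω => (0 : ℝ) | ℱ (startTime hT)] = 0 := condExp_zero
  rw [hω, hadd, Pi.add_apply, hsmul]
  simp only [costPM, costPMGeneral, Matrix.zero_mulVec, dotProduct_zero, integral_zero, hrisk,
    M.dotProduct_gammaPow_conj_mulVec, Pi.smul_apply, Pi.zero_apply, smul_eq_mul, add_zero]
  rfl

variable (M)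

/-- The constant value on `[0, T)` of the rescaled deviation of the optimal strategy. -/
noncomputable def optimalControl (m : ℕ) (T : ℝ) (x d : Fin n → ℝ) : Fin n → ℝ :=
  M.gammaPow (-(1 / 2)) *ᵥ M.optimalDeviation m T x d

theorem optimalControl_eq (x d : Fin n → ℝ) :
    M.optimalControl m T x d = (-(1 / 2 : ℝ)) • (((M.scrR m)⁻¹ * (M.scrB m)ᵀ *
      (1 + ((1 / 2) * T) • M.scrBRB m)⁻¹) *ᵥ M.initialState x d) := by
  rw [optimalControl, optimalDeviation, Matrix.mulVec_smul, Matrix.mulVec_mulVec]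
  simp only [← Matrix.mul_assoc, M.gammaPow_neg_half_mul_half, Matrix.one_mul]

theorem two_smul_kappa_mulVec_optimalControl (hκ : (M.kappa m).PosDef) (hT : 0 ≤ T)
    (x d : Fin n → ℝ) :
    (2 : ℝ) • (M.kappa m *ᵥ M.optimalControl m T x d)
      = -((M.scrB m)ᵀ *ᵥ (M.initialState x d + T • (M.scrB m *ᵥ M.optimalControl m T x d))) := by
  have hdet := (Matrix.isUnit_iff_isUnit_det _).1 hκ.isUnit
  have hstate : M.initialState x d + T • (M.scrB m *ᵥ M.optimalControl m T x d)
      = (1 + ((1 / 2) * T) • M.scrBRB m)⁻¹ *ᵥ M.initialState x d := by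
    have hend := M.explicitState_eq_mulVec hκ x d hT T
    rw [sub_self, mul_zero, zero_smul, add_zero, Matrix.one_mul] at hend
    rw [← hend, explicitState, optimalControl_eq, Matrix.mulVec_smul, Matrix.mulVec_mulVec,
      scrBRB, Matrix.smul_mulVec]
    simp only [← Matrix.mul_assoc]
    module
  rw [hstate, optimalControl_eq, M.scrR_eq_kappa, Matrix.mulVec_smul, smul_smul,
    Matrix.mulVec_mulVec, Matrix.mulVec_mulVec]
  simp only [← Matrix.mul_assoc, Matrix.mul_nonsing_inv _ hdet, Matrix.one_mul]
  norm_num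

theorem scaledDeviation_optimalStrategy_ae_eq (hT : 0 < T) (x d : Fin n → ℝ) (ω : Ω) :
    (fun s => M.scaledDeviation d (M.optimalStrategy m T Ω x d) s ω)
      =ᵐ[volume] fun _ => M.optimalControl m T x d := by
  filter_upwards [ae_lt_endTime T] with s hs
  rw [scaledDeviation, M.deviation_optimalStrategy_of_lt x d hT s ω hs, optimalControl]

theorem ae_eq_of_deviation_ae_eq (hT : 0 < T) {X Y : StartedProcess T Ω n} {ω : Ω}
    (hpre : X.pre = Y.pre) (hX : Integrable fun s => X.path s ω)
    (hY : Integrable fun s => Y.path s ω)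
    (hdev : ∀ᵐ s, (M.deviation d X).path s ω = (M.deviation d Y).path s ω) :
    ∀ᵐ s, X.path s ω = Y.path s ω := by
  have hresilience : ∀ r, M.resiliencePart (d - M.gamma *ᵥ X.pre) (fun s => X.path s ω) r
      = M.resiliencePart (d - M.gamma *ᵥ Y.pre) (fun s => Y.path s ω) r := fun r => by
    rw [M.resiliencePart_eq_sub_integral_deviation hT d X hX,
      M.resiliencePart_eq_sub_integral_deviation hT d Y hY, hpre,
      integral_congr_ae (ae_restrict_of_ae (hdev.mono fun s hs => congrArg (M.rho *ᵥ ·) hs))]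
  filter_upwards [hdev] with s hs
  rw [M.deviation_path_eq, M.deviation_path_eq, hresilience s] at hs
  have hgamma := congrArg (M.gammaPow (-1) *ᵥ ·) (add_right_cancel hs)
  simpa only [Matrix.mulVec_mulVec, ← M.gammaPow_one, M.gammaPow_mul, neg_add_cancel,
    M.gammaPow_zero, Matrix.one_mulVec] using hgamma

variable {M}

theorem lqCost_optimalStrategy (B K : Matrix (Fin n) (Fin n) ℝ) (h : Fin n → ℝ) (hT : 0 < T)
    (x d : Fin n → ℝ) (ω : Ω) :
    lqCost volume B K h (fun s => M.scaledDeviation d (M.optimalStrategy m T Ω x d) s ω)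
      = lqCost volume B K h fun _ : Time T => M.optimalControl m T x d :=
  lqCost_congr (M.scaledDeviation_optimalStrategy_ae_eq hT x d ω)

theorem MemPM.lqCost_optimalStrategy_le [SFinite P] {ξ : Ω → Fin n → ℝ}
    (h : M.MemPM hT ℱ P ξ x d X) (hκ : (M.kappa m).PosDef) :
    ∀ᵐ ω ∂P, lqCost volume (M.scrB m) (M.kappa m) (M.initialState x d)
        (fun s => M.scaledDeviation d (M.optimalStrategy m T Ω x d) s ω)
      ≤ lqCost volume (M.scrB m) (M.kappa m) (M.initialState x d)
        fun s => M.scaledDeviation d X s ω := by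
  filter_upwards [h.ae_memLp_scaledDeviation] with ω hω
  rw [lqCost_optimalStrategy _ _ _ hT]
  refine lqCost_const_le hκ ?_ hω
  rw [volume_real_univ_time hT.le]
  exact M.two_smul_kappa_mulVec_optimalControl hκ hT.le x d

theorem isOptimal_optimalStrategy [IsFiniteMeasure P] (hT : 0 < T) (hκ : (M.kappa m).PosDef)
    (x d : Fin n → ℝ) : M.IsOptimal m hT ℱ P x d (M.optimalStrategy m T Ω x d) := by
  have hmem := M.memPM_optimalStrategy (m := m) (ℱ := ℱ) (P := P) x d hT
  refine ⟨hmem, fun X hX => ?_⟩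
  filter_upwards [hmem.costPM_ae_eq (m := m), hX.costPM_ae_eq (m := m),
    condExp_mono (m := ℱ (startTime hT))
      (integrable_lqCost (M.scrB m) (M.kappa m) (M.initialState x d) hmem.memLp_scaledDeviation)
      (integrable_lqCost _ _ _ hX.memLp_scaledDeviation) (hX.lqCost_optimalStrategy_le hκ)]
    with ω hcost hcostX hle
  rw [hcost, hcostX]
  exact sub_le_sub_right hle _

theorem IsOptimal.lqCost_ae_eq [IsFiniteMeasure P] (h : M.IsOptimal m hT ℱ P x d X)
    (hκ : (M.kappa m).PosDef) :
    ∀ᵐ ω ∂P, lqCost volume (M.scrB m) (M.kappa m) (M.initialState x d)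
        (fun s => M.scaledDeviation d (M.optimalStrategy m T Ω x d) s ω)
      = lqCost volume (M.scrB m) (M.kappa m) (M.initialState x d)
        fun s => M.scaledDeviation d X s ω := by
  have hmem := M.memPM_optimalStrategy (m := m) (ℱ := ℱ) (P := P) x d hT
  have hle := h.1.lqCost_optimalStrategy_le hκ
  have hint := integrable_lqCost (M.scrB m) (M.kappa m) (M.initialState x d)
    hmem.memLp_scaledDeviation
  have hintX := integrable_lqCost (M.scrB m) (M.kappa m) (M.initialState x d)
    h.1.memLp_scaledDeviation
  refine (integral_eq_iff_of_ae_le hint hintX hle).1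
    (le_antisymm (integral_mono_ae hint hintX hle) ?_)
  rw [← integral_condExp (ℱ.le (startTime hT)),
    ← integral_condExp (f := fun ω => lqCost _ _ _ _ fun s =>
      M.scaledDeviation d (M.optimalStrategy m T Ω x d) s ω) (ℱ.le (startTime hT))]
  refine integral_mono_ae integrable_condExp integrable_condExp ?_
  filter_upwards [hmem.costPM_ae_eq (m := m), h.1.costPM_ae_eq (m := m), h.2 _ hmem]
    with ω hcost hcostX hopt
  rw [hcost, hcostX] at hopt
  exact (sub_le_sub_iff_right _).1 hopt

theorem IsOptimal.scaledDeviation_ae_eq [IsFiniteMeasure P] (h : M.IsOptimal m hT ℱ P x d X)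
    (hκ : (M.kappa m).PosDef) :
    ∀ᵐ ω ∂P, ∀ᵐ s, M.scaledDeviation d X s ω = M.optimalControl m T x d := by
  filter_upwards [h.lqCost_ae_eq hκ, h.1.ae_memLp_scaledDeviation] with ω heq hω
  rw [lqCost_optimalStrategy _ _ _ hT] at heq
  refine ae_eq_of_lqCost_eq_lqCost_const hκ ?_ hω heq
  rw [volume_real_univ_time hT.le]
  exact M.two_smul_kappa_mulVec_optimalControl hκ hT.le x d

theorem IsOptimal.path_ae_eq [IsFiniteMeasure P] (h : M.IsOptimal m hT ℱ P x d X)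
    (hκ : (M.kappa m).PosDef) :
    ∀ᵐ ω ∂P, ∀ᵐ s, X.path s ω = (M.optimalStrategy m T Ω x d).path s ω := by
  filter_upwards [h.scaledDeviation_ae_eq hκ, h.1.integrable_path] with ω hω hX
  refine M.ae_eq_of_deviation_ae_eq (d := d) hT h.1.initial hX
    (M.integrable_optimalStrategy x d ω) ?_
  filter_upwards [hω, M.scaledDeviation_optimalStrategy_ae_eq (m := m) hT x d ω] with s hs hs'
  rw [← gammaPow_half_mulVec_scaledDeviation, hs, ← hs', gammaPow_half_mulVec_scaledDeviation]

theorem IsOptimal.eq_optimalStrategy [IsFiniteMeasure P] (h : M.IsOptimal m hT ℱ P x d X)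
    (hκ : (M.kappa m).PosDef) : ∀ᵐ p ∂((volume : Measure (Time T)).prod P),
      X.path p.1 p.2 = (M.optimalStrategy m T Ω x d).path p.1 p.2 := by
  have hset : MeasurableSet {p : Time T × Ω |
      X.path p.1 p.2 = (M.optimalStrategy m T Ω x d).path p.1 p.2} :=
    measurableSet_eq_fun
      (stronglyMeasurable_uncurry_of_isStronglyProgressive hT h.1.prog).measurable
      (stronglyMeasurable_uncurry_of_isStronglyProgressive hT
        (M.memPM_optimalStrategy (ℱ := ℱ) (P := P) x d hT).prog).measurable
  exact (Measure.ae_prod_iff_ae_ae hset).2 ((Measure.ae_ae_comm hset).2 (h.path_ae_eq hκ))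

end OWModel

end TradeExecution

theorem mainTheorem10_general {n m : ℕ} {T : ℝ} (hT : 0 < T)
    {Ω : Type*} {mΩ : MeasurableSpace Ω} (P : Measure Ω) [IsProbabilityMeasure P]
    (ℱ : Filtration (Time T) mΩ) (W : Fin m → Time T → Ω → ℝ)
    (hW : IsBrownianMotion ℱ P W) (M : OWModel n) (x d : Fin n → ℝ) (hκ : (M.kappa m).PosDef) :
    IsUnit (M.scrR m) ∧
    (∀ s : Time T, IsUnit (1 + ((1 / 2) * (T - s)) • M.scrBRB m)) ∧
    IsRiccatiSolution hT ℱ P W (fun _ _ => M.scrA m) (fun _ _ => M.scrB m)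
      (fun _ _ => M.scrQ) (fun _ _ => M.scrR m) (fun k _ _ => M.scrC m k)
      (fun s _ => M.explicitY m T s) (fun _ _ _ => 0) ∧
    (∀ (Y : Time T → Ω → Matrix (Fin n) (Fin n) ℝ)
        (Z : Fin m → Time T → Ω → Matrix (Fin n) (Fin n) ℝ),
      IsRiccatiSolution hT ℱ P W (fun _ _ => M.scrA m) (fun _ _ => M.scrB m)
        (fun _ _ => M.scrQ) (fun _ _ => M.scrR m) (fun k _ _ => M.scrC m k) Y Z →
      (∀ᵐ ω ∂P, ∀ s : Time T, Y s ω = M.explicitY m T s) ∧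
      ∀ k, ∀ᵐ p ∂((volume : Measure (Time T)).prod P), Z k p.1 p.2 = 0) ∧
    (∀ s : Time T,
      feedback (M.scrB m) M.scrQ (M.scrR m) (M.scrC m) (M.explicitY m T s) (fun _ => 0)
        = -((M.scrR m)⁻¹ * (M.scrB m)ᵀ * M.explicitY m T s)) ∧
    IsOptimalStateSolution hT ℱ P W (fun _ _ => M.scrA m) (fun _ _ => M.scrB m)
      (fun s _ => feedback (M.scrB m) M.scrQ (M.scrR m) (M.scrC m) (M.explicitY m T s)
        (fun _ => 0))
      (fun k _ _ => M.scrC m k) (M.initialState x d) (fun s _ => M.explicitState m T x d s) ∧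
    (∀ H : Time T → Ω → Fin n → ℝ,
      IsOptimalStateSolution hT ℱ P W (fun _ _ => M.scrA m) (fun _ _ => M.scrB m)
        (fun s _ => feedback (M.scrB m) M.scrQ (M.scrR m) (M.scrC m) (M.explicitY m T s)
          (fun _ => 0))
        (fun k _ _ => M.scrC m k) (M.initialState x d) H →
      ∀ᵐ ω ∂P, ∀ s : Time T, H s ω = M.explicitState m T x d s) ∧
    ∃ X : StartedProcess T Ω n,
      M.IsOptimal m hT ℱ P x d X ∧
      (∀ X' : StartedProcess T Ω n, M.IsOptimal m hT ℱ P x d X' →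
        ∀ᵐ p ∂((volume : Measure (Time T)).prod P), X'.path p.1 p.2 = X.path p.1 p.2) ∧
      M.MemFV m hT ℱ P (fun _ => 0) x d X ∧
      X.pre = x ∧
      (∀ ω, X.path (endTime hT) ω = 0) ∧
      (∀ (s : Time T) (ω : Ω), (s : ℝ) < T →
        X.path s ω =
          (-(1 / 2 : ℝ)) • ((M.gammaPow (-(1 / 2)) *
              ((M.scrR m)⁻¹ * (M.scrB m)ᵀ * (1 + ((1 / 2) * T) • M.scrBRB m)⁻¹
                + (2 : ℝ) • 1)) *ᵥ M.initialState x d)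
          + (s : ℝ) • ((1 / 2 : ℝ) • ((M.gammaPow (-(1 / 2)) * M.scrBRB m *
              (1 + ((1 / 2) * T) • M.scrBRB m)⁻¹) *ᵥ M.initialState x d))) ∧
      M.IsFVDeviation P d X (M.deviation d X) ∧
      (M.deviation d X).pre = d ∧
      (∀ ω, (M.deviation d X).path (endTime hT) ω =
        (M.gammaPow (1 / 2) * (1 + ((1 / 2) * T) • M.scrBRB m)⁻¹) *ᵥ M.initialState x d) ∧
      (∀ (s : Time T) (ω : Ω), (s : ℝ) < T →
        (M.deviation d X).path s ω =
          (-(1 / 2 : ℝ)) • ((M.gammaPow (1 / 2) * (M.scrR m)⁻¹ * (M.scrB m)ᵀ *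
              (1 + ((1 / 2) * T) • M.scrBRB m)⁻¹) *ᵥ M.initialState x d)) := by
  have hintegrable := ae_of_all P (M.integrable_optimalStrategy (m := m) (T := T) (Ω := Ω) x d)
  refine ⟨M.isUnit_scrR hκ, fun s => M.isUnit_one_add_half_mul_sub_smul_scrBRB hκ s.2.2,
    M.isRiccatiSolution_explicitY hT hκ,
    fun Y Z h => ⟨M.eq_explicitY_of_isRiccatiSolution hT hW hκ h,
      M.integrand_eq_zero_of_isRiccatiSolution hT hW hκ h⟩,
    fun s => M.feedback_eq _ _, M.isOptimalStateSolution_explicitState hκ x d hT,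
    fun H h => M.eq_explicitState_of_isOptimalStateSolution hκ x d hT hW h,
    M.optimalStrategy m T Ω x d, OWModel.isOptimal_optimalStrategy hT hκ x d,
    fun X hX => hX.eq_optimalStrategy hκ, M.memFV_optimalStrategy x d hT, rfl,
    M.optimalStrategy_endTime x d hT, fun s _ hs => if_pos hs,
    M.isFVDeviation_deviation hT d _ hintegrable, rfl,
    M.deviation_optimalStrategy_endTime x d hκ hT, M.deviation_optimalStrategy_of_lt x d hT⟩

theorem mainTheorem10 {n m : ℕ} {T : ℝ} (hT : 0 < T)
    {Ω : Type*} {mΩ : MeasurableSpace Ω} (P : Measure Ω) [IsProbabilityMeasure P]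
    (ℱ : Filtration (Time T) mΩ) (W : Fin m → Time T → Ω → ℝ)
    (hW : IsBrownianMotion ℱ P W) (hℱ : IsAugmentedNaturalFiltration ℱ P W)
    (M : OWModel n) (hρ : M.rho ≠ 0) (x d : Fin n → ℝ) (hxd : d ≠ M.gamma *ᵥ x)
    (hκ : (M.kappa m).PosDef) :
    -- the inverse matrices in the explicit formulas exist
    IsUnit (M.scrR m) ∧
    (∀ s : Time T, IsUnit (1 + ((1 / 2) * (T - s)) • M.scrBRB m)) ∧
    -- the explicit solution of the Riccati BSDE, and its uniqueness
    IsRiccatiSolution hT ℱ P W (fun _ _ => M.scrA m) (fun _ _ => M.scrB m)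
      (fun _ _ => M.scrQ) (fun _ _ => M.scrR m) (fun k _ _ => M.scrC m k)
      (fun s _ => M.explicitY m T s) (fun _ _ _ => 0) ∧
    (∀ (Y : Time T → Ω → Matrix (Fin n) (Fin n) ℝ)
        (Z : Fin m → Time T → Ω → Matrix (Fin n) (Fin n) ℝ),
      IsRiccatiSolution hT ℱ P W (fun _ _ => M.scrA m) (fun _ _ => M.scrB m)
        (fun _ _ => M.scrQ) (fun _ _ => M.scrR m) (fun k _ _ => M.scrC m k) Y Z →
      (∀ᵐ ω ∂P, ∀ s : Time T, Y s ω = M.explicitY m T s) ∧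
      ∀ k, ∀ᵐ p ∂((volume : Measure (Time T)).prod P), Z k p.1 p.2 = 0) ∧
    -- the feedback matrix `θ`
    (∀ s : Time T,
      feedback (M.scrB m) M.scrQ (M.scrR m) (M.scrC m) (M.explicitY m T s) (fun _ => 0)
        = -((M.scrR m)⁻¹ * (M.scrB m)ᵀ * M.explicitY m T s)) ∧
    -- the explicit solution of the SDE of the optimal state, and its uniqueness
    IsOptimalStateSolution hT ℱ P W (fun _ _ => M.scrA m) (fun _ _ => M.scrB m)
      (fun s _ => feedback (M.scrB m) M.scrQ (M.scrR m) (M.scrC m) (M.explicitY m T s)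
        (fun _ => 0))
      (fun k _ _ => M.scrC m k) (M.initialState x d) (fun s _ => M.explicitState m T x d s) ∧
    (∀ H : Time T → Ω → Fin n → ℝ,
      IsOptimalStateSolution hT ℱ P W (fun _ _ => M.scrA m) (fun _ _ => M.scrB m)
        (fun s _ => feedback (M.scrB m) M.scrQ (M.scrR m) (M.scrC m) (M.explicitY m T s)
          (fun _ => 0))
        (fun k _ _ => M.scrC m k) (M.initialState x d) H →
      ∀ᵐ ω ∂P, ∀ s : Time T, H s ω = M.explicitState m T x d s) ∧
    -- the unique optimal strategy and its deviation
    ∃ X : StartedProcess T Ω n,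
      M.IsOptimal m hT ℱ P x d X ∧
      (∀ X' : StartedProcess T Ω n, M.IsOptimal m hT ℱ P x d X' →
        ∀ᵐ p ∂((volume : Measure (Time T)).prod P), X'.path p.1 p.2 = X.path p.1 p.2) ∧
      M.MemFV m hT ℱ P (fun _ => 0) x d X ∧
      X.pre = x ∧
      (∀ ω, X.path (endTime hT) ω = 0) ∧
      (∀ (s : Time T) (ω : Ω), (s : ℝ) < T →
        X.path s ω =
          (-(1 / 2 : ℝ)) • ((M.gammaPow (-(1 / 2)) *
              ((M.scrR m)⁻¹ * (M.scrB m)ᵀ * (1 + ((1 / 2) * T) • M.scrBRB m)⁻¹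
                + (2 : ℝ) • 1)) *ᵥ M.initialState x d)
          + (s : ℝ) • ((1 / 2 : ℝ) • ((M.gammaPow (-(1 / 2)) * M.scrBRB m *
              (1 + ((1 / 2) * T) • M.scrBRB m)⁻¹) *ᵥ M.initialState x d))) ∧
      M.IsFVDeviation P d X (M.deviation d X) ∧
      (M.deviation d X).pre = d ∧
      (∀ ω, (M.deviation d X).path (endTime hT) ω =
        (M.gammaPow (1 / 2) * (1 + ((1 / 2) * T) • M.scrBRB m)⁻¹) *ᵥ M.initialState x d) ∧
      (∀ (s : Time T) (ω : Ω), (s : ℝ) < T →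
        (M.deviation d X).path s ω =
          (-(1 / 2 : ℝ)) • ((M.gammaPow (1 / 2) * (M.scrR m)⁻¹ * (M.scrB m)ᵀ *
              (1 + ((1 / 2) * T) • M.scrBRB m)⁻¹) *ᵥ M.initialState x d)) :=
  mainTheorem10_general hT P ℱ W hW M x d hκ
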